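/- Let $A$ be a C*-algebra and let $(E,\varphi)$ be a Hilbert $A$-bimodule, that is, $E$ is a right Hilbert $A$-module (with inner product $\langle\cdot,\cdot\rangle_A$, conjugate linear in the first variable) and $\varphi:A\to\mathcal L(E)$ is an injective $*$-homomorphism into the bounded adjointable operators on $E$. Assume that $E$ is full (the values of the inner product span a dense subspace of $A$), that $E\otimes_A E$ is full (the elements $\langle\xi,\varphi(a)\eta\rangle_A$, $\xi,\eta\in E$, $a\in A$, span a dense subspace of $A$; if $E$ is full, this is automatic when $\varphi(A)E$ is dense in $E$, e.g. when $A$ and $\varphi$ are unital), and that $\varphi(A)\cap\mathcal K(E)=\{0\}$, where $\mathcal K(E)$ is the closed span of the operators $\theta_{\xi,\eta}(\zeta)=\xi\langle\eta,\zeta\rangle_A$. Let $\mathcal E_+=\bigoplus_{n\ge0}E^{\otimes n}$ be the Fock module ($E^{\otimes0}=A$, $E^{\otimes n}=E\otimes_A\cdots\otimes_AE$), let $T_\xi$ $(\xi\in E)$ be the creation operators on $\mathcal E_+$, $T_\xi(a)=\xi a$ and $T_\xi(\xi_1\otimes\cdots\otimes\xi_n)=\xi\otimes\xi_1\otimes\cdots\otimes\xi_n$,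 and let $\mathcal O_E=\mathcal T_E\subset\mathcal L(\mathcal E_+)$ be the C*-algebra generated by them (since $\varphi(A)\cap\mathcal K(E)=\{0\}$, the Toeplitz algebra $\mathcal T_E$ is identified with the Cuntz–Pimsner algebra $\mathcal O_E$). For $\xi\in E^{\otimes k}$ let $T_\xi$ be the operator of tensoring on the left by $\xi$ (for $k=0$, left multiplication by $\xi\in A$). Let $\mathcal F_E\subset\mathcal O_E$ be the C*-subalgebra generated by all $T_\xi T_\eta^*$ with $\xi,\eta\in E^{\otimes k}$, $k\ge0$, and for $n\ge0$ let $J_n\subset\mathcal F_E$ be the C*-subalgebra generated by those with $k\ge n$. Let $\lambda:\mathbb T\to\mathrm{Aut}(\mathcal O_E)$ be the gauge action, $\lambda_t(T_\xi)=tT_\xi$ for $\xi\in E$; let $\mathcal O_E\rtimes_\lambda\mathbb T$ be the crossed product, i.e. the completion of $C(\mathbb T,\mathcal O_E)$ in the norm given by the integrated forms $f\mapsto\int_{\mathbb T}\pi(f(t))U_t\,dt$ of all covariant representations $(\pi,U)$, $U_t\pi(x)U_t^*=\pi(\lambda_t(x))$; and let $\widehat\lambda:\mathbb Z\to\mathrm{Aut}(\mathcal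 O_E\rtimes_\lambda\mathbb T)$ be the dual action, $(\widehat\lambda_kf)(t)=t^kf(t)$ for $f\in C(\mathbb T,\mathcal O_E)$. Then there are an embedding (injective $*$-homomorphism) $\epsilon:\mathcal F_E\hookrightarrow\mathcal O_E\rtimes_\lambda\mathbb T$ onto a corner, i.e. onto $p(\mathcal O_E\rtimes_\lambda\mathbb T)p$ for a projection $p$ in the multiplier algebra of $\mathcal O_E\rtimes_\lambda\mathbb T$, where $p=\epsilon(1)$ if $\mathcal F_E$ has a unit $1$, and essential closed two-sided ideals $I_n$ $(n\in\mathbb Z)$ of $\mathcal O_E\rtimes_\lambda\mathbb T$ such that: 1. for all $n\in\mathbb Z$, $\mathcal F_E$ is strongly Morita equivalent to $I_n$, and $A$ is strongly Morita equivalent to $I_n/I_{n+1}$; 2. for all $n\ge0$, $\epsilon(J_n)=p\,I_n\,p$ (thus $\epsilon(J_n)=\epsilon(1)I_n\epsilon(1)$ in the unital case); 3. $I_n\subset I_m$ if $m\le n$; 4. $\bigcap_nI_n=\{0\}$; 5. $\overline{\bigcup_nI_n}=\mathcal O_E\rtimes_\lambda\mathbb T$; 6. $\widehat\lambda_k(I_n)=I_{n+k}$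 for all $k,n\in\mathbb Z$. -/

import Mathlib

noncomputable section

open scoped ENNReal MultiplierAlgebra ComplexConjugate

universe u v w

namespace CuntzPimsner

/-! ### Positive elements -/

section Positive

variable {A : Type u} [NonUnitalCStarAlgebra A]

/-- Positive elements of a C⋆-algebra: those of the form `b⋆ b`. -/
def IsPos (a : A) : Prop := ∃ b : A, a = star b * b

theorem isPos_iff_nonneg (a : A) :
    IsPos a ↔ (CStarAlgebra.spectralOrder A).le 0 a := by
  let _ := CStarAlgebra.spectralOrder A
  let _ := CStarAlgebra.spectralOrderedRing A
  exact CStarAlgebra.nonneg_iff_eq_star_mul_self.symm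

theorem IsPos.zero : IsPos (0 : A) := ⟨0, by simp⟩

theorem IsPos.add {a b : A} (ha : IsPos a) (hb : IsPos b) : IsPos (a + b) := by
  rw [isPos_iff_nonneg] at *
  let _ := CStarAlgebra.spectralOrder A
  let _ := CStarAlgebra.spectralOrderedRing A
  exact add_nonneg ha hb

theorem IsPos.sum {ι : Type*} (s : Finset ι) (f : ι → A) (h : ∀ i ∈ s, IsPos (f i)) :
    IsPos (∑ i ∈ s, f i) :=
  Finset.sum_induction f IsPos (fun _ _ => IsPos.add) IsPos.zero h

theorem isClosed_isPos : IsClosed {a : A | IsPos a} := by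
  let _ := CStarAlgebra.spectralOrder A
  let _ := CStarAlgebra.spectralOrderedRing A
  have : {a : A | IsPos a} = Set.Ici 0 := by
    ext a; exact isPos_iff_nonneg a
  rw [this]
  exact isClosed_Ici

theorem IsPos.norm_le {a b : A} (ha : IsPos a) (h : IsPos (b - a)) : ‖a‖ ≤ ‖b‖ := by
  rw [isPos_iff_nonneg] at *
  let _ := CStarAlgebra.spectralOrder A
  let _ := CStarAlgebra.spectralOrderedRing A
  exact CStarAlgebra.norm_le_norm_of_nonneg_of_le ha (sub_nonneg.1 h)

theorem IsPos.star_eq {a : A} (ha : IsPos a) : star a = a := by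
  obtain ⟨b, rfl⟩ := ha
  simp

theorem IsPos.conj {a : A} (ha : IsPos a) (c : A) : IsPos (star c * a * c) := by
  obtain ⟨b, rfl⟩ := ha
  exact ⟨b * c, by simp [mul_assoc]⟩

theorem IsPos.conj_le {a : A} (ha : IsPos a) (c : A) :
    IsPos ((‖a‖ : ℂ) • (star c * c) - star c * a * c) := by
  rw [isPos_iff_nonneg]
  let _ := CStarAlgebra.spectralOrder A
  let _ := CStarAlgebra.spectralOrderedRing A
  have := CStarAlgebra.star_left_conjugate_le_norm_smul (a := c) (b := a) ha.star_eq
  rw [← Complex.coe_smul] at this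
  exact sub_nonneg.2 this

end Positive

/-! ### Hilbert modules -/

/-- A complex vector space with a right multiplication by `A` and a positive semidefinite
`A`-valued inner product, conjugate linear in the first variable. -/
class PreHilbert (A : Type u) (X : Type v) [NonUnitalCStarAlgebra A]
    [AddCommGroup X] [Module ℂ X] where
  act : X → A → X
  ip : X → X → A
  ip_add_right : ∀ x y z : X, ip x (y + z) = ip x y + ip x z
  ip_smul_right : ∀ (c : ℂ) (x y : X), ip x (c • y) = c • ip x y
  ip_act_right : ∀ (x y : X) (a : A), ip x (act y a) = ip x y * a
  star_ip : ∀ x y : X, star (ip x y) = ip y x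
  ip_self_pos : ∀ x : X, IsPos (ip x x)

/-- A right Hilbert `A`-module: `X` is complete in the norm `‖x‖ = ‖⟨x, x⟩‖ ^ (1 / 2)`
(so `⟨x, x⟩ = 0` only if `x = 0`).  That `act` makes `X` a right `A`-module follows from these
axioms: see `act_add`, `add_act`, `act_act`, `smul_act`, `act_smul` below. -/
class HilbertModule (A : Type u) (X : Type v) [NonUnitalCStarAlgebra A]
    [NormedAddCommGroup X] [NormedSpace ℂ X] [CompleteSpace X] extends PreHilbert A X where
  norm_sq : ∀ x : X, ‖x‖ ^ 2 = ‖ip x x‖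

namespace PreHilbert

section

variable {A : Type u} {X : Type v} [NonUnitalCStarAlgebra A] [AddCommGroup X] [Module ℂ X]
  [PreHilbert A X]

theorem ip_add_left (x y z : X) : ip (A := A) (x + y) z = ip x z + ip y z := by
  rw [← star_ip, ip_add_right, star_add, star_ip, star_ip]

theorem ip_smul_left (c : ℂ) (x y : X) : ip (A := A) (c • x) y = conj c • ip x y := by
  rw [← star_ip, ip_smul_right, star_smul, star_ip]; rfl

theorem ip_act_left (x y : X) (a : A) : ip (act x a) y = star a * ip x y := by
  rw [← star_ip, ip_act_right, star_mul, star_ip]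

theorem ip_zero_right (x : X) : ip (A := A) x 0 = 0 := by
  simpa using ip_smul_right (A := A) 0 x 0

theorem ip_zero_left (x : X) : ip (A := A) 0 x = 0 := by
  simpa using ip_smul_left (A := A) 0 x x

theorem ip_neg_right (x y : X) : ip (A := A) x (-y) = -ip x y := by
  simpa using ip_smul_right (A := A) (-1) x y

theorem ip_sub_right (x y z : X) : ip (A := A) x (y - z) = ip x y - ip x z := by
  rw [sub_eq_add_neg, ip_add_right, ip_neg_right, sub_eq_add_neg]

theorem ip_sub_left (x y z : X) : ip (A := A) (x - y) z = ip x z - ip y z := by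
  rw [← star_ip, ip_sub_right, star_sub, star_ip, star_ip]

/-- The Cauchy–Schwarz inequality. -/
theorem norm_ip_sq_le (x y : X) :
    ‖ip (A := A) x y‖ ^ 2 ≤ ‖ip (A := A) x x‖ * ‖ip (A := A) y y‖ := by
  set c : A := ip x y with hc
  set M := ‖ip (A := A) x x‖ with hM
  have key : ∀ t : ℝ, 2 * t * ‖c‖ ^ 2 ≤ t ^ 2 * M * ‖c‖ ^ 2 + ‖ip (A := A) y y‖ := by
    intro t
    have h1 := ip_self_pos (A := A) (act x ((t : ℂ) • c) - y)
    have h2 : ip (A := A) (act x ((t : ℂ) • c) - y) (act x ((t : ℂ) • c) - y)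
        = ((t ^ 2 : ℝ) : ℂ) • (star c * ip x x * c) - ((2 * t : ℝ) : ℂ) • (star c * c)
          + ip y y := by
      have h3 : ip (A := A) y x = star c := by rw [hc, star_ip]
      simp only [ip_sub_right, ip_sub_left, ip_act_left, ip_act_right, h3, ← hc, star_smul,
        smul_mul_assoc, mul_smul_comm, Complex.star_def, Complex.conj_ofReal]
      push_cast
      simp only [sub_mul, smul_mul_assoc, smul_sub, smul_smul, mul_assoc, pow_two, two_mul,
        add_smul]
      abel
    rw [h2] at h1
    have h4 := (ip_self_pos (A := A) x).conj_le ((t : ℂ) • c)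
    have h5 := h1.add h4
    have h6 : ((t ^ 2 : ℝ) : ℂ) • (star c * ip x x * c) - ((2 * t : ℝ) : ℂ) • (star c * c)
          + ip y y + ((‖ip (A := A) x x‖ : ℂ) • (star ((t : ℂ) • c) * ((t : ℂ) • c)) -
            star ((t : ℂ) • c) * ip x x * ((t : ℂ) • c))
        = (((t ^ 2 * M : ℝ) : ℂ) • (star c * c) + ip y y) - ((2 * t : ℝ) : ℂ) • (star c * c) := by
      simp only [star_smul, smul_mul_assoc, mul_smul_comm, smul_smul, Complex.star_def,
        Complex.conj_ofReal]
      push_cast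
      rw [← hM, show (M : ℂ) * ((t : ℂ) * t) = (t : ℂ) ^ 2 * M by ring,
        show (t : ℂ) * t = (t : ℂ) ^ 2 by ring]
      abel
    rw [h6] at h5
    rcases le_total t 0 with ht | ht
    · have : 0 ≤ t ^ 2 * M * ‖c‖ ^ 2 + ‖ip (A := A) y y‖ := by positivity
      nlinarith [sq_nonneg ‖c‖]
    · have hp : IsPos (((2 * t : ℝ) : ℂ) • (star c * c)) := by
        refine ⟨((Real.sqrt (2 * t) : ℝ) : ℂ) • c, ?_⟩
        simp only [star_smul, smul_mul_assoc, mul_smul_comm, smul_smul, Complex.star_def,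
          Complex.conj_ofReal]
        rw [← Complex.ofReal_mul, Real.mul_self_sqrt (by positivity)]
      have h7 := hp.norm_le h5
      rw [norm_smul, CStarRing.norm_star_mul_self, Complex.norm_real, Real.norm_eq_abs,
        abs_of_nonneg (by positivity)] at h7
      refine le_trans (by nlinarith) (h7.trans ((norm_add_le _ _).trans ?_))
      rw [norm_smul, CStarRing.norm_star_mul_self, Complex.norm_real, Real.norm_eq_abs,
        abs_of_nonneg (by positivity)]
      nlinarith
  have hM0 : 0 ≤ M := norm_nonneg _
  rcases hM0.eq_or_lt with h0 | h0
  · rw [← h0] at key ⊢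
    by_contra hcon
    have hc0 : 0 < ‖c‖ ^ 2 := by linarith
    have := key ((‖ip (A := A) y y‖ + 1) / ‖c‖ ^ 2)
    rw [mul_assoc, div_mul_cancel₀ _ hc0.ne'] at this
    nlinarith [norm_nonneg (ip (A := A) y y)]
  · have := key M⁻¹
    have h8 : M⁻¹ ^ 2 * M = M⁻¹ := by field_simp
    rw [h8] at this
    have h9 : M⁻¹ * ‖c‖ ^ 2 ≤ ‖ip (A := A) y y‖ := by linarith
    rwa [inv_mul_le_iff₀ h0] at h9

variable (A X) in
theorem seminormCore :
    let _ : Norm X := ⟨fun x => √‖ip (A := A) x x‖⟩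
    SeminormedSpace.Core ℂ X := by
  let _ : Norm X := ⟨fun x => √‖ip (A := A) x x‖⟩
  have hn : ∀ x : X, ‖x‖ = √‖ip (A := A) x x‖ := fun _ => rfl
  have hcs : ∀ x y : X, ‖ip (A := A) x y‖ ≤ ‖x‖ * ‖y‖ := fun x y => by
    rw [hn, hn, ← Real.sqrt_mul (norm_nonneg _)]
    exact Real.le_sqrt_of_sq_le (norm_ip_sq_le x y)
  have hsq : ∀ x : X, ‖x‖ ^ 2 = ‖ip (A := A) x x‖ := fun x => Real.sq_sqrt (norm_nonneg _)
  have h0 : ∀ x : X, 0 ≤ ‖x‖ := fun x => Real.sqrt_nonneg _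
  refine ⟨h0, fun c x => ?_, fun x y => ?_⟩
  · rw [hn, hn, ip_smul_right, ip_smul_left, smul_smul, norm_smul, norm_mul, RCLike.norm_conj,
      Real.sqrt_mul (by positivity), Real.sqrt_mul_self (norm_nonneg _)]
  · refine abs_le_of_sq_le_sq' ?_ (add_nonneg (h0 x) (h0 y)) |>.2
    rw [hsq, ip_add_left, ip_add_right, ip_add_right]
    calc _ ≤ ‖ip (A := A) x x‖ + ‖ip (A := A) x y‖ + (‖ip (A := A) y x‖ + ‖ip (A := A) y y‖) :=
          (norm_add_le _ _).trans (add_le_add (norm_add_le _ _) (norm_add_le _ _))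
      _ ≤ ‖x‖ ^ 2 + ‖x‖ * ‖y‖ + (‖y‖ * ‖x‖ + ‖y‖ ^ 2) := by
          gcongr
          · rw [hsq]
          · exact hcs x y
          · exact hcs y x
          · rw [hsq]
      _ = _ := by ring

end

end PreHilbert

open PreHilbert HilbertModule

section Basic

variable {A : Type u} {X : Type v} [NonUnitalCStarAlgebra A] [NormedAddCommGroup X]
  [NormedSpace ℂ X] [CompleteSpace X] [HilbertModule A X]

theorem norm_ip_le (x y : X) : ‖ip (A := A) x y‖ ≤ ‖x‖ * ‖y‖ := by
  have h := norm_ip_sq_le (A := A) x y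
  rw [← norm_sq, ← norm_sq, ← mul_pow] at h
  exact abs_le_of_sq_le_sq' h (by positivity) |>.2

theorem eq_of_ip {x y : X} (h : ∀ z : X, ip (A := A) z x = ip z y) : x = y := by
  rw [← sub_eq_zero, ← norm_eq_zero, ← sq_eq_zero_iff, norm_sq (A := A), ip_sub_right, h,
    sub_self, norm_zero]

theorem act_add (x : X) (a b : A) : act x (a + b) = act x a + act x b :=
  eq_of_ip (A := A) fun z => by simp only [ip_act_right, ip_add_right, mul_add]

theorem add_act (x y : X) (a : A) : act (x + y) a = act x a + act y a :=
  eq_of_ip (A := A) fun z => by simp only [ip_act_right, ip_add_right, add_mul]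

theorem act_act (x : X) (a b : A) : act (act x a) b = act x (a * b) :=
  eq_of_ip (A := A) fun z => by simp only [ip_act_right, mul_assoc]

theorem smul_act (c : ℂ) (x : X) (a : A) : act (c • x) a = c • act x a :=
  eq_of_ip (A := A) fun z => by simp only [ip_act_right, ip_smul_right, smul_mul_assoc]

theorem act_smul (c : ℂ) (x : X) (a : A) : act x (c • a) = c • act x a :=
  eq_of_ip (A := A) fun z => by simp only [ip_act_right, ip_smul_right, mul_smul_comm]

theorem norm_act_le (x : X) (a : A) : ‖act x a‖ ≤ ‖x‖ * ‖a‖ := by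
  refine abs_le_of_sq_le_sq' ?_ (by positivity) |>.2
  rw [norm_sq (A := A), ip_act_left, ip_act_right, mul_pow, norm_sq (A := A)]
  calc _ ≤ ‖star a‖ * (‖ip (A := A) x x‖ * ‖a‖) :=
        (norm_mul_le _ _).trans (by gcongr; exact norm_mul_le _ _)
    _ = _ := by rw [norm_star]; ring

end Basic

/-- A C⋆-algebra is a Hilbert module over itself, with `⟨a, b⟩ = a⋆ b`. -/
instance selfHilbertModule (A : Type u) [NonUnitalCStarAlgebra A] : HilbertModule A A where
  act x a := x * a
  ip x y := star x * y
  ip_add_right x y z := mul_add _ _ _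
  ip_smul_right c x y := mul_smul_comm _ _ _
  ip_act_right x y a := (mul_assoc _ _ _).symm
  star_ip x y := by simp
  ip_self_pos x := ⟨x, rfl⟩
  norm_sq x := by rw [CStarRing.norm_star_mul_self, pow_two]

variable (A : Type u) [NonUnitalCStarAlgebra A] (X : Type v) [NormedAddCommGroup X]
  [NormedSpace ℂ X] [CompleteSpace X] [HilbertModule A X]

/-- `X` is full: the values of the inner product span a dense subspace of `A`. -/
def IsFull : Prop :=
  Dense (Submodule.span ℂ {a : A | ∃ x y : X, a = ip x y} : Set A)

/-! ### Adjointable operators -/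

/-- The bounded adjointable operators on `X`, as a subalgebra of the bounded operators. -/
def adjointableSubalgebra : Subalgebra ℂ (X →L[ℂ] X) where
  carrier := {T | ∃ S : X →L[ℂ] X, ∀ x y : X, ip (A := A) (S x) y = ip x (T y)}
  mul_mem' := by
    rintro T₁ T₂ ⟨S₁, h₁⟩ ⟨S₂, h₂⟩
    exact ⟨S₂ * S₁, fun x y => by
      change ip (S₂ (S₁ x)) y = ip x (T₁ (T₂ y))
      rw [h₂, h₁]⟩
  add_mem' := by
    rintro T₁ T₂ ⟨S₁, h₁⟩ ⟨S₂, h₂⟩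
    exact ⟨S₁ + S₂, fun x y => by
      simp only [_root_.add_apply, ip_add_left, ip_add_right, h₁, h₂]⟩
  algebraMap_mem' c := ⟨conj c • 1, fun x y => by
      simp [Algebra.algebraMap_eq_smul_one, ip_smul_left, ip_smul_right]⟩

/-- The C⋆-algebra `L(X)` of bounded adjointable operators on `X`, with the operator norm. -/
def Adjointable : Type v := adjointableSubalgebra A X

namespace Adjointable

variable {A X}

instance : NormedRing (Adjointable A X) := inferInstanceAs (NormedRing (adjointableSubalgebra A X))

instance : NormedAlgebra ℂ (Adjointable A X) :=
  inferInstanceAs (NormedAlgebra ℂ (adjointableSubalgebra A X))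

/-- The underlying bounded operator. -/
def toCLM (T : Adjointable A X) : X →L[ℂ] X := T.1

instance : CoeFun (Adjointable A X) (fun _ => X → X) := ⟨fun T => T.toCLM⟩

theorem ext_ip {T S : Adjointable A X} (h : ∀ x y : X, ip (A := A) x (T y) = ip x (S y)) :
    T = S :=
  Subtype.ext (ContinuousLinearMap.ext fun y => eq_of_ip (A := A) fun x => h x y)

theorem exists_adjoint (T : Adjointable A X) :
    ∃ S : Adjointable A X, ∀ x y : X, ip (A := A) (S x) y = ip x (T y) := by
  obtain ⟨S, hS⟩ := T.2
  exact ⟨⟨S, T.1, fun x y => by rw [← star_ip, ← hS, star_ip]⟩, hS⟩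

/-- The adjoint: `⟨T⋆ x, y⟩ = ⟨x, T y⟩`. -/
instance : Star (Adjointable A X) := ⟨fun T => T.exists_adjoint.choose⟩

theorem ip_star_left (T : Adjointable A X) (x y : X) :
    ip (A := A) ((star T) x) y = ip x (T y) :=
  T.exists_adjoint.choose_spec x y

theorem ip_star_right (T : Adjointable A X) (x y : X) :
    ip (A := A) x ((star T) y) = ip (T x) y := by
  rw [← star_ip, ip_star_left, star_ip]

theorem mul_apply (T S : Adjointable A X) (x : X) : (T * S) x = T (S x) := rfl

theorem add_apply (T S : Adjointable A X) (x : X) : (T + S) x = T x + S x := rfl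

theorem smul_apply (c : ℂ) (T : Adjointable A X) (x : X) : (c • T) x = c • T x := rfl

theorem map_add (T : Adjointable A X) (x y : X) : T (x + y) = T x + T y := T.1.map_add x y

theorem map_smul (T : Adjointable A X) (c : ℂ) (x : X) : T (c • x) = c • T x := T.1.map_smul c x

instance : StarRing (Adjointable A X) where
  star_involutive T := ext_ip fun x y => by rw [ip_star_right, ip_star_left]
  star_mul T S := ext_ip fun x y => by
    simp only [ip_star_right, mul_apply]
  star_add T S := ext_ip fun x y => by
    simp only [ip_star_right, add_apply, ip_add_left, ip_add_right]

instance : StarModule ℂ (Adjointable A X) where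
  star_smul c T := ext_ip fun x y => by
    simp only [ip_star_right, smul_apply, ip_smul_left, ip_smul_right]; rfl

theorem norm_apply_le (T : Adjointable A X) (x : X) : ‖T x‖ ≤ ‖T‖ * ‖x‖ := T.1.le_opNorm x

instance : CStarRing (Adjointable A X) where
  norm_mul_self_le T := by
    rw [← sq]
    suffices h : ‖T‖ ≤ √‖star T * T‖ by
      calc ‖T‖ ^ 2 ≤ √‖star T * T‖ ^ 2 := by gcongr
        _ = _ := Real.sq_sqrt (norm_nonneg _)
    refine ContinuousLinearMap.opNorm_le_bound _ (Real.sqrt_nonneg _) fun x => ?_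
    refine abs_le_of_sq_le_sq' ?_ (by positivity) |>.2
    rw [mul_pow, Real.sq_sqrt (norm_nonneg (star T * T))]
    change ‖T x‖ ^ 2 ≤ _
    rw [norm_sq (A := A), ← ip_star_right, ← mul_apply]
    refine (norm_ip_le _ _).trans ?_
    nlinarith [norm_apply_le (star T * T) x, norm_nonneg x]

theorem isClosed : IsClosed (adjointableSubalgebra A X : Set (X →L[ℂ] X)) := by
  refine IsSeqClosed.isClosed fun T T₀ hT hlim => ?_
  let T' : ℕ → Adjointable A X := fun n => ⟨T n, hT n⟩
  have hc : CauchySeq (fun n => (star (T' n)).toCLM) := by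
    have h1 : CauchySeq T := hlim.cauchySeq
    rw [Metric.cauchySeq_iff] at h1 ⊢
    intro e he
    obtain ⟨N, hN⟩ := h1 e he
    refine ⟨N, fun m hm n hn => ?_⟩
    have := hN m hm n hn
    rw [dist_eq_norm] at this ⊢
    have h3 : star (T' m) - star (T' n) = star (T' m - T' n) := (star_sub _ _).symm
    have h2 : ‖star (T' m) - star (T' n)‖ = ‖T' m - T' n‖ := by
      rw [h3]
      exact norm_star (T' m - T' n)
    exact h2.trans_lt this
  obtain ⟨S, hS⟩ := cauchySeq_tendsto_of_complete hc
  refine ⟨S, fun x y => ?_⟩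
  have hcont : ∀ (F : ℕ → X →L[ℂ] X) (F₀ : X →L[ℂ] X) (x : X),
      Filter.Tendsto F Filter.atTop (nhds F₀) →
      Filter.Tendsto (fun n => F n x) Filter.atTop (nhds (F₀ x)) := fun F F₀ x h =>
    ((ContinuousLinearMap.apply ℂ X x).continuous.tendsto F₀).comp h
  have hipc : ∀ x : X, Continuous (fun y : X => ip (A := A) x y) := fun x => by
    refine (LipschitzWith.of_dist_le_mul (K := ‖x‖₊) fun y z => ?_).continuous
    rw [dist_eq_norm, dist_eq_norm, ← ip_sub_right]
    exact norm_ip_le _ _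
  have l1 : Filter.Tendsto (fun n => ip (A := A) x (T n y)) Filter.atTop
      (nhds (ip x (T₀ y))) := ((hipc x).tendsto _).comp (hcont T T₀ y hlim)
  have l2 : Filter.Tendsto (fun n => ip (A := A) ((star (T' n) : Adjointable A X) x) y)
      Filter.atTop (nhds (ip (S x) y)) := by
    have := ((hipc y).tendsto _).comp (hcont _ S x hS)
    have h3 := (continuous_star.tendsto _).comp this
    simp only [star_ip] at h3
    refine h3.congr fun n => ?_
    simp only [Function.comp, star_ip]
  refine tendsto_nhds_unique l2 (l1.congr fun n => ?_)
  rw [ip_star_left]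
  rfl

instance : CompleteSpace (Adjointable A X) :=
  (isClosed (A := A) (X := X)).completeSpace_coe

instance : CStarAlgebra (Adjointable A X) where

end Adjointable

section Compacts

variable {A X}

/-- The rank one operator `θ_{x,y}(z) = x ⟨y, z⟩`. -/
def theta (x y : X) : Adjointable A X :=
  ⟨LinearMap.mkContinuous
      { toFun := fun z => act x (ip (A := A) y z)
        map_add' := fun z z' => by rw [ip_add_right, act_add]
        map_smul' := fun c z => by rw [ip_smul_right, act_smul]; rfl }
      (‖x‖ * ‖y‖) fun z => (norm_act_le x _).trans (by
        rw [mul_assoc]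
        gcongr
        exact norm_ip_le y z),
    LinearMap.mkContinuous
      { toFun := fun z => act y (ip (A := A) x z)
        map_add' := fun z z' => by rw [ip_add_right, act_add]
        map_smul' := fun c z => by rw [ip_smul_right, act_smul]; rfl }
      (‖y‖ * ‖x‖) fun z => (norm_act_le y _).trans (by
        rw [mul_assoc]
        gcongr
        exact norm_ip_le x z),
    fun z z' => by
      change ip (act y (ip (A := A) x z)) z' = ip z (act x (ip (A := A) y z'))
      rw [ip_act_left, ip_act_right, star_ip]⟩

theorem theta_apply (x y z : X) : (theta x y : Adjointable A X) z = act x (ip (A := A) y z) := rfl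

end Compacts

/-- The C⋆-algebra `K(X)` of compact operators: the C⋆-subalgebra of `L(X)` generated by the
`θ_{x,y}` (whose span is already a `⋆`-subalgebra, so that this is the closure of the span). -/
def Compacts : NonUnitalStarSubalgebra ℂ (Adjointable A X) :=
  (NonUnitalStarAlgebra.adjoin ℂ {T | ∃ x y : X, T = theta x y}).topologicalClosure

/-- Strong Morita equivalence of C⋆-algebras: `A` is isomorphic to the compact operators
on a full Hilbert `B`-module. -/
def MoritaEquiv (A : Type u) (B : Type v) [NonUnitalCStarAlgebra A] [NonUnitalCStarAlgebra B] :
    Prop :=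
  ∃ (X : Type (max u v)) (_ : NormedAddCommGroup X) (_ : NormedSpace ℂ X) (_ : CompleteSpace X)
    (_ : HilbertModule B X), IsFull B X ∧ Nonempty (A ≃⋆ₐ[ℂ] Compacts B X)

/-! ### Closed ideals -/

/-- Closed two-sided ideals of a C⋆-algebra (these are automatically self-adjoint). -/
structure ClosedIdeal (B : Type u) [NonUnitalCStarAlgebra B] extends
    NonUnitalStarSubalgebra ℂ B where
  isClosed_carrier : IsClosed carrier
  mul_left_mem : ∀ (b : B) {x : B}, x ∈ carrier → b * x ∈ carrier
  mul_right_mem : ∀ (b : B) {x : B}, x ∈ carrier → x * b ∈ carrier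

namespace ClosedIdeal

variable {B : Type u} [NonUnitalCStarAlgebra B]

/-- The closed ideal `I`, regarded as a C⋆-algebra. -/
abbrev Alg (I : ClosedIdeal B) : Type u := I.toNonUnitalStarSubalgebra

instance (I : ClosedIdeal B) : IsClosed (I.toNonUnitalStarSubalgebra : Set B) :=
  I.isClosed_carrier

/-- An ideal is essential if it meets every nonzero closed ideal nontrivially. -/
def IsEssential (I : ClosedIdeal B) : Prop :=
  ∀ J : ClosedIdeal B, (∀ x ∈ I.carrier, x ∈ J.carrier → x = 0) → ∀ x ∈ J.carrier, x = 0

/-- The C⋆-algebra `C` is strongly Morita equivalent to the quotient C⋆-algebra `I / J`,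
where `I / J` is given as a C⋆-algebra `Q` with a surjective `⋆`-homomorphism `I → Q`
with kernel `J`. -/
def MoritaEquivQuotient (C : Type v) [NonUnitalCStarAlgebra C] (I J : ClosedIdeal B) : Prop :=
  J.carrier ⊆ I.carrier ∧
    ∃ (Q : Type u) (_ : NonUnitalCStarAlgebra Q) (q : I.Alg →⋆ₙₐ[ℂ] Q),
      Function.Surjective q ∧ (∀ x : I.Alg, q x = 0 ↔ (x : B) ∈ J.carrier) ∧ MoritaEquiv C Q

end ClosedIdeal

/-! ### Gram matrices -/

section Gram

variable {A X}

theorem exists_neg_part {D : Type w} [NonUnitalCStarAlgebra D] (M : D) (hM : star M = M) :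
    ∃ N R : D, N = star R * R ∧ star N = N ∧ star N * M * N = -(N * N * N) ∧
      (N = 0 → ∃ B : D, M = star B * B) := by
  let _ := CStarAlgebra.spectralOrder D
  let _ := CStarAlgebra.spectralOrderedRing D
  have hM' : IsSelfAdjoint M := hM
  have hNpos : 0 ≤ M⁻ := CFC.negPart_nonneg M
  obtain ⟨R, hR⟩ := CStarAlgebra.nonneg_iff_eq_star_mul_self.1 hNpos
  refine ⟨M⁻, R, hR, hNpos.isSelfAdjoint, ?_, fun h => ?_⟩
  · have h1 : M⁻ * M = -(M⁻ * M⁻) := by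
      conv_lhs => rw [← CFC.posPart_sub_negPart M hM', mul_sub]
      simp [CFC.posPart_sub_negPart M hM']
    rw [show star M⁻ = M⁻ from hNpos.isSelfAdjoint, h1, neg_mul]
  · exact CStarAlgebra.nonneg_iff_eq_star_mul_self.1 ((CFC.negPart_eq_zero_iff M hM').1 h)

theorem isPos_gram_aux {ι : Type w} [Fintype ι] (G : ι → ι → A)
    (hG : ∀ i j, star (G i j) = G j i)
    (h : ∀ v : ι → A, IsPos (∑ i, ∑ j, star (v i) * G i j * v j)) :
    ∃ b : ι → ι → A, ∀ i j, G i j = ∑ l, star (b l i) * b l j := by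
  classical
  let _ := CStarAlgebra.spectralOrder A
  let _ := CStarAlgebra.spectralOrderedRing A
  let M : CStarMatrix ι ι A := CStarMatrix.ofMatrix G
  have hM : star M = M := by
    ext i j
    exact hG j i
  obtain ⟨N, R, hR, hNs, h1, hB⟩ := exists_neg_part M hM
  have h2 : N * N * N = star (R * N) * (R * N) := by
    rw [star_mul, hNs, mul_assoc N (star R), ← mul_assoc (star R), ← hR, mul_assoc]
  have h3 : ∀ i, (N * N * N) i i = 0 := by
    intro i
    have e1 : IsPos ((N * N * N) i i) := by
      rw [h2, CStarMatrix.mul_apply]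
      exact IsPos.sum _ _ fun j _ => ⟨(R * N) j i, rfl⟩
    have e2 : IsPos ((star N * M * N) i i) := by
      convert h (fun j => N j i) using 1
      simp only [CStarMatrix.mul_apply, Finset.sum_mul]
      rw [Finset.sum_comm]
      rfl
    rw [h1] at e2
    have e3 := e1.norm_le (b := 0) (by simpa using e2)
    simpa using e3
  have h4 : R * N = 0 := by
    ext j i
    have e1 := h3 i
    rw [h2, CStarMatrix.mul_apply] at e1
    change ∑ k, star ((R * N) k i) * (R * N) k i = 0 at e1
    have e2 : IsPos (star ((R * N) j i) * (R * N) j i) := ⟨_, rfl⟩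
    have e3 : IsPos (0 - star ((R * N) j i) * (R * N) j i) := by
      have : IsPos (∑ x ∈ Finset.univ.erase j, star ((R * N) x i) * (R * N) x i) :=
        IsPos.sum _ _ fun k _ => ⟨_, rfl⟩
      rw [← Finset.sum_erase_add _ _ (Finset.mem_univ j)] at e1
      rwa [zero_sub, ← eq_neg_of_add_eq_zero_left e1]
    have e4 := e2.norm_le e3
    rw [CStarRing.norm_star_mul_self, norm_zero] at e4
    have e5 : ‖(R * N) j i‖ = 0 := by nlinarith [norm_nonneg ((R * N) j i)]
    exact norm_eq_zero.1 e5
  have h5 : N * N = 0 := by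
    rw [show N * N = star R * (R * N) by rw [← mul_assoc, ← hR], h4, mul_zero]
  have h6 : star N * N = 0 := by rw [hNs, h5]
  obtain ⟨B, hB⟩ := hB (CStarRing.star_mul_self_eq_zero_iff N |>.1 h6)
  refine ⟨fun l i => B l i, fun i j => ?_⟩
  have := congrArg (fun K : CStarMatrix ι ι A => K i j) hB
  simp only [CStarMatrix.mul_apply] at this
  exact this

/-- The Gram matrix `⟨x i, x j⟩` is positive, i.e. of the form `b⋆ b`. -/
theorem exists_gram_factor {ι : Type w} [Fintype ι] (x : ι → X) :
    ∃ b : ι → ι → A, ∀ i j, ip (x i) (x j) = ∑ l, star (b l i) * b l j := by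
  refine isPos_gram_aux _ (fun i j => star_ip _ _) fun v => ?_
  have h := ip_self_pos (A := A) (∑ i, act (x i) (v i))
  have hl : ∀ (s : Finset ι) (f : ι → X) (y : X),
      ip (A := A) (∑ i ∈ s, f i) y = ∑ i ∈ s, ip (f i) y := fun s f y => by
    classical
    induction s using Finset.induction_on with
    | empty => simp [ip_zero_left]
    | insert a s ha ih => rw [Finset.sum_insert ha, Finset.sum_insert ha, ip_add_left, ih]
  have hr : ∀ (s : Finset ι) (f : ι → X) (y : X),
      ip (A := A) y (∑ i ∈ s, f i) = ∑ i ∈ s, ip y (f i) := fun s f y => by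
    rw [← star_ip, hl, star_sum]
    simp only [star_ip]
  rw [hl] at h
  simpa only [hr, ip_act_left, ip_act_right, mul_assoc] using h

end Gram

/-! ### Elementary tensors -/

section Words

variable {A X}

/-- Left multiplication, as a `⋆`-homomorphism `A → L(A)`. -/
def leftMul : A →⋆ₙₐ[ℂ] Adjointable A A where
  toFun a := ⟨ContinuousLinearMap.mul ℂ A a, ContinuousLinearMap.mul ℂ A (star a), fun x y => by
    change star (star a * x) * y = star x * (a * y)
    simp [mul_assoc]⟩
  map_smul' c a := Adjointable.ext_ip fun x y => by
    change star x * ((c • a) * y) = star x * (c • (a * y))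
    rw [smul_mul_assoc]
  map_zero' := Adjointable.ext_ip fun x y => by
    change star x * (0 * y) = star x * 0
    rw [zero_mul]
  map_add' a b := Adjointable.ext_ip fun x y => by
    change star x * ((a + b) * y) = star x * (a * y + b * y)
    rw [add_mul]
  map_mul' a b := Adjointable.ext_ip fun x y => by
    change star x * ((a * b) * y) = star x * (a * (b * y))
    rw [mul_assoc]
  map_star' a := Adjointable.ext_ip fun x y => by
    refine Eq.trans ?_ (Adjointable.ip_star_right _ x y).symm
    change star x * (star a * y) = star (a * x) * y
    simp [mul_assoc]

theorem leftMul_apply (a b : A) : leftMul a b = a * b := rfl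

/-- Words `(ξ₁, …, ξₙ; a)`, standing for the elementary tensors
`ξ₁ ⊗ ⋯ ⊗ ξₙ a` of `X^{⊗ n}` (for `n = 0`: elements `a` of `A`). -/
abbrev Word (A : Type u) (X : Type v) := List X × A

/-- A pair of operators `m = (m₁, m₂) ∈ L(A) × L(X)` acts on `A` by `m₁` and on the first tensor
factor of `X^{⊗ n}`, `n ≥ 1`, by `m₂`. -/
def mulW (m : Adjointable A A × Adjointable A X) : Word A X → Word A X
  | ([], a) => ([], m.1 a)
  | (ξ :: u, a) => (m.2 ξ :: u, a)

/-- The `⋆`-homomorphism `a ↦ (a ·, φ a)`, giving the left action of `A` on all `X^{⊗ n}`. -/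
def leftPair (φ : A →⋆ₙₐ[ℂ] Adjointable A X) :
    A →⋆ₙₐ[ℂ] Adjointable A A × Adjointable A X :=
  leftMul.prod φ

/-- `gram φ u (v, b) = ⟨u, v b⟩`, where the inner product on tensor powers is
`⟨ξ ⊗ u, η ⊗ v⟩ = ⟨u, φ(⟨ξ, η⟩) v⟩`, and tensors of different lengths are orthogonal. -/
def gram (φ : A →⋆ₙₐ[ℂ] Adjointable A X) : List X → Word A X → A
  | [], ([], b) => b
  | [], (_ :: _, _) => 0
  | _ :: _, ([], _) => 0
  | ξ :: u, (η :: v, b) => gram φ u (mulW (leftPair φ (ip ξ η)) (v, b))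

/-- The inner product of two elementary tensors. -/
def wip (φ : A →⋆ₙₐ[ℂ] Adjointable A X) (x y : Word A X) : A := star x.2 * gram φ x.1 y

variable (φ : A →⋆ₙₐ[ℂ] Adjointable A X)

theorem gram_cons_cons (ξ η : X) (u v : List X) (b : A) : gram φ (ξ :: u) (η :: v, b) =
    gram φ u (mulW (leftPair φ (ip ξ η)) (v, b)) := rfl

theorem mulW_cons (m : Adjointable A A × Adjointable A X) (ξ : X) (u : List X) (a : A) :
    mulW m (ξ :: u, a) = (m.2 ξ :: u, a) := rfl

theorem mulW_mul (m n : Adjointable A A × Adjointable A X) (x : Word A X) :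
    mulW (m * n) x = mulW m (mulW n x) := by
  obtain ⟨_ | ⟨ξ, u⟩, a⟩ := x <;> rfl

theorem length_mulW (m : Adjointable A A × Adjointable A X) (x : Word A X) :
    (mulW m x).1.length = x.1.length := by
  obtain ⟨_ | ⟨ξ, u⟩, a⟩ := x <;> rfl

theorem wip_cons (ξ η : X) (u v : List X) (a b : A) :
    wip φ (ξ :: u, a) (η :: v, b) = wip φ (u, a) (mulW (leftPair φ (ip ξ η)) (v, b)) := rfl

theorem wip_nil_cons (η : X) (v : List X) (a b : A) : wip φ ([], a) (η :: v, b) = 0 :=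
  mul_zero _

theorem wip_cons_nil (ξ : X) (u : List X) (a b : A) : wip φ (ξ :: u, a) ([], b) = 0 :=
  mul_zero _

theorem gram_add (u v : List X) (b c : A) : gram φ u (v, b + c) = gram φ u (v, b) + gram φ u (v, c) := by
  induction u generalizing v b c with
  | nil => rcases v with _ | ⟨η, v⟩ <;> simp [gram]
  | cons ξ u ih =>
    rcases v with _ | ⟨η, v⟩
    · simp [gram]
    · rcases v with _ | ⟨ζ, v⟩
      · simp only [gram, mulW, Adjointable.map_add, ih]
      · simp only [gram, mulW, ih]

theorem gram_smul (u v : List X) (c : ℂ) (b : A) : gram φ u (v, c • b) = c • gram φ u (v, b) := by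
  induction u generalizing v b with
  | nil => rcases v with _ | ⟨η, v⟩ <;> simp [gram]
  | cons ξ u ih =>
    rcases v with _ | ⟨η, v⟩
    · simp [gram]
    · rcases v with _ | ⟨ζ, v⟩
      · simp only [gram, mulW, Adjointable.map_smul, ih]
      · simp only [gram, mulW, ih]

theorem gram_mul (u v : List X) (b c : A) : gram φ u (v, b * c) = gram φ u (v, b) * c := by
  induction u generalizing v b with
  | nil => rcases v with _ | ⟨η, v⟩ <;> simp [gram]
  | cons ξ u ih =>
    rcases v with _ | ⟨η, v⟩
    · simp [gram]
    · rcases v with _ | ⟨ζ, v⟩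
      · simp only [gram, mulW]
        rw [← ih]
        congr 2
        change ip ξ η * (b * c) = ip ξ η * b * c
        rw [mul_assoc]
      · simp only [gram, mulW, ih]

theorem gram_mulW_add (u : List X) (m n : Adjointable A A × Adjointable A X) (y : Word A X) :
    gram φ u (mulW (m + n) y) = gram φ u (mulW m y) + gram φ u (mulW n y) := by
  induction u generalizing m n y with
  | nil =>
    obtain ⟨_ | ⟨η, v⟩, b⟩ := y
    · rfl
    · simp [gram, mulW]
  | cons ξ u ih =>
    obtain ⟨_ | ⟨η, v⟩, b⟩ := y
    · simp [gram, mulW]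
    · simp only [mulW_cons, gram_cons_cons, Prod.snd_add, Adjointable.add_apply, ip_add_right, map_add, ih]

theorem gram_mulW_smul (u : List X) (c : ℂ) (m : Adjointable A A × Adjointable A X)
    (y : Word A X) : gram φ u (mulW (c • m) y) = c • gram φ u (mulW m y) := by
  induction u generalizing m y with
  | nil =>
    obtain ⟨_ | ⟨η, v⟩, b⟩ := y
    · rfl
    · simp [gram, mulW]
  | cons ξ u ih =>
    obtain ⟨_ | ⟨η, v⟩, b⟩ := y
    · simp [gram, mulW]
    · simp only [mulW_cons, gram_cons_cons, Prod.smul_snd, Adjointable.smul_apply, ip_smul_right, map_smul, ih]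

theorem gram_mulW_sum {ι : Type*} (s : Finset ι) (u : List X)
    (m : ι → Adjointable A A × Adjointable A X) (y : Word A X) :
    gram φ u (mulW (∑ i ∈ s, m i) y) = ∑ i ∈ s, gram φ u (mulW (m i) y) := by
  classical
  induction s using Finset.induction_on with
  | empty => simpa using gram_mulW_smul φ u 0 0 y
  | insert a s ha ih => rw [Finset.sum_insert ha, Finset.sum_insert ha, gram_mulW_add, ih]

theorem wip_mulW_left (m : Adjointable A A × Adjointable A X) (x y : Word A X) :
    wip φ (mulW m x) y = wip φ x (mulW (star m) y) := by
  obtain ⟨_ | ⟨ξ, u⟩, a⟩ := x <;> obtain ⟨_ | ⟨η, v⟩, b⟩ := y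
  · exact (Adjointable.ip_star_right m.1 a b).symm
  · simp [wip, mulW, gram]
  · simp [wip, mulW, gram]
  · simp only [mulW, wip_cons, Prod.snd_star, Adjointable.ip_star_right]

theorem star_wip (x y : Word A X) : star (wip φ x y) = wip φ y x := by
  obtain ⟨u, a⟩ := x
  obtain ⟨v, b⟩ := y
  induction u generalizing a v b with
  | nil => rcases v with _ | ⟨η, v⟩ <;> simp [wip, gram]
  | cons ξ u ih =>
    rcases v with _ | ⟨η, v⟩
    · simp [wip, gram]
    · rw [wip_cons, wip_cons, ih, wip_mulW_left, ← map_star, star_ip]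

theorem isPos_sum_wip (N : ℕ) {ι : Type w} (s : Finset ι) (x : ι → Word A X)
    (hx : ∀ i ∈ s, (x i).1.length < N) :
    IsPos (∑ i ∈ s, ∑ j ∈ s, wip φ (x i) (x j)) := by
  classical
  induction N generalizing ι s x with
  | zero =>
    have : s = ∅ := Finset.eq_empty_of_forall_notMem fun i hi => by simpa using hx i hi
    subst this
    simpa using IsPos.zero
  | succ N ih =>
    set s₀ := s.filter fun i => (x i).1 = [] with hs₀
    set s₁ := s.filter fun i => ¬ (x i).1 = [] with hs₁
    have hsplit : ∑ i ∈ s, ∑ j ∈ s, wip φ (x i) (x j)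
        = ∑ i ∈ s₀, ∑ j ∈ s₀, wip φ (x i) (x j) + ∑ i ∈ s₁, ∑ j ∈ s₁, wip φ (x i) (x j) := by
      rw [← Finset.sum_filter_add_sum_filter_not s (fun i => (x i).1 = [])]
      congr 1
      · refine Finset.sum_congr rfl fun i hi => ?_
        rw [← Finset.sum_filter_add_sum_filter_not s (fun i => (x i).1 = [])]
        refine (add_eq_left).2 (Finset.sum_eq_zero fun j hj => ?_)
        have h1 := (Finset.mem_filter.1 hi).2
        have h2 := (Finset.mem_filter.1 hj).2
        generalize x i = p at *
        generalize x j = q at *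
        obtain ⟨u, a⟩ := p
        obtain ⟨_ | ⟨η, v⟩, b⟩ := q
        · simp at h2
        · obtain rfl : u = [] := h1
          exact wip_nil_cons φ η v a b
      · refine Finset.sum_congr rfl fun i hi => ?_
        rw [← Finset.sum_filter_add_sum_filter_not s (fun i => (x i).1 = [])]
        refine (add_eq_right).2 (Finset.sum_eq_zero fun j hj => ?_)
        have h1 := (Finset.mem_filter.1 hi).2
        have h2 := (Finset.mem_filter.1 hj).2
        generalize x i = p at *
        generalize x j = q at *
        obtain ⟨v, b⟩ := q
        obtain ⟨_ | ⟨ξ, u⟩, a⟩ := p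
        · simp at h1
        · obtain rfl : v = [] := h2
          exact wip_cons_nil φ ξ u a b
    rw [hsplit]
    refine IsPos.add ?_ ?_
    · refine ⟨∑ i ∈ s₀, (x i).2, ?_⟩
      rw [star_sum, Finset.sum_mul]
      refine Finset.sum_congr rfl fun i hi => ?_
      rw [Finset.mul_sum]
      refine Finset.sum_congr rfl fun j hj => ?_
      have h1 := (Finset.mem_filter.1 hi).2
      have h2 := (Finset.mem_filter.1 hj).2
      generalize x i = p at *
      generalize x j = q at *
      obtain ⟨u, a⟩ := p
      obtain ⟨v, b⟩ := q
      obtain rfl : u = [] := h1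
      obtain rfl : v = [] := h2
      rfl
    · have hc : ∀ i : s₁, ∃ (ξ : X) (y : Word A X), x i = (ξ :: y.1, y.2) ∧
          y.1.length < N := fun ⟨i, hi⟩ => by
        have h1 := (Finset.mem_filter.1 hi).2
        have h2 := hx i (Finset.mem_filter.1 hi).1
        change ∃ (ξ : X) (y : Word A X), x i = (ξ :: y.1, y.2) ∧ y.1.length < N
        generalize x i = p at *
        obtain ⟨_ | ⟨ξ, u⟩, a⟩ := p
        · exact absurd rfl h1
        · exact ⟨ξ, (u, a), rfl, by simpa using h2⟩
      choose ξ y hxy hy using hc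
      obtain ⟨b, hb⟩ := exists_gram_factor (A := A) ξ
      rw [← Finset.sum_coe_sort s₁]
      have hterm : ∀ i j : s₁, wip φ (x i) (x j)
          = ∑ l, wip φ (mulW (leftPair φ (b l i)) (y i)) (mulW (leftPair φ (b l j)) (y j)) := by
        intro i j
        rw [hxy i, hxy j, wip_cons, hb, map_sum]
        simp only [wip_mulW_left, ← mulW_mul, ← map_star, ← map_mul]
        rw [wip, gram_mulW_sum, Finset.mul_sum]
        rfl
      have htot : ∑ i : s₁, ∑ j ∈ s₁, wip φ (x i) (x j) = ∑ l : s₁, ∑ i : s₁, ∑ j : s₁,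
          wip φ (mulW (leftPair φ (b l i)) (y i)) (mulW (leftPair φ (b l j)) (y j)) := by
        refine Eq.trans ?_ Finset.sum_comm
        refine Finset.sum_congr rfl fun i _ => ?_
        rw [← Finset.sum_coe_sort s₁, Finset.sum_comm]
        exact Finset.sum_congr rfl fun j _ => hterm i j
      rw [htot]
      exact IsPos.sum _ _ fun l _ => ih Finset.univ
        (fun i => mulW (leftPair φ (b l i)) (y i)) fun i _ => by
          rw [length_mulW]; exact hy i

end Words

/-! ### The Fock module -/

section Fock

variable {A X}
variable (φ : A →⋆ₙₐ[ℂ] Adjointable A X)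

/-- The algebraic Fock space: formal sums of elementary tensors `ξ₁ ⊗ ⋯ ⊗ ξₙ a`, `n ≥ 0`, where
`Finsupp.single [ξ₁, …, ξₙ] a` stands for `ξ₁ ⊗ ⋯ ⊗ ξₙ a`.  The relations of the balanced tensor
product hold after dividing out the null vectors of the inner product. -/
def PreFock (_ : A →⋆ₙₐ[ℂ] Adjointable A X) : Type (max u v) := List X →₀ A

namespace PreFock

instance : AddCommGroup (PreFock φ) := inferInstanceAs (AddCommGroup (List X →₀ A))

instance : Module ℂ (PreFock φ) := inferInstanceAs (Module ℂ (List X →₀ A))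

/-- The elementary tensor `ξ₁ ⊗ ⋯ ⊗ ξₙ a` given by the word `(ξ₁, …, ξₙ; a)`. -/
def tensor (x : Word A X) : PreFock φ := Finsupp.single x.1 x.2

/-- The linear map given on elementary tensors by linear maps of the coefficient. -/
def lift {M : Type w} [AddCommGroup M] [Module ℂ M] (F : List X → (A →ₗ[ℂ] M)) :
    PreFock φ →ₗ[ℂ] M :=
  Finsupp.lsum ℂ F

variable {φ} in
theorem lift_tensor {M : Type w} [AddCommGroup M] [Module ℂ M] (F : List X → (A →ₗ[ℂ] M))
    (x : Word A X) : lift φ F (tensor φ x) = F x.1 x.2 :=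
  Finsupp.lsum_single ℂ F x.1 x.2

variable {φ} in
theorem induction {p : PreFock φ → Prop} (f : PreFock φ) (h0 : p 0)
    (hadd : ∀ f g, p f → p g → p (f + g)) (ht : ∀ x, p (tensor φ x)) : p f :=
  Finsupp.induction_linear f h0 hadd fun u a => ht (u, a)

/-- Tensors with a fixed first part, as a linear map of the coefficient. -/
def tensorL (u : List X) : A →ₗ[ℂ] PreFock φ := Finsupp.lsingle u

theorem tensorL_apply (u : List X) (a : A) : tensorL φ u a = tensor φ (u, a) := rfl

/-- `g ↦ ⟨x, g⟩` for an elementary tensor `x`. -/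
def wipL (x : Word A X) : PreFock φ →ₗ[ℂ] A :=
  lift φ fun v =>
    { toFun := fun b => wip φ x (v, b)
      map_add' := fun b c => by simp only [wip, gram_add, mul_add]
      map_smul' := fun c b => by
        simp only [wip, gram_smul, mul_smul_comm, RingHom.id_apply] }

theorem wipL_tensor (x y : Word A X) : wipL φ x (tensor φ y) = wip φ x y :=
  lift_tensor _ y

/-- The sesquilinear extension of the inner product of elementary tensors. -/
def inner (f g : PreFock φ) : A := Finsupp.sum f fun u a => wipL φ (u, a) g

theorem wipL_add (u : List X) (a b : A) (g : PreFock φ) :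
    wipL φ (u, a + b) g = wipL φ (u, a) g + wipL φ (u, b) g := by
  induction g using induction with
  | h0 => simp
  | hadd f g hf hg => simp only [map_add, hf, hg]; abel
  | ht y => simp only [wipL_tensor, wip, star_add, add_mul]

theorem wipL_zero (u : List X) (g : PreFock φ) : wipL φ (u, 0) g = 0 := by
  simpa using wipL_add φ u 0 0 g

theorem inner_add_left (f g h : PreFock φ) :
    inner φ (f + g) h = inner φ f h + inner φ g h :=
  Finsupp.sum_add_index' (fun _ => wipL_zero φ _ _) fun _ _ _ => wipL_add φ _ _ _ _

theorem inner_tensor_left (x : Word A X) (g : PreFock φ) :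
    inner φ (tensor φ x) g = wipL φ x g :=
  Finsupp.sum_single_index (wipL_zero φ _ _)

theorem inner_tensor (x y : Word A X) : inner φ (tensor φ x) (tensor φ y) = wip φ x y := by
  rw [inner_tensor_left, wipL_tensor]

theorem inner_zero_left (g : PreFock φ) : inner φ 0 g = 0 := Finsupp.sum_zero_index

theorem inner_add_right (f g h : PreFock φ) :
    inner φ f (g + h) = inner φ f g + inner φ f h := by
  simp only [inner, map_add]
  exact Finset.sum_add_distrib

theorem inner_smul_right (c : ℂ) (f g : PreFock φ) :
    inner φ f (c • g) = c • inner φ f g := by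
  simp only [inner, map_smul]
  exact Finset.smul_sum.symm

theorem inner_zero_right (f : PreFock φ) : inner φ f 0 = 0 := by
  simpa using inner_smul_right φ 0 f 0

theorem star_inner (f g : PreFock φ) : star (inner φ f g) = inner φ g f := by
  induction f using induction with
  | h0 => rw [inner_zero_left, inner_zero_right, star_zero]
  | hadd f f' hf hf' => rw [inner_add_left, inner_add_right, star_add, hf, hf']
  | ht x =>
    induction g using induction with
    | h0 => rw [inner_zero_left, inner_zero_right, star_zero]
    | hadd f f' hf hf' => rw [inner_add_left, inner_add_right, star_add, hf, hf']
    | ht y => rw [inner_tensor, inner_tensor, star_wip]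

theorem inner_self_pos (f : PreFock φ) : IsPos (inner φ f f) := by
  have h : inner φ f f = ∑ u ∈ Finsupp.support f, ∑ v ∈ Finsupp.support f,
      wip φ (u, (show List X →₀ A from f) u) (v, (show List X →₀ A from f) v) := by
    refine Finset.sum_congr rfl fun u _ => ?_
    exact Finsupp.lsum_apply ℂ _ _
  rw [h]
  exact isPos_sum_wip φ ((Finsupp.support f).sup List.length + 1) _ _ fun u hu =>
    Nat.lt_succ_of_le (Finset.le_sup (f := List.length) hu)

/-- Right multiplication, `(ξ₁ ⊗ ⋯ ⊗ ξₙ a) c = ξ₁ ⊗ ⋯ ⊗ ξₙ (a c)`. -/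
def actL (c : A) : PreFock φ →ₗ[ℂ] PreFock φ :=
  lift φ fun u => tensorL φ u ∘ₗ LinearMap.mulRight ℂ c

theorem actL_tensor (c : A) (u : List X) (a : A) :
    actL φ c (tensor φ (u, a)) = tensor φ (u, a * c) :=
  lift_tensor _ (u, a)

theorem inner_actL_right (f g : PreFock φ) (c : A) :
    inner φ f (actL φ c g) = inner φ f g * c := by
  induction f using induction with
  | h0 => simp [inner_zero_left]
  | hadd f f' hf hf' => rw [inner_add_left, inner_add_left, hf, hf', add_mul]
  | ht x =>
    induction g using induction with
    | h0 => simp [inner_zero_right]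
    | hadd f f' hf hf' => rw [map_add, inner_add_right, inner_add_right, hf, hf', add_mul]
    | ht y =>
      obtain ⟨v, b⟩ := y
      rw [actL_tensor, inner_tensor, inner_tensor, wip, wip, gram_mul, mul_assoc]

instance : PreHilbert A (PreFock φ) where
  act f c := actL φ c f
  ip := inner φ
  ip_add_right := inner_add_right φ
  ip_smul_right := inner_smul_right φ
  ip_act_right := inner_actL_right φ
  star_ip := star_inner φ
  ip_self_pos := inner_self_pos φ

instance : SeminormedAddCommGroup (PreFock φ) :=
  let _ : Norm (PreFock φ) := ⟨fun x => √‖ip (A := A) x x‖⟩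
  SeminormedAddCommGroup.ofCore (seminormCore A (PreFock φ))

instance : NormedSpace ℂ (PreFock φ) where
  norm_smul_le c x := ((seminormCore A (PreFock φ)).norm_smul c x).le

theorem norm_eq (f : PreFock φ) : ‖f‖ = √‖ip (A := A) f f‖ := rfl

theorem norm_sq (f : PreFock φ) : ‖f‖ ^ 2 = ‖ip (A := A) f f‖ :=
  Real.sq_sqrt (norm_nonneg _)

theorem norm_ip_le (f g : PreFock φ) : ‖ip (A := A) f g‖ ≤ ‖f‖ * ‖g‖ := by
  have h := norm_ip_sq_le (A := A) f g
  rw [← norm_sq, ← norm_sq, ← mul_pow] at h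
  exact abs_le_of_sq_le_sq' h (by positivity) |>.2

/-- The inner product as a continuous sesquilinear map. -/
def ipL : PreFock φ →L⋆[ℂ] PreFock φ →L[ℂ] A :=
  LinearMap.mkContinuous₂
    (LinearMap.mk₂'ₛₗ (starRingEnd ℂ) (RingHom.id ℂ) (fun f g => ip (A := A) f g)
      ip_add_left ip_smul_left ip_add_right ip_smul_right) 1
    fun f g => by rw [one_mul]; exact norm_ip_le φ f g

theorem ipL_apply (f g : PreFock φ) : ipL φ f g = ip (A := A) f g := rfl

theorem norm_actL_le (c : A) (f : PreFock φ) : ‖actL φ c f‖ ≤ ‖c‖ * ‖f‖ := by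
  refine abs_le_of_sq_le_sq' ?_ (by positivity) |>.2
  rw [norm_sq, mul_pow, norm_sq]
  change ‖ip (A := A) (act f c) (act f c)‖ ≤ _
  rw [ip_act_left, ip_act_right]
  calc _ ≤ ‖star c‖ * (‖ip (A := A) f f‖ * ‖c‖) :=
        (norm_mul_le _ _).trans (by gcongr; exact norm_mul_le _ _)
    _ = _ := by rw [norm_star]; ring

end PreFock

/-- The Fock module `⨁_{n ≥ 0} X^{⊗ n}`: the Hausdorff completion of the algebraic Fock space. -/
abbrev Fock : Type (max u v) := UniformSpace.Completion (PreFock φ)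

namespace Fock

/-- The canonical map from the algebraic Fock space. -/
abbrev emb : PreFock φ →L[ℂ] Fock φ := UniformSpace.Completion.toComplL

theorem denseRange_emb : DenseRange (emb φ) := UniformSpace.Completion.denseRange_coe

theorem isUniformInducing_emb : IsUniformInducing (emb φ) :=
  UniformSpace.Completion.isUniformInducing_coe _

variable {φ} in
theorem induction {p : Fock φ → Prop} (f : Fock φ) (hc : IsClosed {f | p f})
    (h : ∀ f, p (emb φ f)) : p f :=
  UniformSpace.Completion.induction_on f hc h

/-- The inner product of the Fock module. -/
def ipF : Fock φ →L⋆[ℂ] Fock φ →L[ℂ] A :=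
  (((PreFock.ipL φ).extend (emb φ)).flip.extend (emb φ)).flip

theorem ipF_emb (f g : PreFock φ) : ipF φ (emb φ f) (emb φ g) = ip (A := A) f g := by
  rw [ipF, ContinuousLinearMap.flip_apply,
    ContinuousLinearMap.extend_eq _ (denseRange_emb φ) (isUniformInducing_emb φ),
    ContinuousLinearMap.flip_apply,
    ContinuousLinearMap.extend_eq _ (denseRange_emb φ) (isUniformInducing_emb φ),
    PreFock.ipL_apply]

/-- Extension of bounded operators from the algebraic Fock space. -/
def ext (T : PreFock φ →ₗ[ℂ] PreFock φ) (C : ℝ) (hT : ∀ f, ‖T f‖ ≤ C * ‖f‖) :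
    Fock φ →L[ℂ] Fock φ :=
  ((emb φ).comp (T.mkContinuous C hT)).extend (emb φ)

variable {φ} in
theorem ext_emb (T : PreFock φ →ₗ[ℂ] PreFock φ) (C : ℝ) (hT : ∀ f, ‖T f‖ ≤ C * ‖f‖)
    (f : PreFock φ) : ext φ T C hT (emb φ f) = emb φ (T f) :=
  ContinuousLinearMap.extend_eq _ (denseRange_emb φ) (isUniformInducing_emb φ) f

theorem norm_emb (f : PreFock φ) : ‖emb φ f‖ = ‖f‖ := UniformSpace.Completion.norm_coe f

theorem continuous_ipF : Continuous fun p : Fock φ × Fock φ => ipF φ p.1 p.2 :=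
  ((ipF φ).continuous.comp continuous_fst).clm_apply continuous_snd

instance : HilbertModule A (Fock φ) where
  act f c := ext φ (PreFock.actL φ c) ‖c‖ (PreFock.norm_actL_le φ c) f
  ip f g := ipF φ f g
  ip_add_right f g h := map_add _ _ _
  ip_smul_right c f g := map_smul _ _ _
  ip_act_right f g c := by
    induction f using Fock.induction with
    | hc => exact isClosed_eq (by fun_prop) (by fun_prop)
    | h f =>
    induction g using Fock.induction with
    | hc => exact isClosed_eq (by fun_prop) (by fun_prop)
    | h g =>
      rw [ext_emb, ipF_emb, ipF_emb]
      exact ip_act_right f g c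
  star_ip f g := by
    induction f using Fock.induction with
    | hc => exact isClosed_eq (by fun_prop) (by fun_prop)
    | h f =>
    induction g using Fock.induction with
    | hc => exact isClosed_eq (by fun_prop) (by fun_prop)
    | h g =>
      rw [ipF_emb, ipF_emb, star_ip]
  ip_self_pos f := by
    induction f using Fock.induction with
    | hc => exact isClosed_isPos.preimage ((continuous_ipF φ).comp (continuous_id.prodMk continuous_id))
    | h f =>
      rw [ipF_emb]
      exact ip_self_pos f
  norm_sq f := by
    induction f using Fock.induction with
    | hc =>
      exact isClosed_eq (by fun_prop)
        ((continuous_ipF φ).comp (continuous_id.prodMk continuous_id)).norm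
    | h f => rw [ipF_emb, norm_emb, PreFock.norm_sq]

theorem ip_emb (f g : PreFock φ) : ip (A := A) (emb φ f) (emb φ g) = ip f g := ipF_emb φ f g

theorem continuous_ip : Continuous fun p : Fock φ × Fock φ => ip (A := A) p.1 p.2 :=
  continuous_ipF φ

variable {φ} in
theorem isClosed_ip_eq {F G H K : Fock φ → Fock φ} (hF : Continuous F) (hG : Continuous G)
    (hH : Continuous H) (hK : Continuous K) :
    IsClosed {f | ip (A := A) (F f) (G f) = ip (H f) (K f)} :=
  isClosed_eq ((continuous_ip φ).comp (hF.prodMk hG)) ((continuous_ip φ).comp (hH.prodMk hK))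

end Fock

end Fock

/-! ### Operators on the Fock module -/

section FockOperators

variable {A X}
variable (φ : A →⋆ₙₐ[ℂ] Adjointable A X)

namespace Fock

/-- A bounded adjointable operator on the algebraic Fock space extends to the Fock module. -/
def op (T S : PreFock φ →ₗ[ℂ] PreFock φ) (hTS : ∀ f g, ip (A := A) (S f) g = ip f (T g)) (C : ℝ)
    (hT : ∀ f, ‖T f‖ ≤ C * ‖f‖) : Adjointable A (Fock φ) :=
  ⟨ext φ T C hT, ext φ S C (fun f => by
      have h1 : ‖S f‖ ^ 2 ≤ C * ‖f‖ * ‖S f‖ := by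
        rw [PreFock.norm_sq, hTS]
        refine (PreFock.norm_ip_le φ _ _).trans ?_
        nlinarith [hT (S f), norm_nonneg f]
      rcases (norm_nonneg (S f)).eq_or_lt with h | h
      · rw [← h]; exact (norm_nonneg _).trans (hT f)
      · nlinarith), fun f g => by
    induction f using Fock.induction with
    | hc => exact isClosed_ip_eq (by fun_prop) (by fun_prop) (by fun_prop) (by fun_prop)
    | h f =>
    induction g using Fock.induction with
    | hc => exact isClosed_ip_eq (by fun_prop) (by fun_prop) (by fun_prop) (by fun_prop)
    | h g =>
      rw [ext_emb, ext_emb, ip_emb, ip_emb, hTS]⟩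

variable {φ} in
theorem op_emb (T S : PreFock φ →ₗ[ℂ] PreFock φ)
    (hTS : ∀ f g, ip (A := A) (S f) g = ip f (T g)) (C : ℝ)
    (hT : ∀ f, ‖T f‖ ≤ C * ‖f‖) (f : PreFock φ) :
    (op φ T S hTS C hT) (emb φ f) = emb φ (T f) :=
  ext_emb T C hT f

variable {φ} in
theorem adjointable_ext {T S : Adjointable A (Fock φ)}
    (h : ∀ x : Word A X, T (emb φ (PreFock.tensor φ x)) = S (emb φ (PreFock.tensor φ x))) :
    T = S := by
  refine Subtype.ext (ContinuousLinearMap.ext fun f => ?_)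
  induction f using Fock.induction with
  | hc => exact isClosed_eq (ContinuousLinearMap.continuous _) (ContinuousLinearMap.continuous _)
  | h f =>
    induction f using PreFock.induction with
    | h0 => rw [map_zero, map_zero, map_zero]
    | hadd f g hf hg => rw [map_add, map_add, map_add, hf, hg]
    | ht x => exact h x

end Fock

namespace PreFock

variable {φ} in
theorem adjoint_of_tensor {T S : PreFock φ →ₗ[ℂ] PreFock φ}
    (h : ∀ x y, ip (A := A) (S (tensor φ x)) (tensor φ y) = ip (tensor φ x) (T (tensor φ y)))
    (f g : PreFock φ) : ip (A := A) (S f) g = ip f (T g) := by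
  induction f using induction with
  | h0 => rw [map_zero, ip_zero_left, ip_zero_left]
  | hadd f f' hf hf' => rw [map_add, ip_add_left, ip_add_left, hf, hf']
  | ht x =>
    induction g using induction with
    | h0 => rw [map_zero, ip_zero_right, ip_zero_right]
    | hadd f f' hf hf' => rw [map_add, ip_add_right, ip_add_right, hf, hf']
    | ht y => exact h x y

theorem ip_tensor (x y : Word A X) :
    ip (A := A) (tensor φ x) (tensor φ y) = wip φ x y := inner_tensor φ x y

/-- The action of `L(A) × L(X)` on the algebraic Fock space. -/
def pairL (m : Adjointable A A × Adjointable A X) : PreFock φ →ₗ[ℂ] PreFock φ :=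
  lift φ fun
    | [] => tensorL φ [] ∘ₗ (m.1.toCLM : A →ₗ[ℂ] A)
    | ξ :: u => tensorL φ (m.2 ξ :: u)

theorem pairL_tensor (m : Adjointable A A × Adjointable A X) (x : Word A X) :
    pairL φ m (tensor φ x) = tensor φ (mulW m x) := by
  obtain ⟨_ | ⟨ξ, u⟩, a⟩ := x
  · exact lift_tensor _ ([], a)
  · exact lift_tensor _ (ξ :: u, a)

theorem ip_pairL (m : Adjointable A A × Adjointable A X) (f g : PreFock φ) :
    ip (A := A) (pairL φ (star m) f) g = ip f (pairL φ m g) := by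
  refine adjoint_of_tensor (fun x y => ?_) f g
  rw [pairL_tensor, pairL_tensor, ip_tensor, ip_tensor, wip_mulW_left, star_star]

theorem pairL_mul (m n : Adjointable A A × Adjointable A X) (f : PreFock φ) :
    pairL φ (m * n) f = pairL φ m (pairL φ n f) := by
  induction f using induction with
  | h0 => simp only [map_zero]
  | hadd f g hf hg => simp only [map_add, hf, hg]
  | ht x => simp only [pairL_tensor, mulW_mul]

theorem pairL_one (f : PreFock φ) : pairL φ 1 f = f := by
  induction f using induction with
  | h0 => simp only [map_zero]
  | hadd f g hf hg => simp only [map_add, hf, hg]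
  | ht x =>
    rw [pairL_tensor]
    obtain ⟨_ | ⟨ξ, u⟩, a⟩ := x <;> rfl

theorem ip_pairL_add (m n : Adjointable A A × Adjointable A X) (f g : PreFock φ) :
    ip (A := A) f (pairL φ (m + n) g) = ip f (pairL φ m g) + ip f (pairL φ n g) := by
  induction f using induction with
  | h0 => simp only [ip_zero_left, add_zero]
  | hadd f f' hf hf' => simp only [ip_add_left, hf, hf']; abel
  | ht x =>
    induction g using induction with
    | h0 => simp only [map_zero, ip_zero_right, add_zero]
    | hadd f f' hf hf' => simp only [map_add, ip_add_right, hf, hf']; abel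
    | ht y => simp only [pairL_tensor, ip_tensor, wip, gram_mulW_add, mul_add]

theorem ip_pairL_smul (c : ℂ) (m : Adjointable A A × Adjointable A X) (f g : PreFock φ) :
    ip (A := A) f (pairL φ (c • m) g) = c • ip f (pairL φ m g) := by
  induction f using induction with
  | h0 => simp only [ip_zero_left, smul_zero]
  | hadd f f' hf hf' => simp only [ip_add_left, hf, hf', smul_add]
  | ht x =>
    induction g using induction with
    | h0 => simp only [map_zero, ip_zero_right, smul_zero]
    | hadd f f' hf hf' => simp only [map_add, ip_add_right, hf, hf', smul_add]
    | ht y => simp only [pairL_tensor, ip_tensor, wip, gram_mulW_smul, mul_smul_comm]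

theorem norm_pairL_le (m : Adjointable A A × Adjointable A X) (f : PreFock φ) :
    ‖pairL φ m f‖ ≤ ‖m‖ * ‖f‖ := by
  have h0 : IsPos (star m * m) := ⟨m, rfl⟩
  have h1 := h0.conj_le 1
  rw [star_one, one_mul, one_mul, mul_one, CStarRing.norm_star_mul_self] at h1
  obtain ⟨d, hd⟩ := h1
  have h2 : ((‖m‖ * ‖m‖ : ℝ) : ℂ) • (1 : Adjointable A A × Adjointable A X)
      = star m * m + star d * d := by rw [← hd]; abel
  have h3 : ((‖m‖ * ‖m‖ : ℝ) : ℂ) • ip (A := A) f f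
      = ip (pairL φ m f) (pairL φ m f) + ip (pairL φ d f) (pairL φ d f) := by
    have := ip_pairL_smul φ ((‖m‖ * ‖m‖ : ℝ) : ℂ) 1 f f
    rw [pairL_one] at this
    rw [← this, h2, ip_pairL_add, pairL_mul, pairL_mul]
    congr 1
    · rw [← star_star m, ip_pairL, star_star]
    · rw [← star_star d, ip_pairL, star_star]
  have h4 := (ip_self_pos (A := A) (pairL φ m f)).norm_le
    (b := ((‖m‖ * ‖m‖ : ℝ) : ℂ) • ip (A := A) f f) (by
      rw [h3, add_sub_cancel_left]; exact ip_self_pos _)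
  refine abs_le_of_sq_le_sq' ?_ (by positivity) |>.2
  rw [norm_sq, mul_pow, norm_sq, pow_two]
  refine h4.trans ?_
  rw [norm_smul, Complex.norm_real, Real.norm_eq_abs, abs_of_nonneg (by positivity)]

/-- `ξ₁ ⊗ ⋯ ⊗ ξₙ a ↦ ξ ⊗ ξ₁ ⊗ ⋯ ⊗ ξₙ a`. -/
def createL (ξ : X) : PreFock φ →ₗ[ℂ] PreFock φ := lift φ fun u => tensorL φ (ξ :: u)

/-- `ξ₁ ⊗ ⋯ ⊗ ξₙ a ↦ φ(⟨ξ, ξ₁⟩) ξ₂ ⊗ ⋯ ⊗ ξₙ a` for `n ≥ 1`, and `a ↦ 0` on `A`. -/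
def annihilateL (ξ : X) : PreFock φ →ₗ[ℂ] PreFock φ :=
  lift φ fun
    | [] => 0
    | η :: u => pairL φ (leftPair φ (ip ξ η)) ∘ₗ tensorL φ u

theorem createL_tensor (ξ : X) (u : List X) (a : A) :
    createL φ ξ (tensor φ (u, a)) = tensor φ (ξ :: u, a) := lift_tensor _ (u, a)

theorem annihilateL_nil (ξ : X) (a : A) : annihilateL φ ξ (tensor φ ([], a)) = 0 :=
  lift_tensor _ ([], a)

theorem annihilateL_cons (ξ η : X) (u : List X) (a : A) :
    annihilateL φ ξ (tensor φ (η :: u, a)) = pairL φ (leftPair φ (ip ξ η)) (tensor φ (u, a)) :=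
  lift_tensor _ (η :: u, a)

theorem ip_annihilateL (ξ : X) (f g : PreFock φ) :
    ip (A := A) (annihilateL φ ξ f) g = ip f (createL φ ξ g) := by
  refine adjoint_of_tensor (fun x y => ?_) f g
  obtain ⟨v, b⟩ := y
  rw [createL_tensor]
  obtain ⟨_ | ⟨η, u⟩, a⟩ := x
  · rw [annihilateL_nil, ip_zero_left, ip_tensor, wip_nil_cons]
  · rw [annihilateL_cons, pairL_tensor, ip_tensor, ip_tensor, wip_mulW_left, wip_cons, ← map_star,
      star_ip]

theorem annihilateL_createL (ξ : X) (f : PreFock φ) :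
    annihilateL φ ξ (createL φ ξ f) = pairL φ (leftPair φ (ip ξ ξ)) f := by
  induction f using induction with
  | h0 => simp only [map_zero]
  | hadd f g hf hg => simp only [map_add, hf, hg]
  | ht x => exact (congrArg _ (createL_tensor φ ξ x.1 x.2)).trans (annihilateL_cons φ ξ ξ x.1 x.2)

theorem norm_createL_le (ξ : X) (f : PreFock φ) :
    ‖createL φ ξ f‖ ≤ √‖leftPair φ (ip ξ ξ)‖ * ‖f‖ := by
  refine abs_le_of_sq_le_sq' ?_ (by positivity) |>.2
  rw [norm_sq, ← ip_annihilateL, annihilateL_createL, mul_pow, Real.sq_sqrt (norm_nonneg _)]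
  refine (norm_ip_le φ _ _).trans ?_
  nlinarith [norm_pairL_le φ (leftPair φ (ip ξ ξ)) f, norm_nonneg f]

/-- `ξ₁ ⊗ ⋯ ⊗ ξₙ a ↦ tⁿ ξ₁ ⊗ ⋯ ⊗ ξₙ a`. -/
def gradeL (t : Circle) : PreFock φ →ₗ[ℂ] PreFock φ :=
  lift φ fun u => ((t : ℂ) ^ u.length) • tensorL φ u

theorem gradeL_tensor (t : Circle) (x : Word A X) :
    gradeL φ t (tensor φ x) = ((t : ℂ) ^ x.1.length) • tensor φ x := lift_tensor _ x

theorem gradeL_mul (s t : Circle) (f : PreFock φ) :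
    gradeL φ (s * t) f = gradeL φ s (gradeL φ t f) := by
  induction f using induction with
  | h0 => simp only [map_zero]
  | hadd f g hf hg => simp only [map_add, hf, hg]
  | ht x =>
    rw [gradeL_tensor, gradeL_tensor, map_smul, gradeL_tensor, smul_smul, Circle.coe_mul, mul_pow,
      mul_comm]

theorem gradeL_one (f : PreFock φ) : gradeL φ 1 f = f := by
  induction f using induction with
  | h0 => simp only [map_zero]
  | hadd f g hf hg => simp only [map_add, hf, hg]
  | ht x => rw [gradeL_tensor, Circle.coe_one, one_pow, one_smul]

theorem gram_eq_zero {u : List X} {y : Word A X} (h : u.length ≠ y.1.length) :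
    gram φ u y = 0 := by
  induction u generalizing y with
  | nil =>
    obtain ⟨_ | ⟨η, v⟩, b⟩ := y
    · exact absurd rfl h
    · rfl
  | cons ξ u ih =>
    obtain ⟨_ | ⟨η, v⟩, b⟩ := y
    · rfl
    · rw [gram_cons_cons]
      refine ih ?_
      rw [length_mulW]
      exact fun h' => h (congrArg Nat.succ h')

theorem ip_gradeL (t : Circle) (f g : PreFock φ) :
    ip (A := A) (gradeL φ t⁻¹ f) g = ip f (gradeL φ t g) := by
  refine adjoint_of_tensor (fun x y => ?_) f g
  rw [gradeL_tensor, gradeL_tensor, ip_smul_left, ip_smul_right, ip_tensor, wip]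
  by_cases h : x.1.length = y.1.length
  · rw [h, Circle.coe_inv_eq_conj, map_pow, Complex.conj_conj]
  · rw [gram_eq_zero φ h, mul_zero, smul_zero, smul_zero]

theorem norm_gradeL_le (t : Circle) (f : PreFock φ) : ‖gradeL φ t f‖ ≤ 1 * ‖f‖ := by
  rw [one_mul, norm_eq, norm_eq, ← ip_gradeL, ← gradeL_mul, inv_mul_cancel, gradeL_one]

end PreFock

open PreFock Fock

/-- The creation operator `T_ξ`. -/
def creation (ξ : X) : Adjointable A (Fock φ) :=
  op φ (createL φ ξ) (annihilateL φ ξ) (ip_annihilateL φ ξ) _ (norm_createL_le φ ξ)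

theorem creation_emb (ξ : X) (f : PreFock φ) :
    creation φ ξ (emb φ f) = emb φ (createL φ ξ f) := op_emb _ _ _ _ _ f

/-- The left action `φ₊(a)` of `a ∈ A` on the Fock module. -/
def leftAction (a : A) : Adjointable A (Fock φ) :=
  op φ (pairL φ (leftPair φ a)) (pairL φ (star (leftPair φ a))) (ip_pairL φ _) _
    (norm_pairL_le φ _)

/-- The creation operator `T_ζ = T_{ξ₁} ⋯ T_{ξₙ} φ₊(a)` of an elementary tensor
`ζ = ξ₁ ⊗ ⋯ ⊗ ξₙ a ∈ X^{⊗ n}`. -/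
def creationTensor (x : Word A X) : Adjointable A (Fock φ) :=
  x.1.foldr (fun ξ T => creation φ ξ * T) (leftAction φ x.2)

/-- The algebra generated by the creation operators. -/
def toeplitzSubalgebra : NonUnitalStarSubalgebra ℂ (Adjointable A (Fock φ)) :=
  (NonUnitalStarAlgebra.adjoin ℂ (Set.range (creation φ))).topologicalClosure

instance : IsClosed (toeplitzSubalgebra φ : Set (Adjointable A (Fock φ))) :=
  NonUnitalStarSubalgebra.isClosed_topologicalClosure _

/-- The C⋆-algebra `T_E` generated by the creation operators on the Fock module.  If
`φ(A) ∩ K(E) = 0`, this is the Cuntz–Pimsner algebra `O_E`. -/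
def Toeplitz : Type (max u v) := toeplitzSubalgebra φ

instance : NonUnitalCStarAlgebra (Toeplitz φ) :=
  inferInstanceAs (NonUnitalCStarAlgebra (toeplitzSubalgebra φ))

/-- The C⋆-algebra generated by the operators `T_ξ T_η⋆` with `ξ, η ∈ E^{⊗ k}`, `k ∈ s`. -/
def gradedSubalgebra (s : Set ℕ) : NonUnitalStarSubalgebra ℂ (Adjointable A (Fock φ)) :=
  (NonUnitalStarAlgebra.adjoin ℂ {T | ∃ x y : Word A X, x.1.length ∈ s ∧
    y.1.length = x.1.length ∧ T = creationTensor φ x * star (creationTensor φ y)}).topologicalClosure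

instance (s : Set ℕ) : IsClosed (gradedSubalgebra φ s : Set (Adjointable A (Fock φ))) :=
  NonUnitalStarSubalgebra.isClosed_topologicalClosure _

/-- The core `F_E`, generated by all `T_ξ T_η⋆` with `ξ, η ∈ E^{⊗ k}`, `k ≥ 0`. -/
def Core : Type (max u v) := gradedSubalgebra φ Set.univ

instance : NonUnitalCStarAlgebra (Core φ) :=
  inferInstanceAs (NonUnitalCStarAlgebra (gradedSubalgebra φ Set.univ))

/-- The subalgebra `J_n` of the core generated by the `T_ξ T_η⋆` with `ξ, η ∈ E^{⊗ k}`,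
`k ≥ n`. -/
def coreIdeal (n : ℕ) : Set (Core φ) := {x | x.1 ∈ gradedSubalgebra φ (Set.Ici n)}

/-! ### The gauge action -/

/-- The unitary on the Fock module which is multiplication by `tⁿ` on `E^{⊗ n}`. -/
def gradeOp (t : Circle) : Adjointable A (Fock φ) :=
  op φ (gradeL φ t) (gradeL φ t⁻¹) (ip_gradeL φ t) 1 (norm_gradeL_le φ t)

theorem gradeOp_emb (t : Circle) (f : PreFock φ) :
    gradeOp φ t (emb φ f) = emb φ (gradeL φ t f) := op_emb _ _ _ _ _ f

theorem gradeOp_mul (s t : Circle) : gradeOp φ (s * t) = gradeOp φ s * gradeOp φ t :=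
  adjointable_ext fun x => by
    rw [Adjointable.mul_apply, gradeOp_emb, gradeOp_emb, gradeOp_emb, gradeL_mul]

theorem gradeOp_one : gradeOp φ 1 = 1 :=
  adjointable_ext fun x => by
    rw [gradeOp_emb, gradeL_one]
    rfl

theorem star_gradeOp (t : Circle) : star (gradeOp φ t) = gradeOp φ t⁻¹ := by
  refine Adjointable.ext_ip fun f g => ?_
  rw [Adjointable.ip_star_right]
  have h := (gradeOp φ t⁻¹).ip_star_left
  induction f using Fock.induction with
  | hc => exact isClosed_ip_eq (by fun_prop) (by fun_prop) (by fun_prop) (by fun_prop)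
  | h f =>
  induction g using Fock.induction with
  | hc => exact isClosed_ip_eq (by fun_prop) (by fun_prop) (by fun_prop) (by fun_prop)
  | h g => rw [gradeOp_emb, gradeOp_emb, ip_emb, ip_emb, ← ip_gradeL, inv_inv]

/-- The grading unitaries, as a representation of the circle. -/
def gradeU : Circle →* unitary (Adjointable A (Fock φ)) where
  toFun t := ⟨gradeOp φ t, by
    rw [Unitary.mem_iff, star_gradeOp, ← gradeOp_mul, ← gradeOp_mul, inv_mul_cancel,
      mul_inv_cancel, gradeOp_one]
    exact ⟨rfl, rfl⟩⟩
  map_one' := Subtype.ext (gradeOp_one φ)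
  map_mul' s t := Subtype.ext (gradeOp_mul φ s t)

theorem gradeOp_creation (t : Circle) (ξ : X) :
    gradeOp φ t * creation φ ξ = (t : ℂ) • (creation φ ξ * gradeOp φ t) :=
  adjointable_ext fun x => by
    obtain ⟨u, a⟩ := x
    rw [Adjointable.mul_apply, Adjointable.smul_apply, Adjointable.mul_apply, creation_emb,
      gradeOp_emb, gradeOp_emb, creation_emb, gradeL_tensor, createL_tensor, gradeL_tensor,
      map_smul, map_smul, map_smul, createL_tensor, smul_smul, List.length_cons, pow_succ']

/-- `λ_t(x) = U_t x U_t⋆` on `L` of the Fock module. -/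
def gaugeAd : Circle →* (Adjointable A (Fock φ) ≃⋆ₐ[ℂ] Adjointable A (Fock φ)) :=
  (Unitary.conjStarAlgAut ℂ (Adjointable A (Fock φ))).comp (gradeU φ)

theorem gaugeAd_apply (t : Circle) (x : Adjointable A (Fock φ)) :
    gaugeAd φ t x = gradeOp φ t * x * star (gradeOp φ t) := rfl

theorem gaugeAd_creation (t : Circle) (ξ : X) :
    gaugeAd φ t (creation φ ξ) = (t : ℂ) • creation φ ξ := by
  rw [gaugeAd_apply, gradeOp_creation, smul_mul_assoc, mul_assoc, star_gradeOp, ← gradeOp_mul,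
    mul_inv_cancel, gradeOp_one, mul_one]

theorem continuous_gaugeAd (t : Circle) : Continuous (gaugeAd φ t) := by
  rw [show ⇑(gaugeAd φ t) = fun x => gradeOp φ t * x * star (gradeOp φ t) from
    funext (gaugeAd_apply φ t)]
  fun_prop

theorem gaugeAd_mem (t : Circle) (x : Adjointable A (Fock φ)) (hx : x ∈ toeplitzSubalgebra φ) :
    gaugeAd φ t x ∈ toeplitzSubalgebra φ := by
  have h1 : NonUnitalStarAlgebra.adjoin ℂ (Set.range (creation φ)) ≤
      (toeplitzSubalgebra φ).comap (gaugeAd φ t) := by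
    refine NonUnitalStarAlgebra.adjoin_le ?_
    rintro _ ⟨ξ, rfl⟩
    rw [SetLike.mem_coe, NonUnitalStarSubalgebra.mem_comap, gaugeAd_creation]
    exact SMulMemClass.smul_mem _ (NonUnitalStarSubalgebra.le_topologicalClosure _
      (NonUnitalStarAlgebra.subset_adjoin ℂ _ ⟨ξ, rfl⟩))
  have h2 : IsClosed ((toeplitzSubalgebra φ).comap (gaugeAd φ t) :
      Set (Adjointable A (Fock φ))) := by
    rw [NonUnitalStarSubalgebra.coe_comap]
    exact (NonUnitalStarSubalgebra.isClosed_topologicalClosure _).preimage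
      (continuous_gaugeAd φ t)
  exact (NonUnitalStarSubalgebra.mem_comap _ _ _).1
    (NonUnitalStarSubalgebra.topologicalClosure_minimal _ h1 h2 hx)

end FockOperators

/-- The restriction of a group of automorphisms to an invariant subalgebra. -/
def restrictAut {D : Type u} [NonUnitalCStarAlgebra D] {G : Type v} [Group G]
    (α : G →* (D ≃⋆ₐ[ℂ] D)) (S : NonUnitalStarSubalgebra ℂ D)
    (h : ∀ g, ∀ x ∈ S, α g x ∈ S) : G →* (S ≃⋆ₐ[ℂ] S) where
  toFun g :=
    { toFun := fun x => ⟨α g x, h g x x.2⟩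
      invFun := fun x => ⟨α g⁻¹ x, h g⁻¹ x x.2⟩
      left_inv := fun x => Subtype.ext (by
        change α g⁻¹ (α g x) = x
        rw [← StarAlgEquiv.mul_apply, ← map_mul, inv_mul_cancel, map_one]; rfl)
      right_inv := fun x => Subtype.ext (by
        change α g (α g⁻¹ x) = x
        rw [← StarAlgEquiv.mul_apply, ← map_mul, mul_inv_cancel, map_one]; rfl)
      map_mul' := fun x y => Subtype.ext (map_mul (α g) (x : D) y)
      map_add' := fun x y => Subtype.ext (map_add (α g) (x : D) y)
      map_star' := fun x => Subtype.ext (map_star (α g) (x : D))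
      map_smul' := fun c x => Subtype.ext (map_smul (α g) c (x : D)) }
  map_one' := StarAlgEquiv.ext fun x => Subtype.ext (by
    change α 1 x = x
    rw [map_one]; rfl)
  map_mul' g k := StarAlgEquiv.ext fun x => Subtype.ext (by
    change α (g * k) x = α g (α k x)
    rw [map_mul]; rfl)

variable {A X} in
/-- The gauge action `λ` of the circle on `T_E`, with `λ_t(T_ξ) = t T_ξ`. -/
def gauge (φ : A →⋆ₙₐ[ℂ] Adjointable A X) : Circle →* (Toeplitz φ ≃⋆ₐ[ℂ] Toeplitz φ) :=
  restrictAut (gaugeAd φ) (toeplitzSubalgebra φ) (gaugeAd_mem φ)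

/-! ### The crossed product by an action of the circle -/

theorem map_mem_closure_adjoin {D : Type w} [NonUnitalCStarAlgebra D] {s : Set D}
    (f : D →⋆ₙₐ[ℂ] D) (hf : Continuous f) (h : ∀ x ∈ s, f x ∈ s) (x : D)
    (hx : x ∈ (NonUnitalStarAlgebra.adjoin ℂ s).topologicalClosure) :
    f x ∈ (NonUnitalStarAlgebra.adjoin ℂ s).topologicalClosure := by
  have h1 : NonUnitalStarAlgebra.adjoin ℂ s ≤
      ((NonUnitalStarAlgebra.adjoin ℂ s).topologicalClosure).comap f :=
    NonUnitalStarAlgebra.adjoin_le fun y hy =>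
      NonUnitalStarSubalgebra.le_topologicalClosure _
        (NonUnitalStarAlgebra.subset_adjoin ℂ _ (h y hy))
  have h2 : IsClosed (((NonUnitalStarAlgebra.adjoin ℂ s).topologicalClosure).comap f : Set D) :=
    (NonUnitalStarSubalgebra.isClosed_topologicalClosure _).preimage hf
  exact NonUnitalStarSubalgebra.topologicalClosure_minimal _ h1 h2 hx

section CrossedProduct

variable {D : Type w} [NonUnitalCStarAlgebra D] (α : Circle →* (D ≃⋆ₐ[ℂ] D))

/-- Covariant representations of `(D, 𝕋, α)` on a Hilbert space. -/
structure CovariantRep where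
  H : Type w
  [normedAddCommGroup : NormedAddCommGroup H]
  [innerProductSpace : InnerProductSpace ℂ H]
  [completeSpace : CompleteSpace H]
  π : D →⋆ₙₐ[ℂ] (H →L[ℂ] H)
  U : Circle →* unitary (H →L[ℂ] H)
  continuous_U : ∀ h : H, Continuous fun t => (U t : H →L[ℂ] H) h
  covariant : ∀ (t : Circle) (d : D),
    (U t : H →L[ℂ] H) * π d = π (α t d) * (U t : H →L[ℂ] H)

namespace CovariantRep

attribute [instance] normedAddCommGroup innerProductSpace completeSpace

variable {α}

theorem norm_U_apply (r : CovariantRep α) (t : Circle) (h : r.H) :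
    ‖(r.U t : r.H →L[ℂ] r.H) h‖ = ‖h‖ :=
  ContinuousLinearMap.norm_map_of_mem_unitary (r.U t).2 h

theorem norm_π_le (r : CovariantRep α) (d : D) : ‖r.π d‖ ≤ ‖d‖ :=
  NonUnitalStarAlgHom.norm_apply_le r.π d

/-- The integrand `t ↦ π(f(t)) U_t h` of the integrated form. -/
def integrand (r : CovariantRep α) (f : C(Circle, D)) (h : r.H) (t : Circle) : r.H :=
  r.π (f t) ((r.U t : r.H →L[ℂ] r.H) h)

theorem continuous_integrand (r : CovariantRep α) (f : C(Circle, D)) (h : r.H) :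
    Continuous (r.integrand f h) := by
  have hπ : Continuous r.π := by
    refine (LipschitzWith.of_dist_le_mul (K := 1) fun x y => ?_).continuous
    rw [dist_eq_norm, dist_eq_norm, ← map_sub, NNReal.coe_one, one_mul]
    exact r.norm_π_le _
  exact (hπ.comp f.continuous).clm_apply (r.continuous_U h)

theorem norm_integrand_le (r : CovariantRep α) (f : C(Circle, D)) (h : r.H) (t : Circle) :
    ‖r.integrand f h t‖ ≤ ‖f‖ * ‖h‖ := by
  refine (ContinuousLinearMap.le_opNorm _ _).trans ?_
  rw [norm_U_apply]
  gcongr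
  exact (r.norm_π_le _).trans (f.norm_coe_le_norm t)

/-- The integrated form `(π ⋊ U)(f) = ∫ π(f(t)) U_t dt` of a covariant representation, where `dt`
is the normalized Haar measure of the circle. -/
def integrated (r : CovariantRep α) (f : C(Circle, D)) : r.H →L[ℂ] r.H :=
  LinearMap.mkContinuous
    { toFun := fun h => ∫ θ in (0 : ℝ)..1, r.integrand f h (Circle.exp (2 * Real.pi * θ))
      map_add' := fun h k => by
        rw [← intervalIntegral.integral_add]
        · refine intervalIntegral.integral_congr fun θ _ => ?_
          simp only [integrand, map_add]
        · exact ((r.continuous_integrand f h).comp (by fun_prop)).intervalIntegrable _ _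
        · exact ((r.continuous_integrand f k).comp (by fun_prop)).intervalIntegrable _ _
      map_smul' := fun c h => by
        rw [RingHom.id_apply, ← intervalIntegral.integral_smul]
        refine intervalIntegral.integral_congr fun θ _ => ?_
        simp only [integrand, map_smul] }
    ‖f‖ fun h => by
      refine (intervalIntegral.norm_integral_le_of_norm_le_const
        fun θ _ => r.norm_integrand_le f h _).trans ?_
      simp

theorem norm_integrated_le (r : CovariantRep α) (f : C(Circle, D)) : ‖r.integrated f‖ ≤ ‖f‖ :=
  LinearMap.mkContinuous_norm_le _ (norm_nonneg f) _

theorem integrated_apply (r : CovariantRep α) (f : C(Circle, D)) (h : r.H) : r.integrated f h =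
    ∫ θ in (0 : ℝ)..1, r.integrand f h (Circle.exp (2 * Real.pi * θ)) := rfl

end CovariantRep

/-- The product of the algebras of bounded operators over all covariant representations. -/
def CovariantProd : Type (w + 1) :=
  lp (fun r : CovariantRep α => r.H →L[ℂ] r.H) ∞

instance : NonUnitalCStarAlgebra (CovariantProd α) :=
  inferInstanceAs (NonUnitalCStarAlgebra (lp (fun r : CovariantRep α => r.H →L[ℂ] r.H) ∞))

/-- The image of `f ∈ C(𝕋, D)` in the direct sum of all covariant representations. -/
def universalRep (f : C(Circle, D)) : CovariantProd α :=
  ⟨fun r => r.integrated f, memℓp_infty ⟨‖f‖, by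
    rintro _ ⟨r, rfl⟩
    exact r.norm_integrated_le f⟩⟩

/-- The closure of the image of `C(𝕋, D)` in the universal covariant representation. -/
def crossedSubalgebra : NonUnitalStarSubalgebra ℂ (CovariantProd α) :=
  (NonUnitalStarAlgebra.adjoin ℂ (Set.range (universalRep α))).topologicalClosure

instance : IsClosed (crossedSubalgebra α : Set (CovariantProd α)) :=
  NonUnitalStarSubalgebra.isClosed_topologicalClosure _

/-- The (full) crossed product `D ⋊_α 𝕋`: the completion of the convolution algebra `C(𝕋, D)` in
the norm `‖f‖ = sup ‖(π ⋊ U)(f)‖` over all covariant representations `(π, U)`. -/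
def CrossedProduct : Type (w + 1) := crossedSubalgebra α

instance : NonUnitalCStarAlgebra (CrossedProduct α) :=
  inferInstanceAs (NonUnitalCStarAlgebra (crossedSubalgebra α))

/-! ### The dual action -/

theorem continuous_circle_zpow (k : ℤ) : Continuous fun t : Circle => ((t ^ k : Circle) : ℂ) :=
  continuous_subtype_val.comp (continuous_zpow k)

/-- The unitary representation `t ↦ t ^ k U_t`. -/
def twistU {H : Type w} [NormedAddCommGroup H] [InnerProductSpace ℂ H] [CompleteSpace H] (k : ℤ)
    (U : Circle →* unitary (H →L[ℂ] H)) : Circle →* unitary (H →L[ℂ] H) where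
  toFun t := ⟨((t ^ k : Circle) : ℂ) • (U t : H →L[ℂ] H), by
    have h1 := (Unitary.mem_iff.1 (U t).2).1
    have h2 := (Unitary.mem_iff.1 (U t).2).2
    have h3 : star ((t ^ k : Circle) : ℂ) * ((t ^ k : Circle) : ℂ) = 1 := by
      rw [Complex.star_def, ← Circle.coe_inv_eq_conj, ← Circle.coe_mul, inv_mul_cancel,
        Circle.coe_one]
    rw [Unitary.mem_iff, star_smul, smul_mul_smul_comm, smul_mul_smul_comm, h1, h2,
      mul_comm ((t ^ k : Circle) : ℂ), h3, one_smul]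
    exact ⟨rfl, rfl⟩⟩
  map_one' := Subtype.ext (by simp)
  map_mul' s t := Subtype.ext (by
    simp only [mul_zpow, map_mul, Circle.coe_mul, Submonoid.coe_mul]
    rw [smul_mul_smul_comm])

theorem twistU_twistU {H : Type w} [NormedAddCommGroup H] [InnerProductSpace ℂ H]
    [CompleteSpace H] (k l : ℤ) (U : Circle →* unitary (H →L[ℂ] H)) :
    twistU k (twistU l U) = twistU (k + l) U := by
  refine MonoidHom.ext fun t => Subtype.ext ?_
  change ((t ^ k : Circle) : ℂ) • ((t ^ l : Circle) : ℂ) • (U t : H →L[ℂ] H)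
    = ((t ^ (k + l) : Circle) : ℂ) • (U t : H →L[ℂ] H)
  rw [smul_smul, zpow_add, Circle.coe_mul]

theorem twistU_zero {H : Type w} [NormedAddCommGroup H] [InnerProductSpace ℂ H]
    [CompleteSpace H] (U : Circle →* unitary (H →L[ℂ] H)) : twistU 0 U = U := by
  refine MonoidHom.ext fun t => Subtype.ext ?_
  change ((t ^ (0 : ℤ) : Circle) : ℂ) • (U t : H →L[ℂ] H) = (U t : H →L[ℂ] H)
  rw [zpow_zero, Circle.coe_one, one_smul]

namespace CovariantRep

variable {α}

/-- The covariant representation `(π, χ_k U)` with `χ_k(t) = t ^ k`. -/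
def twist (k : ℤ) (r : CovariantRep α) : CovariantRep α where
  H := r.H
  π := r.π
  U := twistU k r.U
  continuous_U h := (continuous_circle_zpow k).smul (r.continuous_U h)
  covariant t d := by
    change (((t ^ k : Circle) : ℂ) • (r.U t : r.H →L[ℂ] r.H)) * r.π d
      = r.π (α t d) * (((t ^ k : Circle) : ℂ) • (r.U t : r.H →L[ℂ] r.H))
    rw [smul_mul_assoc, mul_smul_comm, r.covariant]

theorem congr_U (x : ∀ r : CovariantRep α, r.H →L[ℂ] r.H) {H : Type w} [NormedAddCommGroup H]
    [InnerProductSpace ℂ H] [CompleteSpace H] (π : D →⋆ₙₐ[ℂ] (H →L[ℂ] H))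
    {U V : Circle →* unitary (H →L[ℂ] H)} (h : U = V) (hU hU' hV hV') :
    x ⟨H, π, U, hU, hU'⟩ = x ⟨H, π, V, hV, hV'⟩ := by
  subst h
  rfl

theorem apply_twist_twist (x : ∀ r : CovariantRep α, r.H →L[ℂ] r.H) (k l : ℤ)
    (r : CovariantRep α) : x ((r.twist l).twist k) = x (r.twist (k + l)) :=
  congr_U x r.π (twistU_twistU k l r.U) _ _ _ _

theorem apply_twist_zero (x : ∀ r : CovariantRep α, r.H →L[ℂ] r.H) (r : CovariantRep α) :
    x (r.twist 0) = x r :=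
  congr_U x r.π (twistU_zero r.U) _ _ _ _

end CovariantRep

/-- Multiplication of `f ∈ C(𝕋, D)` by the character `t ↦ t ^ k`. -/
def modulate (k : ℤ) (f : C(Circle, D)) : C(Circle, D) where
  toFun t := ((t ^ k : Circle) : ℂ) • f t
  continuous_toFun := (continuous_circle_zpow k).smul f.continuous

theorem CovariantRep.integrated_twist (k : ℤ) (r : CovariantRep α) (f : C(Circle, D)) :
    (r.twist k).integrated f = r.integrated (modulate k f) := by
  refine ContinuousLinearMap.ext fun h => ?_
  refine intervalIntegral.integral_congr fun θ _ => ?_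
  generalize Circle.exp (2 * Real.pi * θ) = t
  change r.π (f t) (((t ^ k : Circle) : ℂ) • (r.U t : r.H →L[ℂ] r.H) h)
    = r.π (((t ^ k : Circle) : ℂ) • f t) ((r.U t : r.H →L[ℂ] r.H) h)
  rw [map_smul, map_smul]
  rfl

/-- Relabelling of the factors, `(x_{(π, U)}) ↦ (x_{(π, χ_k U)})`. -/
def relabel (k : ℤ) (x : CovariantProd α) : CovariantProd α :=
  ⟨fun r => x.1 (r.twist k), memℓp_infty ⟨‖x‖, by
    rintro _ ⟨r, rfl⟩
    exact lp.norm_apply_le_norm ENNReal.top_ne_zero x (r.twist k)⟩⟩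

theorem relabel_universalRep (k : ℤ) (f : C(Circle, D)) :
    relabel α k (universalRep α f) = universalRep α (modulate k f) :=
  lp.ext (funext fun r => r.integrated_twist α k f)

/-- `relabel` as a `⋆`-homomorphism. -/
def relabelHom (k : ℤ) : CovariantProd α →⋆ₙₐ[ℂ] CovariantProd α where
  toFun := relabel α k
  map_smul' _ _ := rfl
  map_zero' := rfl
  map_add' _ _ := rfl
  map_mul' _ _ := rfl
  map_star' _ := rfl

theorem relabel_relabel (k l : ℤ) (x : CovariantProd α) :
    relabel α l (relabel α k x) = relabel α (k + l) x :=
  lp.ext (funext fun r => CovariantRep.apply_twist_twist _ k l r)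

theorem relabel_zero (x : CovariantProd α) : relabel α 0 x = x :=
  lp.ext (funext fun r => CovariantRep.apply_twist_zero _ r)

theorem relabelHom_apply (k : ℤ) (x : CovariantProd α) : relabelHom α k x = relabel α k x := rfl

theorem continuous_relabelHom (k : ℤ) : Continuous (relabelHom α k) := by
  have h : ∀ x, ‖relabelHom α k x‖ ≤ ‖x‖ := fun x =>
    lp.norm_le_of_forall_le (norm_nonneg _) fun r =>
      lp.norm_apply_le_norm ENNReal.top_ne_zero x (r.twist k)
  refine (LipschitzWith.of_dist_le_mul (K := 1) fun x y => ?_).continuous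
  rw [dist_eq_norm, dist_eq_norm, ← map_sub, NNReal.coe_one, one_mul]
  exact h (x - y)

theorem relabel_mem (k : ℤ) (x : CovariantProd α) (hx : x ∈ crossedSubalgebra α) :
    relabel α k x ∈ crossedSubalgebra α := by
  refine map_mem_closure_adjoin (relabelHom α k) (continuous_relabelHom α k) ?_ x hx
  rintro _ ⟨f, rfl⟩
  exact ⟨modulate k f, (relabel_universalRep α k f).symm⟩

/-- The dual action `λ̂` of `ℤ` on the crossed product, given on `f ∈ C(𝕋, D)` by
`(λ̂_k f)(t) = t ^ k f(t)`. -/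
def dualAction (k : ℤ) : CrossedProduct α ≃⋆ₐ[ℂ] CrossedProduct α where
  toFun x := ⟨relabel α k x.1, relabel_mem α k x.1 x.2⟩
  invFun x := ⟨relabel α (-k) x.1, relabel_mem α (-k) x.1 x.2⟩
  left_inv x := Subtype.ext (by
    change relabel α (-k) (relabel α k x.1) = x.1
    rw [relabel_relabel, add_neg_cancel, relabel_zero])
  right_inv x := Subtype.ext (by
    change relabel α k (relabel α (-k) x.1) = x.1
    rw [relabel_relabel, neg_add_cancel, relabel_zero])
  map_mul' _ _ := rfl
  map_add' _ _ := rfl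
  map_star' _ := rfl
  map_smul' _ _ := rfl

end CrossedProduct

end CuntzPimsner

end

noncomputable section

open scoped ENNReal MultiplierAlgebra ComplexConjugate

universe u v w

namespace CuntzPimsner

/-! ### Separation by positive functionals -/

section Functional

open scoped ComplexOrder

/-! All computations take place in the product of all covariant representations. There the circle
has spectral projections P_n = ∫ t⁻ⁿ U_t dt (`specProj`). Under the gauge action T_x has degree |x|,
so P_{l+|x|} T_x = T_x P_l. Approximation by trigonometric polynomials then shows that the crossed
product B is the closed span of the elements T_x P_l T_y⋆ (`gen`), which carry degree l + |y| to
degree l + |x|. A product of two of them is zero or again such an element, at the smaller of the two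
levels l (`exists_gen_mul_gen`). Hence the closed span I_n of those with l ≤ -n is an ideal. The
dual action replaces P_l by P_{l-k} and so moves I_n to I_{n+k}; monotonicity and density of the
union are visible on the generators.

The corner P_j B P_j is a copy of the core. Indeed P_j T_x P_l T_y⋆ P_j vanishes unless l + |x| = l
+ |y| = j, and then it equals T_x T_y⋆ P_j with T_x T_y⋆ in the core. So d ↦ d P_j (`coreEmb`) maps
F_E onto P_j B P_j, and the condition l ≤ -n becomes |x| ≥ n + j, which identifies the corner of I_n
with J_{n+j} (with J_0 if n + j < 0). The theorem takes j = 0 and p = P_0. Injectivity requires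
covariant representations in which d P_j is visible: the Fock module, localized at the positive
functionals of A, provides them, and the dual action moves j to any desired degree
(`coreEmb_injective`).

Elements of B are detected on these corners (`eq_zero_of_compress`). Thus ⋂ I_n = 0 reduces to ⋂ J_n
= 0, which holds because J_n kills the vectors of degree < n, and essentiality of I_n reduces to
that of J_n (`eq_zero_of_mul_creationTensor`). For the latter, a core element has the form d = φ₊(a)
+ j with j in J_1. If d kills degree one, then φ(a) is a limit of compact operators, hence φ(a) = 0
and a = 0 by the hypothesis on K(E) and injectivity of φ; so d lies in J_1. If moreover d T_x = 0
whenever |x| ≥ 1, then d J_1 = 0 and d = 0.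

The Morita equivalence of F_E and I_n is given by the row space P_{-n} B. Its left inner products
fill P_{-n} B P_{-n} ≅ F_E. Its right inner products span I_n densely: between T_x and P_l one can
insert elements T_z⋆ T_w with |z| = |w| = -n - l, because fullness of E ⊗ E makes these span φ₊(A)
densely (`gen_mem_cspan_mul`).

For I_n / I_{n+1}, the closed span L_n of the T_x P_{-n} T_y⋆ is a C⋆-algebra complementary to
I_{n+1} in I_n. The Fock representation with grading shifted by n has no negative degrees, so it
kills I_{n+1}, while it is faithful on L_n. Hence L_n itself serves as the quotient, and its row
P_{-n} L_n, with corner φ₊(A) P_{-n}, links it to A. -/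

theorem nonneg_of_norm_le_one {B : Type u} [CStarAlgebra B] (f : B →L[ℂ] ℂ) (hf : ‖f‖ ≤ 1)
    (h1 : f 1 = 1) (x : B) : 0 ≤ f (star x * x) := by
  let _ := CStarAlgebra.spectralOrder B
  let _ := CStarAlgebra.spectralOrderedRing B
  have hle : ∀ y, ‖f y‖ ≤ ‖y‖ := fun y => (f.le_opNorm y).trans (by nlinarith [norm_nonneg y])
  have hy : 0 ≤ star x * x := star_mul_self_nonneg x
  set y := star x * x with hydef
  have hys : star y = y := (IsSelfAdjoint.of_nonneg hy).star_eq
  -- For self-adjoint y and real t one has ‖y + it‖² ≤ ‖y‖² + t², so (Im f(y) + t)² ≤ ‖y‖² + t² for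
  -- every t. Letting t vary forces Im f(y) = 0.
  have him : (f y).im = 0 := by
    have key : ∀ t : ℝ, ((f y).im + t) ^ 2 ≤ ‖y‖ ^ 2 + t ^ 2 := by
      intro t
      have e1 : f (y + ((t : ℂ) * Complex.I) • 1) = f y + (t : ℂ) * Complex.I := by
        rw [map_add, map_smul, h1, smul_eq_mul, mul_one]
      have e2 := hle (y + ((t : ℂ) * Complex.I) • 1)
      have e3 : ‖y + ((t : ℂ) * Complex.I) • (1 : B)‖ ^ 2 ≤ ‖y‖ ^ 2 + t ^ 2 := by
        rw [sq, ← CStarRing.norm_star_mul_self]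
        have e4 : star (y + ((t : ℂ) * Complex.I) • (1 : B)) * (y + ((t : ℂ) * Complex.I) • 1)
            = y * y + ((t ^ 2 : ℝ) : ℂ) • star (1 : B) * 1 := by
          rw [star_add, hys, star_smul, star_one]
          have : star ((t : ℂ) * Complex.I) = -((t : ℂ) * Complex.I) := by
            simp
          rw [this]
          simp only [add_mul, mul_add, smul_mul_assoc, mul_smul_comm, one_mul, mul_one, smul_smul,
            neg_smul, smul_add, smul_neg, neg_mul]
          rw [show ((t : ℂ) * Complex.I) * ((t : ℂ) * Complex.I) = -((t ^ 2 : ℝ) : ℂ) by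
            push_cast; linear_combination ((t : ℂ) ^ 2) * Complex.I_sq, neg_smul, neg_neg]
          abel
        rw [e4]
        refine (norm_add_le _ _).trans ?_
        gcongr
        · exact (norm_mul_le y y).trans (by rw [sq])
        · rw [mul_one, star_one, norm_smul, Complex.norm_real, Real.norm_eq_abs,
            abs_of_nonneg (sq_nonneg t)]
          rcases subsingleton_or_nontrivial B with h | h
          · rw [Subsingleton.elim (1 : B) 0]; simp; positivity
          · rw [norm_one, mul_one]
      rw [e1] at e2
      refine le_trans ?_ e3
      have e5 : |(f y + (t : ℂ) * Complex.I).im| ≤ _ := Complex.abs_im_le_norm _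
      have e6 : (f y + (t : ℂ) * Complex.I).im = (f y).im + t := by simp
      rw [e6] at e5
      rw [← sq_abs]
      gcongr
      exact e5.trans e2
    by_contra hne
    -- This t makes the cross term 2 t Im f(y) equal to ‖y‖² + 1, which exceeds the permitted ‖y‖².
    have hk := key ((‖y‖ ^ 2 + 1) / (2 * (f y).im))
    have : 2 * (f y).im * ((‖y‖ ^ 2 + 1) / (2 * (f y).im)) = ‖y‖ ^ 2 + 1 := by
      field_simp
    nlinarith [sq_nonneg (f y).im]
  -- Since 0 ≤ y ≤ ‖y‖, the element ‖y‖ - y has norm at most ‖y‖, so ‖y‖ - Re f(y) ≤ ‖y‖.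
  have hre : 0 ≤ (f y).re := by
    have e1 : y ≤ algebraMap ℝ B ‖y‖ := IsSelfAdjoint.le_algebraMap_norm_self (.of_nonneg hy)
    have e2 : ‖algebraMap ℝ B ‖y‖ - y‖ ≤ ‖y‖ := by
      refine (CStarAlgebra.norm_le_norm_of_nonneg_of_le (sub_nonneg.2 e1)
        (sub_le_self _ hy)).trans ?_
      rcases subsingleton_or_nontrivial B with h | h
      · rw [Subsingleton.elim (algebraMap ℝ B ‖y‖) 0]; simp
      · simp
    have e3 : f (algebraMap ℝ B ‖y‖ - y) = (‖y‖ : ℂ) - f y := by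
      rw [map_sub, Algebra.algebraMap_eq_smul_one, ← Complex.coe_smul, map_smul, h1, smul_eq_mul,
        mul_one]
    have e4 := (Complex.re_le_norm _).trans ((hle (algebraMap ℝ B ‖y‖ - y)).trans e2)
    rw [e3] at e4
    simp at e4
    exact e4
  exact Complex.nonneg_iff.2 ⟨hre, him.symm⟩

/-- A character of the commutative C⋆-algebra generated by b⋆b takes the value ‖b⋆b‖ there. Its
norm-preserving Hahn–Banach extension still has norm at most 1 and value 1 at the unit, hence is
positive. -/
theorem exists_functional_unital {B : Type u} [CStarAlgebra B] (b : B) (hb : b ≠ 0) :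
    ∃ f : B →L[ℂ] ℂ, (∀ x, 0 ≤ f (star x * x)) ∧ f (star b * b) ≠ 0 := by
  let _ := CStarAlgebra.spectralOrder B
  let _ := CStarAlgebra.spectralOrderedRing B
  have : Nontrivial B := ⟨b, 0, hb⟩
  set a := star b * b with ha
  have ha0 : 0 ≤ a := star_mul_self_nonneg b
  have hn : IsStarNormal a := (IsSelfAdjoint.of_nonneg ha0).isStarNormal
  have hspec : (‖a‖ : ℂ) ∈ spectrum ℂ a := by
    have := spectrum.algebraMap_mem ℂ (CStarAlgebra.norm_mem_spectrum_of_nonneg ha0)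
    simpa using this
  let S := StarAlgebra.elemental ℂ a
  have : IsClosed (S : Set B) := StarAlgebra.elemental.isClosed ℂ a
  let _ : CommCStarAlgebra S := { mul_comm := mul_comm }
  let a' : S := ⟨a, StarAlgebra.elemental.self_mem ℂ a⟩
  have hspec' : (‖a‖ : ℂ) ∈ spectrum ℂ a' := by
    rw [StarSubalgebra.spectrum_eq S]
    exact hspec
  obtain ⟨χ, hχ⟩ := WeakDual.CharacterSpace.mem_spectrum_iff_exists.1 hspec'
  let f₀ : StrongDual ℂ S := LinearMap.mkContinuous
    { toFun := fun x => χ x, map_add' := map_add χ, map_smul' := map_smul χ } 1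
    fun x => by
      rw [one_mul]
      exact spectrum.norm_le_norm_of_mem (WeakDual.CharacterSpace.mem_spectrum_iff_exists.2
        ⟨χ, rfl⟩)
  have hf₀ : ‖f₀‖ ≤ 1 := LinearMap.mkContinuous_norm_le _ zero_le_one _
  obtain ⟨f, hf, hfn⟩ := exists_extension_norm_eq (Subalgebra.toSubmodule S.toSubalgebra) f₀
  refine ⟨f, nonneg_of_norm_le_one f (hfn.trans_le hf₀) ?_, ?_⟩
  · refine (hf (1 : S)).trans ?_
    exact map_one χ
  · refine ne_of_eq_of_ne ((hf a').trans hχ) ?_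
    rw [ha, CStarRing.norm_star_mul_self]
    simpa using hb

theorem leftMul_injective (A : Type u) [NonUnitalCStarAlgebra A] :
    Function.Injective (leftMul : A →⋆ₙₐ[ℂ] Adjointable A A) := by
  intro a b h
  have : leftMul (a - b) (star (a - b)) = 0 := by
    rw [map_sub, h, sub_self]
    rfl
  rw [leftMul_apply, CStarRing.mul_star_self_eq_zero_iff] at this
  exact sub_eq_zero.1 this

theorem continuous_starHom {A : Type u} {B : Type v} [NonUnitalCStarAlgebra A]
    [NonUnitalCStarAlgebra B] (f : A →⋆ₙₐ[ℂ] B) : Continuous f :=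
  AddMonoidHomClass.continuous_of_bound f 1 fun x => by
    rw [one_mul]; exact NonUnitalStarAlgHom.norm_apply_le f x

/-- A `⋆`-homomorphism of C⋆-algebras as a continuous linear map. -/
def homCLM {A : Type u} {B : Type v} [NonUnitalCStarAlgebra A]
    [NonUnitalCStarAlgebra B] (f : A →⋆ₙₐ[ℂ] B) : A →L[ℂ] B where
  toFun := f
  map_add' := map_add f
  map_smul' := map_smul f
  cont := continuous_starHom f

/-- Positive functionals separate the points of a C⋆-algebra. -/
theorem exists_functional {A : Type u} [NonUnitalCStarAlgebra A] (b : A) (hb : b ≠ 0) :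
    ∃ f : A →L[ℂ] ℂ, (∀ x, 0 ≤ f (star x * x)) ∧ f (star b * b) ≠ 0 := by
  -- Left multiplication embeds A in the unital algebra L(A), which supplies the unit needed above.
  obtain ⟨f, hf, hfb⟩ := exists_functional_unital (leftMul b)
    (fun h => hb (leftMul_injective A (h.trans (map_zero leftMul).symm)))
  refine ⟨f.comp (homCLM leftMul), fun x => ?_, ?_⟩
  · change 0 ≤ f (leftMul (star x * x))
    rw [map_mul, map_star]
    exact hf _
  · change f (leftMul (star b * b)) ≠ 0
    rwa [map_mul, map_star]

end Functional


open PreHilbert HilbertModule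

/-! ### Closed linear spans -/

section ClosedSpan

variable {M : Type u} [NormedAddCommGroup M] [NormedSpace ℂ M]
  {N : Type v} [NormedAddCommGroup N] [NormedSpace ℂ N]

/-- The closed linear span. -/
def cspan (S : Set M) : Submodule ℂ M := (Submodule.span ℂ S).topologicalClosure

theorem isClosed_cspan (S : Set M) : IsClosed (cspan S : Set M) :=
  Submodule.isClosed_topologicalClosure _

theorem subset_cspan (S : Set M) : S ⊆ cspan S :=
  Submodule.subset_span.trans (Submodule.le_topologicalClosure _)

theorem mem_cspan {S : Set M} {x : M} (h : x ∈ S) : x ∈ cspan S := subset_cspan S h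

theorem cspan_le {S : Set M} {P : Submodule ℂ M} (hP : IsClosed (P : Set M)) (h : S ⊆ P) :
    cspan S ≤ P :=
  Submodule.topologicalClosure_minimal _ (Submodule.span_le.2 h) hP

theorem cspan_mono {S T : Set M} (h : S ⊆ T) : cspan S ≤ cspan T :=
  cspan_le (isClosed_cspan T) (h.trans (subset_cspan T))

theorem map_mem_of_cspan (f : M →L[ℂ] N) {S : Set M} {P : Submodule ℂ N}
    (hP : IsClosed (P : Set N)) (h : ∀ s ∈ S, f s ∈ P) {x : M} (hx : x ∈ cspan S) : f x ∈ P :=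
  cspan_le (P := P.comap (f : M →ₗ[ℂ] N)) (hP.preimage f.continuous) h hx

theorem map_eq_of_cspan (f g : M →L[ℂ] N) {S : Set M} (h : ∀ s ∈ S, f s = g s) {x : M}
    (hx : x ∈ cspan S) : f x = g x := by
  have := map_mem_of_cspan (f - g) (P := ⊥) isClosed_singleton
    (fun s hs => (sub_eq_zero.2 (h s hs) : (f - g) s = 0)) hx
  exact sub_eq_zero.1 this

theorem map_mem_cspan (f : M →L[ℂ] N) {S : Set M} {T : Set N} (h : ∀ s ∈ S, f s ∈ cspan T) {x : M}
    (hx : x ∈ cspan S) : f x ∈ cspan T :=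
  map_mem_of_cspan f (isClosed_cspan T) h hx

theorem dense_span_iff {S : Set M} :
    Dense (Submodule.span ℂ S : Set M) ↔ ∀ x, x ∈ cspan S :=
  Iff.rfl

end ClosedSpan

section ClosedSpanMul

variable {M : Type u} [NonUnitalCStarAlgebra M]

theorem mul_mem_of_cspan {S T : Set M} {P : Submodule ℂ M} (hP : IsClosed (P : Set M))
    (h : ∀ s ∈ S, ∀ t ∈ T, s * t ∈ P) {x y : M} (hx : x ∈ cspan S) (hy : y ∈ cspan T) :
    x * y ∈ P := by
  refine map_mem_of_cspan (ContinuousLinearMap.mul ℂ M x) hP (fun t ht => ?_) hy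
  exact map_mem_of_cspan ((ContinuousLinearMap.mul ℂ M).flip t) hP (fun s hs => h s hs t ht) hx

theorem star_mem_of_cspan {S : Set M} {P : Submodule ℂ M} (hP : IsClosed (P : Set M))
    (h : ∀ s ∈ S, star s ∈ P) {x : M} (hx : x ∈ cspan S) : star x ∈ P := by
  let Q : Submodule ℂ M :=
    { carrier := {x | star x ∈ P}
      add_mem' := fun ha hb => by
        rw [Set.mem_ofPred_eq, star_add]; exact P.add_mem ha hb
      zero_mem' := by rw [Set.mem_ofPred_eq, star_zero]; exact P.zero_mem
      smul_mem' := fun c x hx => by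
        rw [Set.mem_ofPred_eq, star_smul]; exact P.smul_mem _ hx }
  exact cspan_le (P := Q) (hP.preimage continuous_star) h hx

/-- The closed span of a set with suitable multiplication properties, as a `⋆`-subalgebra. -/
def cspanAlg (S : Set M) (hmul : ∀ s ∈ S, ∀ t ∈ S, s * t ∈ cspan S)
    (hstar : ∀ s ∈ S, star s ∈ cspan S) : NonUnitalStarSubalgebra ℂ M where
  toSubmodule := cspan S
  mul_mem' := fun ha hb => mul_mem_of_cspan (isClosed_cspan S) hmul ha hb
  star_mem' := fun ha => star_mem_of_cspan (isClosed_cspan S) hstar ha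

/-- Under these hypotheses the closed span is already a `⋆`-algebra. Every generated algebra below
is handled as a closed span in this way, so that claims need only be checked on generators. -/
theorem mem_closure_adjoin_iff {S : Set M} (hmul : ∀ s ∈ S, ∀ t ∈ S, s * t ∈ cspan S)
    (hstar : ∀ s ∈ S, star s ∈ cspan S) {x : M} :
    x ∈ (NonUnitalStarAlgebra.adjoin ℂ S).topologicalClosure ↔ x ∈ cspan S := by
  constructor
  · intro hx
    exact NonUnitalStarSubalgebra.topologicalClosure_minimal (t := cspanAlg S hmul hstar) _
      (NonUnitalStarAlgebra.adjoin_le (subset_cspan S)) (isClosed_cspan S) hx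
  · refine fun hx => cspan_le (P := ((NonUnitalStarAlgebra.adjoin ℂ S).topologicalClosure
      ).toNonUnitalSubalgebra.toSubmodule) (NonUnitalStarSubalgebra.isClosed_topologicalClosure _)
      (fun s hs => ?_) hx
    exact NonUnitalStarSubalgebra.le_topologicalClosure _ (NonUnitalStarAlgebra.subset_adjoin ℂ _ hs)

theorem cspan_le_subalgebra {S : Set M} (T : NonUnitalStarSubalgebra ℂ M)
    (hT : IsClosed (T : Set M)) (h : S ⊆ T) {x : M} (hx : x ∈ cspan S) : x ∈ T :=
  cspan_le (P := T.toNonUnitalSubalgebra.toSubmodule) hT h hx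

theorem eq_zero_of_mul_star_self {x : M} (h : x * star x = 0) : x = 0 :=
  (CStarRing.mul_star_self_eq_zero_iff x).1 h

theorem eq_zero_of_star_mul_self {x : M} (h : star x * x = 0) : x = 0 :=
  (CStarRing.star_mul_self_eq_zero_iff x).1 h

/-- If `x s = 0` for all `s ∈ S` and `x⋆` is in the closed span of `S`, then `x = 0`. -/
theorem eq_zero_of_mul_cspan {S : Set M} {x : M} (h : ∀ s ∈ S, x * s = 0) (hx : star x ∈ cspan S) :
    x = 0 :=
  eq_zero_of_mul_star_self
    (map_eq_of_cspan (ContinuousLinearMap.mul ℂ M x) 0 h hx)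

theorem exists_approximateUnit (A : Type v) [NonUnitalCStarAlgebra A] :
    ∃ l : Filter A, l.IsApproximateUnit := by
  let _ := CStarAlgebra.spectralOrder A
  let _ := CStarAlgebra.spectralOrderedRing A
  exact ⟨_, (CStarAlgebra.increasingApproximateUnit A).toIsApproximateUnit⟩

/-- Let b run through an approximate unit, so that ab tends to a. This replaces the unit of A
throughout: a statement about a may be proved for all products ab. -/
theorem mem_of_mul_mem {A : Type v} [NonUnitalCStarAlgebra A] {F : Type w} [TopologicalSpace F]
    {g : A → F} (hg : Continuous g) {P : Set F} (hP : IsClosed P) {a : A}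
    (h : ∀ b, g (a * b) ∈ P) : g a ∈ P := by
  obtain ⟨l, hl⟩ := exists_approximateUnit A
  have := hl.neBot
  exact hP.mem_of_tendsto ((hg.tendsto a).comp (hl.tendsto_mul_left a))
    (Filter.Eventually.of_forall h)

/-- Positivity does not depend on the ambient algebra. If N = R⋆R is the negative part of s formed
inside S, then N s N = -N³, while N s N = (xN)⋆(xN) is positive in M. So N³ = (RN)⋆(RN) is both
positive and negative, RN = 0, and N = 0. -/
theorem isPos_subalgebra (S : NonUnitalStarSubalgebra ℂ M) [IsClosed (S : Set M)] (s : S) (x : M)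
    (h : (s : M) = star x * x) : IsPos s := by
  have hs : star s = s := Subtype.ext (by
    change star (s : M) = s
    rw [h, star_mul, star_star])
  obtain ⟨N, R, hR, hN, h1, h2⟩ := exists_neg_part s hs
  obtain ⟨B, hB⟩ := h2 (by
    have e1 : star (x * N) * (x * N) = -(star ((R : M) * N) * (R * N)) := by
      have e2 := congrArg (Subtype.val : S → M) h1
      change star (N : M) * s * N = -((N : M) * N * N) at e2
      have e3 : (N : M) = star (R : M) * R := congrArg (Subtype.val : S → M) hR
      have e4 : star (N : M) = N := congrArg (Subtype.val : S → M) hN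
      rw [h] at e2
      rw [star_mul, star_mul, mul_assoc, ← mul_assoc (star x), ← mul_assoc, e2, e4, mul_assoc
        (N : M) (star (R : M)), ← mul_assoc (star (R : M)), ← e3, mul_assoc]
    have e5 : IsPos (star ((R : M) * N) * (R * N)) := ⟨_, rfl⟩
    have e6 : IsPos (0 - star ((R : M) * N) * (R * N)) := by
      rw [zero_sub, ← e1]; exact ⟨_, rfl⟩
    have e7 := e5.norm_le e6
    rw [norm_zero] at e7
    have e8 : R * N = 0 := Subtype.ext
      (eq_zero_of_star_mul_self (norm_le_zero_iff.1 e7))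
    refine eq_zero_of_star_mul_self ?_
    rw [hN]
    nth_rewrite 1 [hR]
    rw [mul_assoc, e8, mul_zero])
  exact ⟨B, hB⟩

end ClosedSpanMul

/-! ### Ternary rings of operators and Morita equivalence -/

section Morita

variable {M : Type v} [NonUnitalCStarAlgebra M] (S : NonUnitalStarSubalgebra ℂ M)
  [hS : IsClosed (S : Set M)] (X : Submodule ℂ M) [CompleteSpace X]
  (hXS : ∀ x ∈ X, ∀ s ∈ S, x * s ∈ X) (hip : ∀ x ∈ X, ∀ y ∈ X, star x * y ∈ S)

/-- A closed subspace `X` of a C⋆-algebra with `X S ⊆ X` and `X⋆ X ⊆ S`, as a Hilbert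
`S`-module. -/
abbrev subspaceHilbertModule : HilbertModule S X where
  act x s := ⟨x * s, hXS x x.2 s s.2⟩
  ip x y := ⟨star (x : M) * y, hip x x.2 y y.2⟩
  ip_add_right x y z := Subtype.ext (mul_add _ _ _)
  ip_smul_right c x y := Subtype.ext (mul_smul_comm _ _ _)
  ip_act_right x y a := Subtype.ext (mul_assoc _ _ _).symm
  star_ip x y := Subtype.ext (by
    change star (star (x : M) * y) = star (y : M) * x
    rw [star_mul, star_star])
  ip_self_pos x := isPos_subalgebra S _ x rfl
  norm_sq x := (sq _).trans (CStarRing.norm_star_mul_self (x := (x : M))).symm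

/-- Left multiplication on `X`. -/
def leftMulSub {C : Type u} [NonUnitalCStarAlgebra C] (j : C →⋆ₙₐ[ℂ] M)
    (hjX : ∀ c, ∀ x ∈ X, j c * x ∈ X) :
    let _ := subspaceHilbertModule S X hXS hip
    C →⋆ₙₐ[ℂ] Adjointable S X :=
  let _ := subspaceHilbertModule S X hXS hip
  have hmem : ∀ c (x : X), ((ContinuousLinearMap.mul ℂ M (j c)).comp X.subtypeL) x ∈ X :=
    fun c x => hjX c x x.2
  let op : C → X →L[ℂ] X := fun c =>
    ((ContinuousLinearMap.mul ℂ M (j c)).comp X.subtypeL).codRestrict X (hmem c)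
  { toFun := fun c => ⟨op c, op (star c), fun x y => Subtype.ext (by
      change star (j (star c) * (x : M)) * y = star (x : M) * (j c * y)
      rw [map_star, star_mul, star_star, mul_assoc])⟩
    map_smul' := fun r c => Adjointable.ext_ip fun x y => Subtype.ext (by
      change star (x : M) * (j (r • c) * y) = star (x : M) * (r • (j c * (y : M)))
      rw [map_smul, smul_mul_assoc])
    map_zero' := Adjointable.ext_ip fun x y => Subtype.ext (by
      change star (x : M) * (j 0 * y) = star (x : M) * 0
      rw [map_zero, zero_mul])
    map_add' := fun a b => Adjointable.ext_ip fun x y => Subtype.ext (by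
      change star (x : M) * (j (a + b) * y) = star (x : M) * (j a * y + j b * y)
      rw [map_add, add_mul])
    map_mul' := fun a b => Adjointable.ext_ip fun x y => Subtype.ext (by
      change star (x : M) * (j (a * b) * y) = star (x : M) * (j a * (j b * y))
      rw [map_mul, mul_assoc])
    map_star' := fun a => Adjointable.ext_ip fun x y => by
      refine Eq.trans (Subtype.ext ?_) (Adjointable.ip_star_right _ x y).symm
      change star (x : M) * (j (star a) * y) = star (j a * x) * y
      rw [map_star, star_mul, mul_assoc] }

end Morita

/-- A closed subspace `X` of a C⋆-algebra `M` with `C ≅ [X X⋆]` and `S = [X⋆ X]` gives a strong Morita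
equivalence of `C` and `S`. -/
theorem moritaEquiv_of_subspace {C : Type u} [NonUnitalCStarAlgebra C] {M : Type (max u v)}
    [NonUnitalCStarAlgebra M] (S : NonUnitalStarSubalgebra ℂ M) [hS : IsClosed (S : Set M)]
    (X : Submodule ℂ M) (hX : IsClosed (X : Set M)) (j : C →⋆ₙₐ[ℂ] M)
    (hj : Function.Injective j)
    (hXS : ∀ x ∈ X, ∀ s ∈ S, x * s ∈ X) (hip : ∀ x ∈ X, ∀ y ∈ X, star x * y ∈ S)
    (hjX : ∀ c, ∀ x ∈ X, j c * x ∈ X)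
    (hfull : ∀ s ∈ S, s ∈ cspan {m | ∃ x ∈ X, ∃ y ∈ X, m = star x * y})
    (htheta : ∀ x ∈ X, ∀ y ∈ X, ∃ c, j c = x * star y)
    (hspan : ∀ c, c ∈ cspan {c | ∃ x ∈ X, ∃ y ∈ X, j c = x * star y}) :
    MoritaEquiv C S := by
  have : CompleteSpace X := hX.completeSpace_coe
  let _ := subspaceHilbertModule S X hXS hip
  let Λ : C →⋆ₙₐ[ℂ] Adjointable S X := leftMulSub S X hXS hip j hjX
  have hΛ : ∀ c (x : X), ((Λ c x : X) : M) = j c * x := fun c x => rfl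
  -- An element c acting as zero on X satisfies j(c) x y⋆ = 0, so it annihilates a set with dense
  -- span in C.
  have hinj : Function.Injective Λ := by
    rw [injective_iff_map_eq_zero]
    intro c hc
    refine eq_zero_of_mul_cspan (S := {c | ∃ x ∈ X, ∃ y ∈ X, j c = x * star y}) ?_ (hspan _)
    rintro d ⟨x, hx, y, hy, hd⟩
    refine hj ?_
    have h1 := hΛ c ⟨x, hx⟩
    rw [hc] at h1
    change (0 : M) = j c * x at h1
    rw [map_mul, hd, ← mul_assoc, ← h1, zero_mul, map_zero]
  have htheta' : ∀ (x y : X) (c : C), j c = x * star (y : M) → Λ c = theta x y := fun x y c hc =>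
    Adjointable.ext_ip fun z w => Subtype.ext (by
      change star (z : M) * (j c * w) = star (z : M) * (x * (star (y : M) * w))
      rw [hc, mul_assoc])
  have hmem : ∀ c, Λ c ∈ Compacts S X := fun c => by
    refine map_mem_of_cspan (homCLM Λ)
      (P := (Compacts S X).toNonUnitalSubalgebra.toSubmodule)
      (NonUnitalStarSubalgebra.isClosed_topologicalClosure _) ?_ (hspan c)
    rintro d ⟨x, hx, y, hy, hd⟩
    refine NonUnitalStarSubalgebra.le_topologicalClosure _
      (NonUnitalStarAlgebra.subset_adjoin ℂ _ ⟨⟨x, hx⟩, ⟨y, hy⟩, ?_⟩)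
    exact htheta' ⟨x, hx⟩ ⟨y, hy⟩ d hd
  -- The range contains all θ_{x,y}, and it is closed because an injective `⋆`-homomorphism is
  -- isometric.
  have hsurj : ∀ T ∈ Compacts S X, ∃ c, Λ c = T := by
    intro T hT
    have h1 : T ∈ NonUnitalStarAlgHom.range Λ := by
      refine NonUnitalStarSubalgebra.topologicalClosure_minimal _
        (NonUnitalStarAlgebra.adjoin_le ?_) ?_ hT
      · rintro _ ⟨x, y, rfl⟩
        obtain ⟨c, hc⟩ := htheta x x.2 y y.2
        exact ⟨c, htheta' x y c hc⟩
      · rw [NonUnitalStarAlgHom.coe_range]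
        exact (NonUnitalStarAlgHom.isometry Λ hinj).isClosedEmbedding.isClosed_range
    exact h1
  refine ⟨X, inferInstance, inferInstance, inferInstance, inferInstance, ?_, ⟨?_⟩⟩
  · refine dense_span_iff.2 fun s => ?_
    let ι : S →ₗ[ℂ] M :=
      { toFun := Subtype.val, map_add' := fun _ _ => rfl, map_smul' := fun _ _ => rfl }
    have h1 : IsClosed ((cspan {a : S | ∃ x y : X, a = ip x y}).map ι : Set M) := by
      rw [Submodule.map_coe]
      exact hS.isClosedEmbedding_subtypeVal.isClosedMap _ (isClosed_cspan _)
    have h2 := cspan_le h1 (S := {m | ∃ x ∈ X, ∃ y ∈ X, m = star x * y}) (by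
      rintro _ ⟨x, hx, y, hy, rfl⟩
      exact ⟨⟨star x * y, hip x hx y hy⟩, mem_cspan ⟨⟨x, hx⟩, ⟨y, hy⟩, rfl⟩, rfl⟩)
      (hfull s s.2)
    obtain ⟨s', hs', h3⟩ := h2
    have : s' = s := Subtype.ext h3
    rwa [← this]
  · exact StarAlgEquiv.ofBijective (NonUnitalStarAlgHom.codRestrict Λ (Compacts S X) hmem)
      ⟨fun a b hab => hinj (congrArg Subtype.val hab), fun T => by
        obtain ⟨c, hc⟩ := hsurj T T.2
        exact ⟨c, Subtype.ext hc⟩⟩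


open PreHilbert HilbertModule PreFock Fock

/-! ### Calculus of elementary tensors on the Fock module -/

section FockCalculus

variable {A : Type u} {X : Type v} [NonUnitalCStarAlgebra A] [NormedAddCommGroup X]
  [NormedSpace ℂ X] [CompleteSpace X] [HilbertModule A X] (φ : A →⋆ₙₐ[ℂ] Adjointable A X)

variable {φ} in
theorem Fock.eq_of_ip_emb {x y : Fock φ} (h : ∀ f, ip (A := A) (emb φ f) x = ip (emb φ f) y) :
    x = y := by
  refine eq_of_ip (A := A) fun z => ?_
  induction z using Fock.induction with
  | hc => exact isClosed_ip_eq (by fun_prop) (by fun_prop) (by fun_prop) (by fun_prop)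
  | h f => exact h f

variable {φ} in
-- The relations of the balanced tensor product hold only modulo null vectors of the algebraic Fock
-- space. Identities depending on them are therefore compared through inner products of words.
theorem adjointable_ext_ip {T S : Adjointable A (Fock φ)}
    (h : ∀ x y : Word A X, ip (A := A) (emb φ (tensor φ x)) (T (emb φ (tensor φ y)))
      = ip (emb φ (tensor φ x)) (S (emb φ (tensor φ y)))) : T = S := by
  refine adjointable_ext fun y => Fock.eq_of_ip_emb fun f => ?_
  induction f using PreFock.induction with
  | h0 => rw [map_zero, ip_zero_left, ip_zero_left]
  | hadd f g hf hg => rw [map_add, ip_add_left, ip_add_left, hf, hg]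
  | ht x => exact h x y

theorem Fock.star_op_emb (T S : PreFock φ →ₗ[ℂ] PreFock φ)
    (hTS : ∀ f g, ip (A := A) (S f) g = ip f (T g)) (C : ℝ)
    (hT : ∀ f, ‖T f‖ ≤ C * ‖f‖) (f : PreFock φ) :
    (star (op φ T S hTS C hT)) (emb φ f) = emb φ (S f) := by
  refine Fock.eq_of_ip_emb fun g => ?_
  rw [Adjointable.ip_star_right, op_emb, ip_emb, ip_emb, ← star_ip, ← hTS, star_ip]

theorem star_creation_emb (ξ : X) (f : PreFock φ) :
    (star (creation φ ξ)) (emb φ f) = emb φ (annihilateL φ ξ f) := star_op_emb _ _ _ _ _ _ f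

theorem leftAction_emb (a : A) (f : PreFock φ) :
    leftAction φ a (emb φ f) = emb φ (pairL φ (leftPair φ a) f) := op_emb _ _ _ _ _ f

theorem leftAction_tensor (a : A) (x : Word A X) :
    leftAction φ a (emb φ (tensor φ x)) = emb φ (tensor φ (mulW (leftPair φ a) x)) := by
  rw [leftAction_emb, pairL_tensor]

theorem creation_tensor (ξ : X) (x : Word A X) :
    creation φ ξ (emb φ (tensor φ x)) = emb φ (tensor φ (ξ :: x.1, x.2)) := by
  rw [creation_emb]
  exact congrArg _ (createL_tensor φ ξ x.1 x.2)

theorem ip_emb_tensor (x y : Word A X) :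
    ip (A := A) (emb φ (tensor φ x)) (emb φ (tensor φ y)) = wip φ x y := by
  rw [ip_emb, ip_tensor]

/-- The left action of `A` on the Fock module as a `⋆`-homomorphism. -/
def leftHom : A →⋆ₙₐ[ℂ] Adjointable A (Fock φ) where
  toFun := leftAction φ
  map_smul' c a := adjointable_ext_ip fun x y => by
    rw [Adjointable.smul_apply, ip_smul_right]
    simp only [leftAction_tensor, ip_emb_tensor, map_smul, wip, gram_mulW_smul, mul_smul_comm]
    rfl
  map_zero' := adjointable_ext_ip fun x y => by
    have := gram_mulW_smul φ x.1 0 (leftPair φ 0) y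
    rw [zero_smul, zero_smul] at this
    rw [leftAction_tensor, ip_emb_tensor, map_zero, wip, this, mul_zero]
    exact (ip_zero_right _).symm
  map_add' a b := adjointable_ext_ip fun x y => by
    rw [Adjointable.add_apply, ip_add_right]
    simp only [leftAction_tensor, ip_emb_tensor, map_add, wip, gram_mulW_add, mul_add]
  map_mul' a b := adjointable_ext_ip fun x y => by
    rw [Adjointable.mul_apply]
    simp only [leftAction_tensor, map_mul, mulW_mul]
  map_star' a := adjointable_ext_ip fun x y => by
    rw [Adjointable.ip_star_right]
    simp only [leftAction_tensor, ip_emb_tensor, wip_mulW_left, map_star]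

theorem leftHom_apply (a : A) : leftHom φ a = leftAction φ a := rfl

theorem creation_add (ξ η : X) : creation φ (ξ + η) = creation φ ξ + creation φ η :=
  adjointable_ext_ip fun x y => by
    rw [Adjointable.add_apply, ip_add_right]
    simp only [creation_tensor, ip_emb_tensor]
    obtain ⟨_ | ⟨ζ, u⟩, a⟩ := x
    · simp only [wip_nil_cons, add_zero]
    · rw [wip_cons, wip_cons, wip_cons, ip_add_right, map_add, wip, gram_mulW_add, mul_add]
      rfl

theorem creation_smul (c : ℂ) (ξ : X) : creation φ (c • ξ) = c • creation φ ξ :=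
  adjointable_ext_ip fun x y => by
    rw [Adjointable.smul_apply, ip_smul_right]
    simp only [creation_tensor, ip_emb_tensor]
    obtain ⟨_ | ⟨ζ, u⟩, a⟩ := x
    · simp only [wip_nil_cons, smul_zero]
    · rw [wip_cons, wip_cons, ip_smul_right, map_smul, wip, gram_mulW_smul, mul_smul_comm]
      rfl

theorem leftAction_creation (a : A) (ξ : X) :
    leftAction φ a * creation φ ξ = creation φ (φ a ξ) :=
  adjointable_ext fun x => by
    rw [Adjointable.mul_apply, creation_tensor, leftAction_tensor, creation_tensor]
    rfl

theorem creation_leftAction (ξ : X) (a : A) :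
    creation φ ξ * leftAction φ a = creation φ (act ξ a) :=
  adjointable_ext_ip fun x y => by
    rw [Adjointable.mul_apply]
    simp only [creation_tensor, leftAction_tensor, ip_emb_tensor]
    obtain ⟨_ | ⟨ζ, u⟩, b⟩ := x
    · simp only [wip_nil_cons]
    · simp only [wip_cons, ip_act_right, map_mul, mulW_mul]

theorem star_creation_mul (ξ η : X) :
    star (creation φ ξ) * creation φ η = leftAction φ (ip ξ η) :=
  adjointable_ext fun x => by
    rw [Adjointable.mul_apply, creation_tensor, star_creation_emb, leftAction_emb,
      annihilateL_cons]

theorem creationTensor_nil (a : A) : creationTensor φ ([], a) = leftAction φ a := rfl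

theorem creationTensor_cons (ξ : X) (u : List X) (a : A) :
    creationTensor φ (ξ :: u, a) = creation φ ξ * creationTensor φ (u, a) := rfl

theorem leftAction_mul (a b : A) : leftAction φ a * leftAction φ b = leftAction φ (a * b) :=
  (map_mul (leftHom φ) a b).symm

theorem star_leftAction (a : A) : star (leftAction φ a) = leftAction φ (star a) :=
  (map_star (leftHom φ) a).symm

theorem leftAction_creationTensor (a : A) (x : Word A X) :
    leftAction φ a * creationTensor φ x = creationTensor φ (mulW (leftPair φ a) x) := by
  obtain ⟨_ | ⟨ξ, u⟩, b⟩ := x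
  · exact leftAction_mul φ a b
  · rw [creationTensor_cons, ← mul_assoc, leftAction_creation]
    rfl

theorem creationTensor_leftAction (x : Word A X) (a : A) :
    creationTensor φ x * leftAction φ a = creationTensor φ (x.1, x.2 * a) := by
  obtain ⟨u, b⟩ := x
  induction u with
  | nil => exact leftAction_mul φ b a
  | cons ξ u ih => rw [creationTensor_cons, mul_assoc, ih]; rfl

theorem exists_creationTensor_mul (x y : Word A X) :
    ∃ z : Word A X, z.1.length = x.1.length + y.1.length ∧
      creationTensor φ x * creationTensor φ y = creationTensor φ z := by
  obtain ⟨u, a⟩ := x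
  induction u with
  | nil => exact ⟨_, by rw [length_mulW]; simp, leftAction_creationTensor φ a y⟩
  | cons ξ u ih =>
    obtain ⟨z, hz, h⟩ := ih
    refine ⟨(ξ :: z.1, z.2), ?_, ?_⟩
    · simp only [List.length_cons, hz]; omega
    · rw [creationTensor_cons, mul_assoc, h]; rfl

/-- T_ξ⋆ T_η = φ₊(⟨ξ, η⟩) is absorbed into the next letter of the second word, or into its
coefficient when no letter is left. Peeling off letters one by one exhausts the shorter word x. -/
theorem exists_star_creationTensor_mul (x y : Word A X) (h : x.1.length ≤ y.1.length) :
    ∃ z : Word A X, z.1.length = y.1.length - x.1.length ∧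
      star (creationTensor φ x) * creationTensor φ y = creationTensor φ z := by
  obtain ⟨u, a⟩ := x
  induction u generalizing y with
  | nil =>
    exact ⟨mulW (leftPair φ (star a)) y, by rw [length_mulW]; simp, by
      rw [creationTensor_nil, star_leftAction, leftAction_creationTensor]⟩
  | cons ξ u ih =>
    obtain ⟨_ | ⟨η, v⟩, b⟩ := y
    · simp at h
    · obtain ⟨z, hz, h'⟩ := ih (mulW (leftPair φ (ip ξ η)) (v, b)) (by
        rw [length_mulW]; simpa using h)
      refine ⟨z, ?_, ?_⟩
      · rw [hz, length_mulW]; simp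
      · rw [creationTensor_cons, creationTensor_cons, star_mul, mul_assoc,
          ← mul_assoc (star (creation φ ξ)), star_creation_mul, leftAction_creationTensor, h']

theorem star_creationTensor_mul_of_length_eq (x y : Word A X) (h : x.1.length = y.1.length) :
    ∃ a : A, star (creationTensor φ x) * creationTensor φ y = leftAction φ a := by
  obtain ⟨⟨u, a⟩, hz, h'⟩ := exists_star_creationTensor_mul φ x y h.le
  rw [h, Nat.sub_self] at hz
  obtain rfl := List.length_eq_zero_iff.1 hz
  exact ⟨a, h'⟩

theorem exists_star_creationTensor_mul' (x y : Word A X) (h : y.1.length ≤ x.1.length) :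
    ∃ z : Word A X, z.1.length = x.1.length - y.1.length ∧
      star (creationTensor φ x) * creationTensor φ y = star (creationTensor φ z) := by
  obtain ⟨z, hz, h'⟩ := exists_star_creationTensor_mul φ y x h
  exact ⟨z, hz, by rw [← h', star_mul, star_star]⟩

theorem creationTensor_vacuum (x : Word A X) (b : A) :
    creationTensor φ x (emb φ (tensor φ ([], b))) = emb φ (tensor φ (x.1, x.2 * b)) := by
  obtain ⟨u, a⟩ := x
  induction u with
  | nil => exact leftAction_tensor φ a ([], b)
  | cons ξ u ih => rw [creationTensor_cons, Adjointable.mul_apply, ih, creation_tensor]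

theorem star_creationTensor_vacuum (x : Word A X) (h : x.1 ≠ []) (b : A) :
    (star (creationTensor φ x)) (emb φ (tensor φ ([], b))) = 0 := by
  obtain ⟨_ | ⟨ξ, u⟩, a⟩ := x
  · exact absurd rfl h
  · rw [creationTensor_cons, star_mul, Adjointable.mul_apply, star_creation_emb, annihilateL_nil,
      map_zero]
    exact map_zero (Adjointable.toCLM _)

/-- `a ↦ T_{ξ₁} ⋯ T_{ξₙ} φ₊(a)` as a continuous linear map. -/
def creationTensorL (u : List X) : A →L[ℂ] Adjointable A (Fock φ) :=
  (ContinuousLinearMap.mul ℂ _ (u.foldr (fun ξ T => creation φ ξ * T) 1)).comp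
    (homCLM (leftHom φ))

theorem creationTensorL_apply (u : List X) (a : A) :
    creationTensorL φ u a = creationTensor φ (u, a) := by
  change u.foldr (fun ξ T => creation φ ξ * T) 1 * leftAction φ a = _
  induction u with
  | nil => exact one_mul _
  | cons ξ u ih => rw [List.foldr_cons, mul_assoc, ih]; rfl

theorem norm_vacuum (a : A) : ‖emb φ (tensor φ ([], a))‖ = ‖a‖ := by
  rw [← sq_eq_sq₀ (norm_nonneg _) (norm_nonneg _), HilbertModule.norm_sq (A := A), ip_emb_tensor]
  change ‖star a * a‖ = _
  rw [CStarRing.norm_star_mul_self, sq]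

/-- The vectors `ξ₁ ⊗ ⋯ ⊗ ξₙ a` depend continuously and linearly on `a`. -/
theorem continuous_tensor (u : List X) : Continuous fun a : A => emb φ (tensor φ (u, a)) := by
  induction u with
  | nil =>
    exact AddMonoidHomClass.continuous_of_bound
      ((emb φ : PreFock φ →ₗ[ℂ] Fock φ) ∘ₗ tensorL φ []) 1 fun a => by
        rw [one_mul]; exact (norm_vacuum φ a).le
  | cons ξ u ih =>
    refine ((creation φ ξ).toCLM.continuous.comp ih).congr fun a => ?_
    exact creation_tensor φ ξ (u, a)

/-- An operator which annihilates all `T_x`, `|x| = n`, annihilates the vectors of degree `n`. -/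
theorem apply_tensor_eq_zero (d : Adjointable A (Fock φ)) (u : List X)
    (h : ∀ a, d * creationTensor φ (u, a) = 0) (a : A) : d (emb φ (tensor φ (u, a))) = 0 := by
  refine mem_of_mul_mem (g := fun a => d (emb φ (tensor φ (u, a)))) (P := {0})
    (d.toCLM.continuous.comp (continuous_tensor φ u)) isClosed_singleton fun b => ?_
  change d (emb φ (tensor φ (u, a * b))) = 0
  rw [← creationTensor_vacuum φ (u, a) b, ← Adjointable.mul_apply, h]
  rfl

/-! ### Homogeneity -/

theorem gradeOp_leftAction (t : Circle) (a : A) :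
    gradeOp φ t * leftAction φ a = leftAction φ a * gradeOp φ t :=
  adjointable_ext fun x => by
    rw [Adjointable.mul_apply, Adjointable.mul_apply, leftAction_tensor, gradeOp_emb, gradeOp_emb,
      gradeL_tensor, gradeL_tensor, map_smul, map_smul, length_mulW, Adjointable.map_smul,
      leftAction_tensor]

theorem gradeOp_creationTensor (t : Circle) (x : Word A X) :
    gradeOp φ t * creationTensor φ x
      = (t : ℂ) ^ x.1.length • (creationTensor φ x * gradeOp φ t) := by
  obtain ⟨u, a⟩ := x
  induction u with
  | nil =>
    rw [List.length_nil, pow_zero, one_smul]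
    exact gradeOp_leftAction φ t a
  | cons ξ u ih =>
    rw [creationTensor_cons, ← mul_assoc, gradeOp_creation, smul_mul_assoc, mul_assoc, ih,
      mul_smul_comm, smul_smul, List.length_cons, pow_succ', mul_assoc]

theorem gaugeAd_creationTensor (t : Circle) (x : Word A X) :
    gaugeAd φ t (creationTensor φ x) = (t : ℂ) ^ x.1.length • creationTensor φ x := by
  rw [gaugeAd_apply, gradeOp_creationTensor, smul_mul_assoc, mul_assoc, star_gradeOp,
    ← gradeOp_mul, mul_inv_cancel, gradeOp_one, mul_one]

/-! ### Density of inner products of tensor powers -/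

/-- The inner products of elementary tensors of length `k` span a dense subspace of `A`. -/
theorem leftAction_mem_cspan
    (hfull₂ : Dense (Submodule.span ℂ {a : A | ∃ (x y : X) (b : A), a = ip x (φ b y)} : Set A))
    (k : ℕ) (a : A) : leftAction φ a ∈ cspan {T | ∃ x y : Word A X, x.1.length = k ∧
      y.1.length = k ∧ T = star (creationTensor φ x) * creationTensor φ y} := by
  induction k generalizing a with
  | zero =>
    refine mem_of_mul_mem (g := leftAction φ) (continuous_starHom (leftHom φ))
      (isClosed_cspan _) fun b => mem_cspan ⟨([], star a), ([], b), rfl, rfl, ?_⟩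
    rw [creationTensor_nil, creationTensor_nil, star_leftAction, star_star, leftAction_mul]
  | succ k ih =>
    set V := cspan {T : Adjointable A (Fock φ) | ∃ x y : Word A X, x.1.length = k + 1 ∧
      y.1.length = k + 1 ∧ T = star (creationTensor φ x) * creationTensor φ y} with hV
    -- A word operator ends with a coefficient φ₊(a). Since A need not have a unit, T_x T_ξ becomes
    -- a word operator only after multiplication by some φ₊(a).
    have hword : ∀ (x : Word A X) (ξ : X) (a : A), x.1.length = k → ∃ z : Word A X,
        z.1.length = k + 1 ∧ creationTensor φ x * creation φ ξ * leftAction φ a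
          = creationTensor φ z := fun x ξ a hx => by
      obtain ⟨z, hz, h⟩ := exists_creationTensor_mul φ x ([ξ], a)
      refine ⟨z, by rw [hz, hx]; rfl, ?_⟩
      rw [← h, mul_assoc]; rfl
    -- Here φ₊(⟨ξ, φ(c)η⟩) = T_ξ⋆ φ₊(c) T_η, and by induction φ₊(c) is approximated by combinations
    -- of T_x⋆ T_y with |x| = |y| = k. The outer factors φ₊(a) and φ₊(b) supply the final
    -- coefficients of the longer words.
    have h1 : ∀ (a b c : A) (ξ η : X),
        leftAction φ (a * ip ξ (φ c η) * b) ∈ V := fun a b c ξ η => by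
      have e : leftAction φ (a * ip ξ (φ c η) * b) = leftAction φ a * (star (creation φ ξ) *
          leftAction φ c * creation φ η) * leftAction φ b := by
        rw [mul_assoc (star (creation φ ξ)), leftAction_creation, star_creation_mul,
          leftAction_mul, leftAction_mul]
      rw [e]
      let L : Adjointable A (Fock φ) →L[ℂ] Adjointable A (Fock φ) :=
        ((ContinuousLinearMap.mul ℂ _).flip (leftAction φ b)).comp
          ((ContinuousLinearMap.mul ℂ _ (leftAction φ a)).comp
            (((ContinuousLinearMap.mul ℂ _).flip (creation φ η)).comp
              (ContinuousLinearMap.mul ℂ _ (star (creation φ ξ)))))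
      refine map_mem_cspan L ?_ (ih c)
      rintro _ ⟨x, y, hx, hy, rfl⟩
      obtain ⟨x', hx', hx''⟩ := hword x ξ (star a) hx
      obtain ⟨y', hy', hy''⟩ := hword y η b hy
      refine mem_cspan ⟨x', y', hx', hy', ?_⟩
      rw [← hx'', ← hy'']
      change leftAction φ a * (star (creation φ ξ) * (star (creationTensor φ x)
        * creationTensor φ y) * creation φ η) * leftAction φ b = _
      simp only [star_mul, star_leftAction, star_star, mul_assoc]
    have h2 : ∀ a b c : A, leftAction φ (a * c * b) ∈ V := fun a b c => by
      have hc : c ∈ cspan {a : A | ∃ (x y : X) (b : A), a = ip x (φ b y)} :=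
        dense_span_iff.1 hfull₂ c
      refine map_mem_of_cspan ((homCLM (leftHom φ)).comp (((ContinuousLinearMap.mul ℂ A).flip
        b).comp (ContinuousLinearMap.mul ℂ A a))) (isClosed_cspan _) ?_ hc
      rintro _ ⟨ξ, η, c, rfl⟩
      exact h1 a b c ξ η
    -- Two approximate units remove the auxiliary factors on either side of c.
    refine mem_of_mul_mem (g := leftAction φ) (continuous_starHom (leftHom φ))
      (isClosed_cspan _) fun b => ?_
    refine mem_of_mul_mem (g := fun b => leftAction φ (a * b)) ((continuous_starHom
      (leftHom φ)).comp (continuous_const.mul continuous_id)) (isClosed_cspan _) fun c => ?_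
    rw [← mul_assoc]
    exact h2 a c b

end FockCalculus


open PreHilbert HilbertModule PreFock Fock

/-! ### The Toeplitz algebra and its core -/

section CoreAlgebra

variable {A : Type u} {X : Type v} [NonUnitalCStarAlgebra A] [NormedAddCommGroup X]
  [NormedSpace ℂ X] [CompleteSpace X] [HilbertModule A X] (φ : A →⋆ₙₐ[ℂ] Adjointable A X)

/-- In the middle T_y⋆ T_z collapses to T_{z'} or to T_{y'}⋆, according to which word is longer, and
this is absorbed on the left or on the right. The length data record that the outer words never get
shorter, and that their difference of lengths is additive. -/
theorem exists_tensor_product (x y z w : Word A X) : ∃ x' w' : Word A X,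
    creationTensor φ x * star (creationTensor φ y) *
      (creationTensor φ z * star (creationTensor φ w))
        = creationTensor φ x' * star (creationTensor φ w') ∧
    ((y.1.length ≤ z.1.length ∧ x'.1.length = x.1.length + (z.1.length - y.1.length) ∧
        w'.1.length = w.1.length) ∨
      (z.1.length ≤ y.1.length ∧ x'.1.length = x.1.length ∧
        w'.1.length = w.1.length + (y.1.length - z.1.length))) := by
  rcases le_total y.1.length z.1.length with h | h
  · obtain ⟨z', hz', h1⟩ := exists_star_creationTensor_mul φ y z h
    obtain ⟨x', hx', h2⟩ := exists_creationTensor_mul φ x z'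
    refine ⟨x', w, ?_, Or.inl ⟨h, by rw [hx', hz'], rfl⟩⟩
    rw [← h2, ← h1]
    simp only [mul_assoc]
  · obtain ⟨y', hy', h1⟩ := exists_star_creationTensor_mul' φ y z h
    obtain ⟨w', hw', h2⟩ := exists_creationTensor_mul φ w y'
    refine ⟨x, w', ?_, Or.inr ⟨h, rfl, by rw [hw', hy']⟩⟩
    rw [← h2, star_mul, ← h1]
    simp only [mul_assoc]

/-- The generators `T_x T_y⋆`, `|x| = |y| ≥ n`, of `J_n`. -/
def coreGen (n : ℕ) : Set (Adjointable A (Fock φ)) :=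
  {T | ∃ x y : Word A X, n ≤ x.1.length ∧ y.1.length = x.1.length ∧
    T = creationTensor φ x * star (creationTensor φ y)}

/-- Outer words do not shrink in products, so the generators with lengths at least n are closed
under multiplication. -/
theorem mem_gradedSubalgebra_Ici {n : ℕ} {d : Adjointable A (Fock φ)} :
    d ∈ gradedSubalgebra φ (Set.Ici n) ↔ d ∈ cspan (coreGen φ n) := by
  refine mem_closure_adjoin_iff (S := coreGen φ n) ?_ ?_
  · rintro _ ⟨x, y, hx, hy, rfl⟩ _ ⟨z, w, hz, hw, rfl⟩
    obtain ⟨x', w', h1, h2⟩ := exists_tensor_product φ x y z w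
    refine mem_cspan ⟨x', w', ?_, ?_, h1⟩ <;> omega
  · rintro _ ⟨x, y, hx, hy, rfl⟩
    exact mem_cspan ⟨y, x, hy.symm ▸ hx, hy.symm, by rw [star_mul, star_star]⟩

theorem mem_core_iff {d : Adjointable A (Fock φ)} :
    d ∈ gradedSubalgebra φ Set.univ ↔ d ∈ cspan (coreGen φ 0) := by
  rw [← mem_gradedSubalgebra_Ici, show Set.Ici 0 = (Set.univ : Set ℕ) from Set.Ici_bot]

variable (A X) in
-- With c = ⟨ξ, ξ⟩ one has ‖ξe - ξ‖² = ‖e⋆(ce - c) - (ce - c)‖ ≤ 2‖ce - c‖, so an approximate unit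
-- of A acts as one on X. The bound ‖e‖ ≤ 1 is kept for `norm_le_of_norm_act_le`.
theorem exists_act_approximateUnit : ∃ l : Filter A, l.NeBot ∧ (∀ᶠ e in l, ‖e‖ ≤ 1) ∧
    ∀ ξ : X, Filter.Tendsto (fun e => act ξ e) l (nhds ξ) := by
  let _ := CStarAlgebra.spectralOrder A
  let _ := CStarAlgebra.spectralOrderedRing A
  have hl := CStarAlgebra.increasingApproximateUnit A
  refine ⟨_, hl.neBot, hl.eventually_norm, fun ξ => ?_⟩
  set c : A := ip ξ ξ with hc
  have h1 := hl.tendsto_mul_left c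
  rw [tendsto_iff_norm_sub_tendsto_zero] at h1 ⊢
  have h2 : Filter.Tendsto (fun e => √(2 * ‖c * e - c‖)) (CStarAlgebra.approximateUnit A)
      (nhds 0) := by
    have := (Real.continuous_sqrt.tendsto _).comp (h1.const_mul 2)
    rwa [mul_zero, Real.sqrt_zero] at this
  refine squeeze_zero' (Filter.Eventually.of_forall fun e => norm_nonneg _) ?_ h2
  filter_upwards [hl.eventually_norm] with e he
  refine Real.le_sqrt_of_sq_le ?_
  have h3 : ip (A := A) (act ξ e - ξ) (act ξ e - ξ) = star e * (c * e - c) - (c * e - c) := by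
    rw [ip_sub_left, ip_sub_right, ip_sub_right, ip_act_left, ip_act_right,
      ip_act_left, ← hc, mul_sub]
  rw [HilbertModule.norm_sq (A := A), h3]
  refine (norm_sub_le _ _).trans ?_
  have h4 := norm_mul_le (star e) (c * e - c)
  rw [norm_star] at h4
  nlinarith [norm_nonneg (c * e - c)]

/-- `ξ ↦ T_ξ` as a continuous linear map. -/
def creationL : X →L[ℂ] Adjointable A (Fock φ) :=
  LinearMap.mkContinuous
    { toFun := creation φ, map_add' := creation_add φ, map_smul' := creation_smul φ } 1
    fun ξ => by
      rw [one_mul]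
      refine abs_le_of_sq_le_sq' ?_ (norm_nonneg _) |>.2
      change ‖creation φ ξ‖ ^ 2 ≤ _
      rw [sq, ← CStarRing.norm_star_mul_self, star_creation_mul, HilbertModule.norm_sq (A := A)]
      exact NonUnitalStarAlgHom.norm_apply_le (leftHom φ) _

/-- The generators `T_x T_y⋆` of the Toeplitz algebra. -/
def toeplitzGen : Set (Adjointable A (Fock φ)) :=
  {T | ∃ x y : Word A X, T = creationTensor φ x * star (creationTensor φ y)}

theorem creationTensor_mem_cspan (x : Word A X) : creationTensor φ x ∈ cspan (toeplitzGen φ) := by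
  obtain ⟨u, a⟩ := x
  rw [← creationTensorL_apply]
  refine mem_of_mul_mem (g := creationTensorL φ u) (creationTensorL φ u).continuous
    (isClosed_cspan _) fun b => mem_cspan ⟨(u, a), ([], star b), ?_⟩
  rw [creationTensorL_apply, creationTensor_nil, star_leftAction, star_star,
    creationTensor_leftAction]

/-- T_ξ carries no coefficient and need not be a word operator itself; it is the limit of T_ξ φ₊(e)
along an approximate unit. -/
theorem creation_mem_cspan (ξ : X) : creation φ ξ ∈ cspan (toeplitzGen φ) := by
  obtain ⟨l, hne, -, hl⟩ := exists_act_approximateUnit A X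
  refine (isClosed_cspan _).mem_of_tendsto
    (((creationL φ).continuous.tendsto _).comp (hl ξ)) (Filter.Eventually.of_forall fun e => ?_)
  change creation φ (act ξ e) ∈ cspan (toeplitzGen φ)
  rw [← creation_leftAction]
  exact creationTensor_mem_cspan φ ([ξ], e)

theorem toeplitz_le_cspan {d : Adjointable A (Fock φ)} (hd : d ∈ toeplitzSubalgebra φ) :
    d ∈ cspan (toeplitzGen φ) := by
  refine NonUnitalStarSubalgebra.topologicalClosure_minimal (t := cspanAlg (toeplitzGen φ) ?_ ?_) _
      (NonUnitalStarAlgebra.adjoin_le ?_) (isClosed_cspan _) hd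
  · rintro _ ⟨x, y, rfl⟩ _ ⟨z, w, rfl⟩
    obtain ⟨x', w', h1, -⟩ := exists_tensor_product φ x y z w
    exact mem_cspan ⟨x', w', h1⟩
  · rintro _ ⟨x, y, rfl⟩
    exact mem_cspan ⟨y, x, by rw [star_mul, star_star]⟩
  · rintro _ ⟨ξ, rfl⟩
    exact creation_mem_cspan φ ξ

theorem creation_mem_toeplitz (ξ : X) : creation φ ξ ∈ toeplitzSubalgebra φ :=
  NonUnitalStarSubalgebra.le_topologicalClosure _ (NonUnitalStarAlgebra.subset_adjoin ℂ _ ⟨ξ, rfl⟩)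

/-- Fullness of the module enters here: φ₊(⟨ξ, η⟩) = T_ξ⋆ T_η lies in the Toeplitz algebra, and the
inner products span A densely. -/
theorem leftAction_mem_toeplitz (hfull : IsFull A X) (a : A) :
    leftAction φ a ∈ toeplitzSubalgebra φ := by
  refine map_mem_of_cspan (homCLM (leftHom φ))
    (P := (toeplitzSubalgebra φ).toNonUnitalSubalgebra.toSubmodule)
    (NonUnitalStarSubalgebra.isClosed_topologicalClosure _) ?_ (dense_span_iff.1 hfull a)
  rintro _ ⟨ξ, η, rfl⟩
  change leftAction φ (ip ξ η) ∈ toeplitzSubalgebra φ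
  rw [← star_creation_mul]
  exact mul_mem (star_mem (creation_mem_toeplitz φ ξ)) (creation_mem_toeplitz φ η)

theorem creationTensor_mem_toeplitz (hfull : IsFull A X) (x : Word A X) :
    creationTensor φ x ∈ toeplitzSubalgebra φ := by
  obtain ⟨u, a⟩ := x
  induction u with
  | nil => exact leftAction_mem_toeplitz φ hfull a
  | cons ξ u ih => exact mul_mem (creation_mem_toeplitz φ ξ) ih

theorem core_le_toeplitz (hfull : IsFull A X) {d : Adjointable A (Fock φ)}
    (hd : d ∈ gradedSubalgebra φ Set.univ) : d ∈ toeplitzSubalgebra φ := by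
  refine cspan_le_subalgebra _ (NonUnitalStarSubalgebra.isClosed_topologicalClosure _) ?_
    ((mem_core_iff φ).1 hd)
  rintro _ ⟨x, y, -, -, rfl⟩
  exact mul_mem (creationTensor_mem_toeplitz φ hfull x)
    (star_mem (creationTensor_mem_toeplitz φ hfull y))

/-! ### The filtration of the core by the ideals `J_n` -/

/-- Evaluation of operators at a vector. -/
def evalL (v : Fock φ) : Adjointable A (Fock φ) →L[ℂ] Fock φ :=
  LinearMap.mkContinuous
    { toFun := fun T => T v, map_add' := fun _ _ => rfl, map_smul' := fun _ _ => rfl } ‖v‖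
    fun T => by rw [mul_comm]; exact Adjointable.norm_apply_le T v

theorem apply_zero (T : Adjointable A (Fock φ)) : T (0 : Fock φ) = 0 := map_zero T.toCLM

/-- `J_n` annihilates the vectors of degree `< n`. -/
theorem coreIdeal_apply_tensor {n : ℕ} {d : Adjointable A (Fock φ)} (hd : d ∈ cspan (coreGen φ n))
    (x : Word A X) (hx : x.1.length < n) : d (emb φ (tensor φ x)) = 0 := by
  refine map_eq_of_cspan (evalL φ (emb φ (tensor φ x))) 0 ?_ hd
  rintro _ ⟨z, y, hz, hy, rfl⟩
  change creationTensor φ z ((star (creationTensor φ y)) (emb φ (tensor φ x))) = 0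
  obtain ⟨u, a⟩ := x
  rw [show (star (creationTensor φ y)) (emb φ (tensor φ (u, a))) = 0 from ?_, apply_zero]
  refine mem_of_mul_mem (P := {0}) (g := fun a => (star (creationTensor φ y))
    (emb φ (tensor φ (u, a)))) ((star (creationTensor φ y)).toCLM.continuous.comp
      (continuous_tensor φ u)) isClosed_singleton fun b => ?_
  -- As |u| < n ≤ |y|, the product T_y⋆ T_{(u,a)} is T_w⋆ for a nonempty word w, and such an
  -- operator kills the vacuum vectors.
  obtain ⟨w, hw, h⟩ := exists_star_creationTensor_mul' φ y (u, a) (by simp at hx ⊢; omega)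
  change (star (creationTensor φ y)) (emb φ (tensor φ (u, a * b))) = 0
  rw [← creationTensor_vacuum φ (u, a) b, ← Adjointable.mul_apply, h,
    star_creationTensor_vacuum φ w]
  intro h0
  rw [h0] at hw
  simp at hw hx
  omega

theorem eq_zero_of_mem_all_coreIdeal {d : Adjointable A (Fock φ)}
    (hd : ∀ n, d ∈ cspan (coreGen φ n)) : d = 0 :=
  adjointable_ext fun x => coreIdeal_apply_tensor φ (hd (x.1.length + 1)) x (Nat.lt_succ_self _)

/-- On the vacuum vector a⋆ the J_1 part vanishes and the value is aa⋆, of norm ‖a‖². This makes the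
coefficient a in the decomposition φ₊(a) + j depend continuously on the operator. -/
theorem norm_le_norm_leftAction_add (a : A) {j : Adjointable A (Fock φ)}
    (hj : j ∈ cspan (coreGen φ 1)) : ‖a‖ ≤ ‖leftAction φ a + j‖ := by
  have h1 : (leftAction φ a + j) (emb φ (tensor φ ([], star a)))
      = emb φ (tensor φ ([], a * star a)) := by
    rw [Adjointable.add_apply, coreIdeal_apply_tensor φ hj ([], star a) Nat.zero_lt_one, add_zero]
    exact leftAction_tensor φ a ([], star a)
  have h2 := Adjointable.norm_apply_le (leftAction φ a + j) (emb φ (tensor φ ([], star a)))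
  rw [h1, norm_vacuum, norm_vacuum, CStarRing.norm_self_mul_star, norm_star] at h2
  rcases (norm_nonneg a).eq_or_lt with h | h
  · rw [← h]; exact norm_nonneg _
  · exact le_of_mul_le_mul_right h2 h

/-- Every element of the core is of the form `φ₊(a) + j` with `j ∈ J_1`. -/
theorem exists_core_decomposition {d : Adjointable A (Fock φ)} (hd : d ∈ cspan (coreGen φ 0)) :
    ∃ a, d - leftAction φ a ∈ cspan (coreGen φ 1) := by
  have hspan : ∀ s ∈ Submodule.span ℂ (coreGen φ 0),
      ∃ a, s - leftAction φ a ∈ cspan (coreGen φ 1) := by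
    intro s hs
    induction hs using Submodule.span_induction with
    | mem s hs =>
      obtain ⟨x, y, -, hy, rfl⟩ := hs
      by_cases hx : 1 ≤ x.1.length
      · exact ⟨0, by
          rw [← leftHom_apply, map_zero, sub_zero]; exact mem_cspan ⟨x, y, hx, hy, rfl⟩⟩
      · obtain ⟨_ | ⟨ξ, u⟩, a⟩ := x
        · obtain ⟨_ | ⟨η, v⟩, b⟩ := y
          · refine ⟨a * star b, ?_⟩
            rw [creationTensor_nil, creationTensor_nil, star_leftAction, leftAction_mul, sub_self]
            exact zero_mem _
          · simp at hy
        · simp at hx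
    | zero => exact ⟨0, by rw [← leftHom_apply, map_zero, sub_zero]; exact zero_mem _⟩
    | add s t _ _ hs ht =>
      obtain ⟨a, ha⟩ := hs
      obtain ⟨b, hb⟩ := ht
      refine ⟨a + b, ?_⟩
      rw [← leftHom_apply, map_add, add_sub_add_comm]
      exact add_mem ha hb
    | smul c s _ hs =>
      obtain ⟨a, ha⟩ := hs
      refine ⟨c • a, ?_⟩
      rw [← leftHom_apply, map_smul, ← smul_sub]
      exact Submodule.smul_mem _ c ha
  obtain ⟨s, hs, hlim⟩ := mem_closure_iff_seq_limit.1 hd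
  choose a ha using fun k => hspan (s k) (hs k)
  -- The coefficients converge by `norm_le_norm_leftAction_add`, so the decomposition passes from
  -- the span to its closure.
  have hcau : CauchySeq a := by
    have h1 := hlim.cauchySeq
    rw [Metric.cauchySeq_iff] at h1 ⊢
    intro ε hε
    obtain ⟨N, hN⟩ := h1 ε hε
    refine ⟨N, fun m hm n hn => lt_of_le_of_lt ?_ (hN m hm n hn)⟩
    rw [dist_eq_norm, dist_eq_norm]
    have h2 := norm_le_norm_leftAction_add φ (a m - a n) (sub_mem (ha m) (ha n))
    refine h2.trans_eq (congrArg _ ?_)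
    rw [← leftHom_apply, ← leftHom_apply, ← leftHom_apply, map_sub]
    abel
  obtain ⟨a₀, ha₀⟩ := cauchySeq_tendsto_of_complete hcau
  exact ⟨a₀, (isClosed_cspan _).mem_of_tendsto
    (hlim.sub (((continuous_starHom (leftHom φ)).tendsto _).comp ha₀))
    (Filter.Eventually.of_forall ha)⟩

/-! ### Degree one vectors, compact operators, and essentiality of the ideals J_n -/

theorem norm_tensor_one (η : X) (c : A) : ‖emb φ (tensor φ ([η], c))‖ = ‖act η c‖ := by
  rw [← sq_eq_sq₀ (norm_nonneg _) (norm_nonneg _), HilbertModule.norm_sq (A := A),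
    HilbertModule.norm_sq (A := A), ip_emb_tensor, ip_act_left, ip_act_right]
  rfl

theorem tensor_add (ξ η : X) (c : A) : emb φ (tensor φ ([ξ + η], c))
    = emb φ (tensor φ ([ξ], c)) + emb φ (tensor φ ([η], c)) := by
  rw [← creation_tensor φ (ξ + η) ([], c), creation_add, Adjointable.add_apply, creation_tensor,
    creation_tensor]

theorem tensor_smul (r : ℂ) (ξ : X) (c : A) : emb φ (tensor φ ([r • ξ], c))
    = r • emb φ (tensor φ ([ξ], c)) := by
  rw [← creation_tensor φ (r • ξ) ([], c), creation_smul, Adjointable.smul_apply, creation_tensor]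

theorem tensor_act (ξ : X) (a c : A) :
    emb φ (tensor φ ([act ξ a], c)) = emb φ (tensor φ ([ξ], a * c)) := by
  rw [← creation_tensor φ (act ξ a) ([], c), ← creation_leftAction, Adjointable.mul_apply,
    leftAction_tensor, creation_tensor]
  rfl

/-- On degree one, T_{ζa} T_{ηb}⋆ acts as θ_{ζab⋆, η}, and generators with longer words act as zero.
The statement is kept to the algebraic span; limits are taken by a norm estimate where it is used.
-/
theorem exists_compact_of_span {j : Adjointable A (Fock φ)}
    (hj : j ∈ Submodule.span ℂ (coreGen φ 1)) : ∃ K ∈ Compacts A X, ∀ ξ c,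
      j (emb φ (tensor φ ([ξ], c))) = emb φ (tensor φ ([K ξ], c)) := by
  have h0 : ∀ c, emb φ (tensor φ ([(0 : Adjointable A X) (0 : X)], c)) = 0 := fun c => by
    have := tensor_smul φ 0 (0 : X) c
    rw [zero_smul, zero_smul] at this
    exact this
  induction hj using Submodule.span_induction with
  | mem j hj =>
    obtain ⟨⟨u, a⟩, ⟨v, b⟩, hx, hy, rfl⟩ := hj
    obtain _ | ⟨η, v⟩ := v
    · simp at hx hy; omega
    have hy1 : ∀ ξ c, (star (creation φ η)) (emb φ (tensor φ ([ξ], c)))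
        = emb φ (tensor φ ([], ip η ξ * c)) := fun ξ c => by
      rw [star_creation_emb, annihilateL_cons, pairL_tensor]; rfl
    obtain _ | ⟨η', v⟩ := v
    · obtain ⟨ζ, rfl⟩ := List.length_eq_one_iff.1 hy.symm
      refine ⟨theta (act ζ (a * star b)) η, NonUnitalStarSubalgebra.le_topologicalClosure _
        (NonUnitalStarAlgebra.subset_adjoin ℂ _ ⟨_, _, rfl⟩), fun ξ c => ?_⟩
      rw [theta_apply, act_act, tensor_act, creationTensor_cons, creationTensor_cons, star_mul,
        creationTensor_nil, creationTensor_nil, star_leftAction]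
      simp only [Adjointable.mul_apply]
      rw [hy1, leftAction_tensor, leftAction_tensor, creation_tensor, mul_assoc, mul_assoc]
      rfl
    · refine ⟨0, zero_mem _, fun ξ c => ?_⟩
      refine Eq.trans ?_ (h0 c).symm
      rw [creationTensor_cons φ η, star_mul]
      simp only [Adjointable.mul_apply]
      rw [hy1, star_creationTensor_vacuum φ _ (List.cons_ne_nil _ _), apply_zero]
  | zero => exact ⟨0, zero_mem _, fun ξ c => (h0 c).symm⟩
  | add s t _ _ hs ht =>
    obtain ⟨K, hK, h1⟩ := hs
    obtain ⟨L, hL, h2⟩ := ht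
    refine ⟨K + L, add_mem hK hL, fun ξ c => ?_⟩
    rw [Adjointable.add_apply, Adjointable.add_apply, h1, h2, tensor_add]
  | smul r s _ hs =>
    obtain ⟨K, hK, h1⟩ := hs
    refine ⟨r • K, SMulMemClass.smul_mem _ hK, fun ξ c => ?_⟩
    rw [Adjointable.smul_apply, Adjointable.smul_apply, h1, tensor_smul]

theorem norm_le_of_norm_act_le {η : X} {r : ℝ} (h : ∀ c : A, ‖c‖ ≤ 1 → ‖act η c‖ ≤ r) :
    ‖η‖ ≤ r := by
  obtain ⟨l, hne, h1, hl⟩ := exists_act_approximateUnit A X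
  refine le_of_tendsto (hl η).norm ?_
  filter_upwards [h1] with e he
  exact h e he

/-- Write d = φ₊(a) + j with j in J_1. Vanishing of d on degree one makes φ(a) a limit of compact
operators, hence φ(a) = 0 and a = 0. So d lies in J_1, where it annihilates all generators, and d =
0. -/
theorem eq_zero_of_mul_creationTensor_one
    (hK : ∀ a : A, φ a ∈ Compacts A X → φ a = 0) (hφ : Function.Injective φ) {d : Adjointable A (Fock φ)}
    (hd : d ∈ cspan (coreGen φ 0)) (h : ∀ x : Word A X, 1 ≤ x.1.length → d * creationTensor φ x = 0) :
    d = 0 := by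
  obtain ⟨a, ha⟩ := exists_core_decomposition φ hd
  have hvec : ∀ ξ c, d (emb φ (tensor φ ([ξ], c))) = 0 := fun ξ c =>
    apply_tensor_eq_zero φ d [ξ] (fun a => h ([ξ], a) le_rfl) c
  have hcomp : φ a ∈ Compacts A X := by
    have hcl : IsClosed (Compacts A X : Set (Adjointable A X)) :=
      NonUnitalStarSubalgebra.isClosed_topologicalClosure _
    have : φ a ∈ closure (Compacts A X : Set (Adjointable A X)) := by
      rw [Metric.mem_closure_iff]
      intro ε hε
      obtain ⟨j, hj, hjd⟩ := Metric.mem_closure_iff.1 ha (ε / 2) (by positivity)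
      obtain ⟨K, hKm, hKj⟩ := exists_compact_of_span φ hj
      refine ⟨-K, neg_mem hKm, ?_⟩
      rw [dist_eq_norm, sub_neg_eq_add]
      refine lt_of_le_of_lt ?_ (half_lt_self hε)
      refine ContinuousLinearMap.opNorm_le_bound _ (by positivity) fun ξ => ?_
      change ‖φ a ξ + K ξ‖ ≤ _
      refine norm_le_of_norm_act_le (A := A) fun c hc => ?_
      -- On degree one φ₊(a) + j equals d - (d - φ₊(a) - j). The first term vanishes there and the
      -- second has norm below ε/2, so -K is within ε of φ(a).
      have e1 : emb φ (tensor φ ([φ a ξ + K ξ], c))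
          = d (emb φ (tensor φ ([ξ], c))) - (d - leftAction φ a - j) (emb φ (tensor φ ([ξ], c))) := by
        rw [tensor_add, ← hKj]
        have e2 : leftAction φ a (emb φ (tensor φ ([ξ], c))) = emb φ (tensor φ ([φ a ξ], c)) :=
          leftAction_tensor φ a ([ξ], c)
        rw [← e2]
        change _ = d _ - (d _ - leftAction φ a _ - j _)
        abel
      rw [← norm_tensor_one φ, e1, hvec, zero_sub, norm_neg]
      refine (Adjointable.norm_apply_le _ _).trans ?_
      rw [dist_eq_norm] at hjd
      rw [norm_tensor_one]
      refine mul_le_mul hjd.le ?_ (norm_nonneg _) (by positivity)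
      refine (norm_act_le ξ c).trans ?_
      nlinarith [norm_nonneg ξ]
    rwa [hcl.closure_eq] at this
  have ha0 : a = 0 := hφ ((hK a hcomp).trans (map_zero φ).symm)
  rw [ha0, ← leftHom_apply, map_zero, sub_zero] at ha
  refine eq_zero_of_mul_cspan (S := coreGen φ 1) ?_ ?_
  · rintro _ ⟨x, y, hx, -, rfl⟩
    rw [← mul_assoc, h x hx, zero_mul]
  · exact (mem_gradedSubalgebra_Ici φ).1 (star_mem ((mem_gradedSubalgebra_Ici φ).2 ha))

/-- For a generator T_z T_w⋆ with |z| = |w|, the words x and y of equal length either are both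
absorbed, leaving T_{z'} T_{w'}⋆, or both absorb z and w, leaving T_{z'}⋆ T_{w'} with |z'| = |w'|,
which lies in φ₊(A). -/
theorem star_mul_mem_core {d : Adjointable A (Fock φ)} (hd : d ∈ cspan (coreGen φ 0))
    (x y : Word A X) (hxy : x.1.length = y.1.length) :
    star (creationTensor φ x) * d * creationTensor φ y ∈ cspan (coreGen φ 0) := by
  refine map_mem_cspan (((ContinuousLinearMap.mul ℂ _).flip (creationTensor φ y)).comp
    (ContinuousLinearMap.mul ℂ _ (star (creationTensor φ x)))) ?_ hd
  rintro _ ⟨z, w, -, hzw, rfl⟩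
  change star (creationTensor φ x) * (creationTensor φ z * star (creationTensor φ w)) *
    creationTensor φ y ∈ _
  rw [← mul_assoc, mul_assoc]
  rcases le_total x.1.length z.1.length with h | h
  · obtain ⟨z', hz', h1⟩ := exists_star_creationTensor_mul φ x z h
    obtain ⟨w', hw', h2⟩ := exists_star_creationTensor_mul' φ w y (by omega)
    rw [h1, h2]
    exact mem_cspan ⟨z', w', Nat.zero_le _, by omega, rfl⟩
  · obtain ⟨z', hz', h1⟩ := exists_star_creationTensor_mul' φ x z h
    obtain ⟨w', hw', h2⟩ := exists_star_creationTensor_mul φ w y (by omega)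
    obtain ⟨a, ha⟩ := star_creationTensor_mul_of_length_eq φ z' w' (by omega)
    rw [h1, h2, ha]
    refine mem_of_mul_mem (g := leftAction φ) (continuous_starHom (leftHom φ)) (isClosed_cspan _)
      fun b => mem_cspan ⟨([], a), ([], star b), Nat.zero_le _, rfl, ?_⟩
    rw [creationTensor_nil, creationTensor_nil, star_leftAction, star_star, leftAction_mul]

theorem mul_mem_core {n : ℕ} {c d : Adjointable A (Fock φ)} (hc : c ∈ cspan (coreGen φ n))
    (hd : d ∈ cspan (coreGen φ n)) : c * d ∈ cspan (coreGen φ n) :=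
  (mem_gradedSubalgebra_Ici φ).1 (mul_mem ((mem_gradedSubalgebra_Ici φ).2 hc)
    ((mem_gradedSubalgebra_Ici φ).2 hd))

theorem star_mem_core {n : ℕ} {c : Adjointable A (Fock φ)} (hc : c ∈ cspan (coreGen φ n)) :
    star c ∈ cspan (coreGen φ n) :=
  (mem_gradedSubalgebra_Ici φ).1 (star_mem ((mem_gradedSubalgebra_Ici φ).2 hc))

/-- The ideals `J_n` of the core are essential. -/
theorem eq_zero_of_mul_creationTensor
    (hK : ∀ a : A, φ a ∈ Compacts A X → φ a = 0) (hφ : Function.Injective φ) (n : ℕ) {d : Adjointable A (Fock φ)}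
    (hd : d ∈ cspan (coreGen φ 0)) (h : ∀ x : Word A X, n ≤ x.1.length → d * creationTensor φ x = 0) :
    d = 0 := by
  induction n generalizing d with
  | zero =>
    refine eq_zero_of_mul_cspan (S := coreGen φ 0) ?_ (star_mem_core φ hd)
    rintro _ ⟨x, y, hx, -, rfl⟩
    rw [← mul_assoc, h x hx, zero_mul]
  | succ n ih =>
    refine ih hd fun y hy => ?_
    rcases hy.lt_or_eq with hlt | heq
    · exact h y hlt
    -- For |y| = n the core element T_y⋆ d⋆ d T_y is killed on the right by every T_z with |z| ≥ 1,
    -- because T_y T_z has length at least n + 1. The case of length one then gives d T_y = 0.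
    have h1 := star_mul_mem_core φ (mul_mem_core φ (star_mem_core φ hd) hd) y y rfl
    refine eq_zero_of_star_mul_self ?_
    rw [star_mul, mul_assoc, ← mul_assoc (star d), ← mul_assoc]
    refine eq_zero_of_mul_creationTensor_one φ hK hφ h1 fun z hz => ?_
    obtain ⟨w, hw, h2⟩ := exists_creationTensor_mul φ y z
    rw [mul_assoc, h2, mul_assoc, mul_assoc, h w (by omega), mul_zero, mul_zero]

end CoreAlgebra


/-! ### Trigonometric polynomials with values in a Banach space -/

section Trigonometric

variable {D : Type w} [NormedAddCommGroup D] [NormedSpace ℂ D]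

/-- The function `t ↦ c(t) d`. -/
def scalarTensor (d : D) : C(Circle, ℂ) →L[ℂ] C(Circle, D) :=
  LinearMap.mkContinuous
    { toFun := fun c => ⟨fun t => c t • d, by fun_prop⟩
      map_add' := fun a b => ContinuousMap.ext fun t => add_smul (a t) (b t) d
      map_smul' := fun r a => ContinuousMap.ext fun t => mul_smul r (a t) d } ‖d‖ fun c => by
    refine (ContinuousMap.norm_le _ (by positivity)).2 fun t => ?_
    change ‖c t • d‖ ≤ _
    rw [norm_smul, mul_comm]
    gcongr
    exact c.norm_coe_le_norm t

/-- The character `t ↦ t ^ n` of the circle. -/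
def circleChar (n : ℤ) : C(Circle, ℂ) := ⟨fun t => ((t ^ n : Circle) : ℂ), continuous_circle_zpow n⟩

/-- Density of the Fourier monomials, carried from the additive circle of length 1 to the unit
circle. -/
theorem mem_cspan_circleChar (c : C(Circle, ℂ)) : c ∈ cspan (Set.range circleChar) := by
  have hfact : Fact (0 < (1 : ℝ)) := ⟨zero_lt_one⟩
  let e : AddCircle (1 : ℝ) ≃ₜ Circle := AddCircle.homeomorphCircle one_ne_zero
  let L : C(AddCircle (1 : ℝ), ℂ) →L[ℂ] C(Circle, ℂ) :=
    LinearMap.mkContinuous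
      { toFun := fun g => g.comp ⟨e.symm, e.symm.continuous⟩
        map_add' := fun _ _ => rfl
        map_smul' := fun _ _ => rfl } 1 fun g => by
      rw [one_mul]
      exact (ContinuousMap.norm_le _ (norm_nonneg _)).2 fun t => g.norm_coe_le_norm _
  have h1 : c = L (c.comp ⟨e, e.continuous⟩) := ContinuousMap.ext fun t =>
    (congrArg c (e.apply_symm_apply t)).symm
  rw [h1]
  refine map_mem_cspan L (S := Set.range (fourier (T := 1))) ?_ ?_
  · rintro _ ⟨n, rfl⟩
    refine mem_cspan ⟨n, ContinuousMap.ext fun t => ?_⟩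
    obtain ⟨x, rfl⟩ := e.surjective t
    change ((e x ^ n : Circle) : ℂ) = fourier n (e.symm (e x))
    rw [e.symm_apply_apply, fourier_apply, AddCircle.toCircle_zsmul,
      AddCircle.homeomorphCircle_apply]
  · change _ ∈ (Submodule.span ℂ _).topologicalClosure
    rw [span_fourier_closure_eq_top]
    trivial

/-- A partition of unity subordinate to sets where f varies by less than ε/2 approximates f by a
finite sum of scalar functions times fixed values of f. The scalar case handles the coefficient
functions. -/
theorem mem_cspan_trigonometric (f : C(Circle, D)) :
    f ∈ cspan {g : C(Circle, D) | ∃ n d, g = scalarTensor d (circleChar n)} := by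
  set V := cspan {g : C(Circle, D) | ∃ n d, g = scalarTensor d (circleChar n)}
  have h1 : ∀ c d, scalarTensor (D := D) d c ∈ V := fun c d => by
    refine map_mem_cspan (scalarTensor d) ?_ (mem_cspan_circleChar c)
    rintro _ ⟨n, rfl⟩
    exact mem_cspan ⟨n, d, rfl⟩
  rw [← SetLike.mem_coe, ← (isClosed_cspan _).closure_eq, Metric.mem_closure_iff]
  intro ε hε
  let U : Circle → Set Circle := fun t => {s | ‖f s - f t‖ < ε / 2}
  have hU : ∀ t, IsOpen (U t) := fun t => isOpen_lt (by fun_prop) continuous_const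
  obtain ⟨F, hF⟩ := isCompact_univ.elim_finite_subcover U hU fun t _ =>
    Set.mem_iUnion.2 ⟨t, by simp [U, hε]⟩
  obtain ⟨p, hp⟩ := PartitionOfUnity.exists_isSubordinate (ι := F) isClosed_univ
    (fun i => U i) (fun i => hU i) fun t ht => by
      obtain ⟨i, hi, hit⟩ := Set.mem_iUnion₂.1 (hF ht)
      exact Set.mem_iUnion.2 ⟨⟨i, hi⟩, hit⟩
  have hsum : ∀ t, ∑ i, p i t = 1 := fun t => by
    rw [← finsum_eq_sum_of_fintype]; exact p.sum_eq_one (Set.mem_univ t)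
  let c : F → C(Circle, ℂ) := fun i => ⟨fun t => (p i t : ℂ), by fun_prop⟩
  refine ⟨∑ i : F, scalarTensor (f i) (c i), sum_mem fun i _ => h1 _ _, ?_⟩
  rw [dist_eq_norm]
  refine lt_of_le_of_lt ((ContinuousMap.norm_le _ (half_pos hε).le).2 fun t => ?_) (half_lt_self hε)
  have h2 : (f - ∑ i : F, scalarTensor (f i) (c i)) t = ∑ i : F, (p i t : ℂ) • (f t - f i) := by
    rw [ContinuousMap.sub_apply, ContinuousMap.sum_apply]
    simp only [smul_sub, Finset.sum_sub_distrib]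
    rw [← Finset.sum_smul, ← Complex.ofReal_sum, hsum, Complex.ofReal_one, one_smul]
    rfl
  rw [h2]
  calc _ ≤ ∑ i, p i t * (ε / 2) := by
        refine norm_sum_le_of_le _ fun i _ => ?_
        rw [norm_smul, Complex.norm_real, Real.norm_eq_abs, abs_of_nonneg (p.nonneg i t)]
        by_cases hi : p i t = 0
        · rw [hi, zero_mul, zero_mul]
        · have : t ∈ U i := hp i (subset_closure hi)
          exact mul_le_mul_of_nonneg_left (le_of_lt this) (p.nonneg i t)
    _ = ε / 2 := by rw [← Finset.sum_mul, hsum, one_mul]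

end Trigonometric

/-! ### Spectral projections of a representation of the circle -/

section Spectral

variable {H : Type w} [NormedAddCommGroup H] [InnerProductSpace ℂ H] [CompleteSpace H]

/-- The parametrization `θ ↦ exp(2πiθ)` of the circle. -/
abbrev circleParam (θ : ℝ) : Circle := Circle.exp (2 * Real.pi * θ)

theorem continuous_circleParam : Continuous circleParam := by fun_prop

/-- Invariance of Haar measure: multiplication by exp(ix) translates θ by x/2π, and the integrand
has period 1. -/
theorem integral_circleParam_mul {F : Type v} [NormedAddCommGroup F] [NormedSpace ℝ F]
    (f : Circle → F) (s : Circle) :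
    ∫ θ in (0 : ℝ)..1, f (s * circleParam θ) = ∫ θ in (0 : ℝ)..1, f (circleParam θ) := by
  obtain ⟨x, rfl⟩ := Circle.exp_surjective s
  have h1 : ∀ θ : ℝ, Circle.exp x * circleParam θ = circleParam (θ + x / (2 * Real.pi)) :=
    fun θ => by
      rw [circleParam, circleParam, ← Circle.exp_add]
      congr 1
      field_simp
      ring
  have h2 : Function.Periodic (fun θ => f (circleParam θ)) 1 := fun θ => by
    have : circleParam (θ + 1) = circleParam θ := by
      rw [circleParam, circleParam, mul_add, mul_one, Circle.exp_add, Circle.exp_two_pi, mul_one]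
    change f _ = f _
    rw [this]
  simp only [h1]
  rw [intervalIntegral.integral_comp_add_right (fun θ => f (circleParam θ)), zero_add]
  have := h2.intervalIntegral_add_eq (0 + x / (2 * Real.pi)) 0
  rwa [zero_add 1, zero_add, add_comm _ 1, ← zero_add (x / (2 * Real.pi)), zero_add (x / _)] at this

variable (U : Circle →* unitary (H →L[ℂ] H)) (hU : ∀ h : H, Continuous fun t => (U t : H →L[ℂ] H) h)

theorem norm_unitary_apply (t : Circle) (h : H) : ‖(U t : H →L[ℂ] H) h‖ = ‖h‖ :=
  ContinuousLinearMap.norm_map_of_mem_unitary (U t).2 h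

/-- The spectral projection `∫ t⁻ⁿ U_t dt`. -/
def spectralProj (hU : ∀ h : H, Continuous fun t => (U t : H →L[ℂ] H) h) (n : ℤ) : H →L[ℂ] H :=
  LinearMap.mkContinuous
    { toFun := fun h => ∫ θ in (0 : ℝ)..1,
        circleChar (-n) (circleParam θ) • (U (circleParam θ) : H →L[ℂ] H) h
      map_add' := fun h k => by
        have hc : ∀ h, Continuous fun θ : ℝ =>
            circleChar (-n) (circleParam θ) • (U (circleParam θ) : H →L[ℂ] H) h := fun h =>
          ((circleChar (-n)).continuous.comp continuous_circleParam).smul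
            ((hU h).comp continuous_circleParam)
        rw [← intervalIntegral.integral_add ((hc h).intervalIntegrable _ _)
          ((hc k).intervalIntegrable _ _)]
        simp only [map_add, smul_add]
      map_smul' := fun c h => by
        rw [RingHom.id_apply, ← intervalIntegral.integral_smul]
        simp only [map_smul, smul_comm c] } 1 fun h => by
    refine (intervalIntegral.norm_integral_le_of_norm_le_const (C := ‖h‖) fun θ _ => ?_).trans
      (by simp)
    rw [norm_smul, norm_unitary_apply]
    exact (congrArg (· * ‖h‖) (Circle.norm_coe _)).le.trans (one_mul _).le

theorem spectralProj_apply (n : ℤ) (h : H) : spectralProj U hU n h = ∫ θ in (0 : ℝ)..1,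
    circleChar (-n) (circleParam θ) • (U (circleParam θ) : H →L[ℂ] H) h := rfl

theorem map_spectralProj (T : H →L[ℂ] H) (n : ℤ) (h : H) :
    T (spectralProj U hU n h) = ∫ θ in (0 : ℝ)..1,
      circleChar (-n) (circleParam θ) • T ((U (circleParam θ) : H →L[ℂ] H) h) := by
  have hc : Continuous fun θ : ℝ =>
      circleChar (-n) (circleParam θ) • (U (circleParam θ) : H →L[ℂ] H) h :=
    ((circleChar (-n)).continuous.comp continuous_circleParam).smul
      ((hU h).comp continuous_circleParam)
  rw [spectralProj_apply, ← ContinuousLinearMap.intervalIntegral_comp_comm _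
    (hc.intervalIntegrable _ _)]
  simp only [map_smul]

theorem norm_spectralProj_le (n : ℤ) : ‖spectralProj U hU n‖ ≤ 1 :=
  LinearMap.mkContinuous_norm_le _ zero_le_one _

theorem circleChar_mul (n : ℤ) (s t : Circle) :
    circleChar n (s * t) = circleChar n s * circleChar n t := by
  change ((((s * t) ^ n : Circle)) : ℂ) = _
  rw [mul_zpow, Circle.coe_mul]; rfl

theorem circleChar_add (m n : ℤ) (s : Circle) :
    circleChar (m + n) s = circleChar m s * circleChar n s := by
  change (((s ^ (m + n) : Circle)) : ℂ) = _
  rw [zpow_add, Circle.coe_mul]; rfl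

theorem circleChar_zero (s : Circle) : circleChar 0 s = 1 := by
  change (((s ^ (0 : ℤ) : Circle)) : ℂ) = _
  rw [zpow_zero, Circle.coe_one]

theorem circleChar_neg_mul (n : ℤ) (s : Circle) : circleChar (-n) s * circleChar n s = 1 := by
  rw [← circleChar_add, neg_add_cancel, circleChar_zero]

theorem star_circleChar (n : ℤ) (s : Circle) : star (circleChar n s) = circleChar (-n) s := by
  change star ((s ^ n : Circle) : ℂ) = ((s ^ (-n) : Circle) : ℂ)
  rw [zpow_neg, Circle.coe_inv_eq_conj, Complex.star_def]

theorem circleChar_inv (n : ℤ) (s : Circle) : circleChar n s⁻¹ = circleChar (-n) s := by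
  change ((s⁻¹ ^ n : Circle) : ℂ) = ((s ^ (-n) : Circle) : ℂ)
  rw [inv_zpow, zpow_neg]

/-- By invariance the integral equals χ(s) times itself, and some s has χ(s) ≠ 1. -/
theorem integral_circleChar {n : ℤ} (hn : n ≠ 0) :
    ∫ θ in (0 : ℝ)..1, circleChar n (circleParam θ) = 0 := by
  obtain ⟨s, hs⟩ : ∃ s : Circle, circleChar n s ≠ 1 := by
    -- The n-th power of this point is -1.
    refine ⟨Circle.exp (Real.pi / n), ?_⟩
    change ((Circle.exp (Real.pi / n) ^ n : Circle) : ℂ) ≠ 1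
    rw [← Circle.exp_zsmul, zsmul_eq_mul, mul_div_cancel₀ _ (by exact_mod_cast hn), Circle.coe_exp,
      Complex.exp_pi_mul_I]
    norm_num
  have h1 := integral_circleParam_mul (circleChar n) s
  simp only [circleChar_mul] at h1
  rw [intervalIntegral.integral_const_mul] at h1
  have h2 : (circleChar n s - 1) * ∫ θ in (0 : ℝ)..1, circleChar n (circleParam θ) = 0 := by
    rw [sub_mul, one_mul, h1, sub_self]
  exact (mul_eq_zero.1 h2).resolve_left (sub_ne_zero.2 hs)

theorem spectralProj_apply_of_eigen {n m : ℤ} {h : H}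
    (hh : ∀ t, (U t : H →L[ℂ] H) h = circleChar m t • h) :
    spectralProj U hU n h = if m = n then h else 0 := by
  rw [spectralProj_apply]
  simp only [hh, smul_smul, ← circleChar_add]
  rw [intervalIntegral.integral_smul_const]
  split_ifs with hmn
  · subst hmn
    simp [circleChar_zero]
  · rw [integral_circleChar (by omega), zero_smul]

theorem unitary_spectralProj (n : ℤ) (s : Circle) :
    (U s : H →L[ℂ] H) * spectralProj U hU n = circleChar n s • spectralProj U hU n := by
  refine ContinuousLinearMap.ext fun h => ?_
  change (U s : H →L[ℂ] H) (spectralProj U hU n h) = circleChar n s • spectralProj U hU n h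
  rw [map_spectralProj, spectralProj_apply,
    ← integral_circleParam_mul (fun t => circleChar (-n) t • (U t : H →L[ℂ] H) h) s,
    ← intervalIntegral.integral_smul]
  refine intervalIntegral.integral_congr fun θ _ => ?_
  change circleChar (-n) (circleParam θ) • (U s : H →L[ℂ] H) ((U (circleParam θ) : H →L[ℂ] H) h)
    = circleChar n s • circleChar (-n) (s * circleParam θ)
      • (U (s * circleParam θ) : H →L[ℂ] H) h
  rw [circleChar_mul, smul_smul, ← mul_assoc, mul_comm (circleChar n s),
    circleChar_neg_mul, one_mul, map_mul]
  rfl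

theorem spectralProj_unitary (n : ℤ) (s : Circle) :
    spectralProj U hU n * (U s : H →L[ℂ] H) = circleChar n s • spectralProj U hU n := by
  refine ContinuousLinearMap.ext fun h => ?_
  change spectralProj U hU n ((U s : H →L[ℂ] H) h) = circleChar n s • spectralProj U hU n h
  rw [spectralProj_apply, spectralProj_apply,
    ← integral_circleParam_mul (fun t => circleChar (-n) t • (U t : H →L[ℂ] H) h) s,
    ← intervalIntegral.integral_smul]
  refine intervalIntegral.integral_congr fun θ _ => ?_
  change circleChar (-n) (circleParam θ) • (U (circleParam θ) : H →L[ℂ] H) ((U s : H →L[ℂ] H) h)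
    = circleChar n s • circleChar (-n) (s * circleParam θ)
      • (U (s * circleParam θ) : H →L[ℂ] H) h
  rw [circleChar_mul, smul_smul, ← mul_assoc, mul_comm (circleChar n s),
    circleChar_neg_mul, one_mul, mul_comm s, map_mul]
  rfl

theorem spectralProj_mul_of_eigen {n m : ℤ} {T : H →L[ℂ] H}
    (hT : ∀ t, (U t : H →L[ℂ] H) * T = circleChar m t • T) :
    spectralProj U hU n * T = if m = n then T else 0 := by
  refine ContinuousLinearMap.ext fun h => ?_
  have := spectralProj_apply_of_eigen U hU (n := n) (h := T h)
    fun t => congrArg (fun S : H →L[ℂ] H => S h) (hT t)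
  change spectralProj U hU n (T h) = _
  rw [this]
  split_ifs <;> rfl

theorem spectralProj_mul (n m : ℤ) : spectralProj U hU n * spectralProj U hU m
    = if m = n then spectralProj U hU m else 0 :=
  spectralProj_mul_of_eigen U hU (unitary_spectralProj U hU m)

theorem star_unitary_rep (t : Circle) : star (U t : H →L[ℂ] H) = (U t⁻¹ : H →L[ℂ] H) := by
  have h : star (U t) = U t⁻¹ := by
    rw [map_inv]; rfl
  exact congrArg Subtype.val h

/-- The range of P⋆ consists of vectors of degree n, so P P⋆ = P⋆. The left side is self-adjoint,
hence so is P. -/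
theorem star_spectralProj (n : ℤ) : star (spectralProj U hU n) = spectralProj U hU n := by
  set P := spectralProj U hU n with hP
  have h1 : P * star P = star P := by
    have := spectralProj_mul_of_eigen U hU (n := n) (m := n) (T := star P) fun t => by
      rw [← star_star (U t : H →L[ℂ] H), ← star_mul, star_unitary_rep, hP, spectralProj_unitary,
        star_smul, circleChar_inv, star_circleChar, neg_neg]
    rwa [if_pos rfl] at this
  have h2 : star (P * star P) = P * star P := by rw [star_mul, star_star]
  rw [h1, star_star] at h2
  exact h2.symm

/-- An operator of degree k raises the spectral degree by k. -/
theorem spectralProj_comm {n k : ℤ} {T : H →L[ℂ] H}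
    (hT : ∀ t, (U t : H →L[ℂ] H) * T = circleChar k t • (T * (U t : H →L[ℂ] H))) :
    spectralProj U hU (n + k) * T = T * spectralProj U hU n := by
  refine ContinuousLinearMap.ext fun h => ?_
  change spectralProj U hU (n + k) (T h) = T (spectralProj U hU n h)
  rw [spectralProj_apply, map_spectralProj]
  refine intervalIntegral.integral_congr fun θ _ => ?_
  have h1 : (U (circleParam θ) : H →L[ℂ] H) (T h)
      = circleChar k (circleParam θ) • T ((U (circleParam θ) : H →L[ℂ] H) h) :=
    congrArg (fun S : H →L[ℂ] H => S h) (hT (circleParam θ))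
  change circleChar (-(n + k)) (circleParam θ) • (U (circleParam θ) : H →L[ℂ] H) (T h)
    = circleChar (-n) (circleParam θ) • T ((U (circleParam θ) : H →L[ℂ] H) h)
  rw [h1, smul_smul, ← circleChar_add]
  rw [show -(n + k) + k = -n by ring]

end Spectral


/-- The image of a closed subspace under an isometry is closed. This pulls membership in a closed
span back from the ambient algebra to a subalgebra. -/
theorem mem_cspan_of_isometry {M : Type u} [NormedAddCommGroup M] [NormedSpace ℂ M]
    {N : Type v} [NormedAddCommGroup N] [NormedSpace ℂ N] [CompleteSpace N] (f : N →L[ℂ] M)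
    (hf : Isometry f) {S : Set M} {T : Set N} (hST : S ⊆ f '' T) {x : N} (hx : f x ∈ cspan S) :
    x ∈ cspan T := by
  have h1 : IsClosed ((cspan T).map (f : N →ₗ[ℂ] M) : Set M) := by
    rw [Submodule.map_coe]
    exact hf.isClosedEmbedding.isClosedMap _ (isClosed_cspan _)
  obtain ⟨y, hy, h2⟩ := cspan_le h1 (hST.trans (Set.image_mono (subset_cspan T))) hx
  rwa [← hf.injective h2]

/-! ### The structure of the crossed product -/

section CrossedStructure

variable {D : Type w} [NonUnitalCStarAlgebra D] (α : Circle →* (D ≃⋆ₐ[ℂ] D))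

/-- The spectral projections `P_n` in the product of all covariant representations. -/
def specProj (n : ℤ) : CovariantProd α :=
  ⟨fun r => spectralProj r.U r.continuous_U n, memℓp_infty ⟨1, by
    rintro _ ⟨r, rfl⟩
    exact norm_spectralProj_le r.U r.continuous_U n⟩⟩

/-- The coefficient algebra `D` in the product of all covariant representations. -/
def coef : D →⋆ₙₐ[ℂ] CovariantProd α where
  toFun d := ⟨fun r => r.π d, memℓp_infty ⟨‖d‖, by
    rintro _ ⟨r, rfl⟩
    exact r.norm_π_le d⟩⟩
  map_smul' c d := lp.ext (funext fun r => map_smul r.π c d)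
  map_zero' := lp.ext (funext fun r => map_zero r.π)
  map_add' a b := lp.ext (funext fun r => map_add r.π a b)
  map_mul' a b := lp.ext (funext fun r => map_mul r.π a b)
  map_star' a := lp.ext (funext fun r => map_star r.π a)

/-- `d` is homogeneous of degree `k`. -/
def IsHomog (k : ℤ) (d : D) : Prop := ∀ t, α t d = circleChar k t • d

variable {α} in
theorem IsHomog.mul {k l : ℤ} {d e : D} (hd : IsHomog α k d) (he : IsHomog α l e) :
    IsHomog α (k + l) (d * e) := fun t => by
  rw [map_mul, hd, he, smul_mul_smul_comm, circleChar_add]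

variable {α} in
theorem IsHomog.star {k : ℤ} {d : D} (hd : IsHomog α k d) : IsHomog α (-k) (star d) := fun t => by
  rw [map_star, hd, star_smul, star_circleChar]

theorem specProj_mul (n m : ℤ) :
    specProj α n * specProj α m = if m = n then specProj α m else 0 :=
  lp.ext (funext fun r => by
    refine (spectralProj_mul r.U r.continuous_U n m).trans ?_
    split_ifs <;> rfl)

theorem specProj_mul_self (n : ℤ) : specProj α n * specProj α n = specProj α n := by
  rw [specProj_mul, if_pos rfl]

theorem specProj_mul_of_ne {n m : ℤ} (h : n ≠ m) : specProj α n * specProj α m = 0 := by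
  rw [specProj_mul, if_neg h.symm]

theorem star_specProj (n : ℤ) : star (specProj α n) = specProj α n :=
  lp.ext (funext fun r => star_spectralProj r.U r.continuous_U n)

variable {α} in
theorem IsHomog.specProj_mul {k : ℤ} {d : D} (hd : IsHomog α k d) (n : ℤ) :
    specProj α (n + k) * coef α d = coef α d * specProj α n :=
  lp.ext (funext fun r => spectralProj_comm r.U r.continuous_U fun t => by
    change (r.U t : r.H →L[ℂ] r.H) * r.π d = circleChar k t • (r.π d * (r.U t : r.H →L[ℂ] r.H))
    rw [r.covariant, hd, map_smul, smul_mul_assoc])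

theorem relabel_specProj (k n : ℤ) : relabel α k (specProj α n) = specProj α (n - k) :=
  lp.ext (funext fun r => ContinuousLinearMap.ext fun h => by
    refine intervalIntegral.integral_congr fun θ _ => ?_
    change circleChar (-n) (circleParam θ) • circleChar k (circleParam θ) •
        (r.U (circleParam θ) : r.H →L[ℂ] r.H) h
      = circleChar (-(n - k)) (circleParam θ) • (r.U (circleParam θ) : r.H →L[ℂ] r.H) h
    rw [smul_smul, ← circleChar_add, show -n + k = -(n - k) by ring])

theorem relabel_coef (k : ℤ) (d : D) : relabel α k (coef α d) = coef α d := rfl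

/-- The function t ↦ t⁻ⁿ d integrates to d P_n. The elements d and P_n lie in the product of all
representations and need not belong to the crossed product separately. -/
theorem universalRep_scalarTensor (n : ℤ) (d : D) :
    universalRep α (scalarTensor d (circleChar (-n))) = coef α d * specProj α n :=
  lp.ext (funext fun r => ContinuousLinearMap.ext fun h => by
    change r.integrated _ h = r.π d (spectralProj r.U r.continuous_U n h)
    rw [map_spectralProj]
    refine intervalIntegral.integral_congr fun θ _ => ?_
    change r.π (circleChar (-n) (circleParam θ) • d) ((r.U (circleParam θ) : r.H →L[ℂ] r.H) h) = _
    rw [map_smul]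
    rfl)

/-- `universalRep` as a continuous linear map. -/
def universalRepL : C(Circle, D) →L[ℂ] CovariantProd α :=
  LinearMap.mkContinuous
    { toFun := universalRep α
      map_add' := fun f g => lp.ext (funext fun r => ContinuousLinearMap.ext fun h => by
        change r.integrated (f + g) h = r.integrated f h + r.integrated g h
        have hc : ∀ f : C(Circle, D), IntervalIntegrable
            (fun θ => r.integrand f h (circleParam θ)) MeasureTheory.volume 0 1 := fun f =>
          ((r.continuous_integrand f h).comp continuous_circleParam).intervalIntegrable _ _
        rw [r.integrated_apply, r.integrated_apply, r.integrated_apply,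
          ← intervalIntegral.integral_add (hc f) (hc g)]
        refine intervalIntegral.integral_congr fun θ _ => ?_
        change r.π (f _ + g _) _ = r.π (f _) _ + r.π (g _) _
        rw [map_add]
        rfl)
      map_smul' := fun c f => lp.ext (funext fun r => ContinuousLinearMap.ext fun h => by
        change r.integrated (c • f) h = c • r.integrated f h
        rw [r.integrated_apply, r.integrated_apply, ← intervalIntegral.integral_smul]
        refine intervalIntegral.integral_congr fun θ _ => ?_
        change r.π (c • f _) _ = c • r.π (f _) _
        rw [map_smul]
        rfl) } 1 fun f => by
    rw [one_mul]
    exact lp.norm_le_of_forall_le (norm_nonneg _) fun r => r.norm_integrated_le f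

theorem universalRep_mem_cspan {S : Set D} (hdense : ∀ d, d ∈ cspan S) (f : C(Circle, D)) :
    universalRep α f ∈ cspan {m | ∃ d ∈ S, ∃ n, m = coef α d * specProj α n} := by
  refine map_mem_cspan (universalRepL α) ?_ (mem_cspan_trigonometric f)
  rintro _ ⟨n, d, rfl⟩
  change universalRep α _ ∈ _
  rw [← neg_neg n, universalRep_scalarTensor]
  refine map_mem_cspan (((ContinuousLinearMap.mul ℂ _).flip (specProj α (-n))).comp
    (homCLM (coef α))) ?_ (hdense d)
  exact fun s hs => mem_cspan ⟨s, hs, -n, rfl⟩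

theorem coef_mul_specProj_mem (d : D) (n : ℤ) : coef α d * specProj α n ∈ crossedSubalgebra α := by
  rw [← universalRep_scalarTensor]
  exact NonUnitalStarSubalgebra.le_topologicalClosure _
    (NonUnitalStarAlgebra.subset_adjoin ℂ _ ⟨_, rfl⟩)

/-- The crossed product is spanned by the elements `d P_n` with `d` in a multiplicative set of
homogeneous elements which spans a dense subspace. -/
theorem mem_crossedSubalgebra_iff {S : Set D} (hS : ∀ d ∈ S, ∃ k, IsHomog α k d)
    (hmul : ∀ s ∈ S, ∀ t ∈ S, s * t ∈ S) (hstar : ∀ s ∈ S, star s ∈ S)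
    (hdense : ∀ d, d ∈ cspan S) {x : CovariantProd α} :
    x ∈ crossedSubalgebra α ↔ x ∈ cspan {m | ∃ d ∈ S, ∃ n, m = coef α d * specProj α n} := by
  constructor
  · refine fun hx => NonUnitalStarSubalgebra.topologicalClosure_minimal (t := cspanAlg
      {m | ∃ d ∈ S, ∃ n, m = coef α d * specProj α n} ?_ ?_) _
      (NonUnitalStarAlgebra.adjoin_le ?_) (isClosed_cspan _) hx
    · rintro _ ⟨d, hd, n, rfl⟩ _ ⟨e, he, m, rfl⟩
      obtain ⟨k, hk⟩ := hS e he
      -- If e has degree k then P_n e = e P_{n-k}, which brings the two projections together.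
      have h1 : coef α d * specProj α n * (coef α e * specProj α m)
          = coef α (d * e) * (specProj α (n - k) * specProj α m) := by
        have := hk.specProj_mul (n - k)
        rw [sub_add_cancel] at this
        rw [mul_assoc, ← mul_assoc (specProj α n), this, map_mul, mul_assoc, mul_assoc]
      rw [h1, CuntzPimsner.specProj_mul]
      split_ifs with h
      · exact mem_cspan ⟨_, hmul d hd e he, m, rfl⟩
      · rw [mul_zero]; exact zero_mem _
    · rintro _ ⟨d, hd, n, rfl⟩
      obtain ⟨k, hk⟩ := hS d hd
      have h1 := hk.star.specProj_mul (n + k)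
      rw [add_neg_cancel_right] at h1
      refine mem_cspan ⟨star d, hstar d hd, n + k, ?_⟩
      rw [star_mul, star_specProj, ← map_star, h1]
    · rintro _ ⟨f, rfl⟩
      exact universalRep_mem_cspan α hdense f
  · refine cspan_le_subalgebra _ (NonUnitalStarSubalgebra.isClosed_topologicalClosure _) ?_
    rintro _ ⟨d, -, n, rfl⟩
    exact coef_mul_specProj_mem α d n

end CrossedStructure


open PreHilbert HilbertModule PreFock Fock

/-! ### Localization of Hilbert modules at positive functionals -/

section Localization

open scoped ComplexOrder InnerProductSpace
open UniformSpace

/-- Bounded positive functionals on a C⋆-algebra. -/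
def PosFunctional (A : Type u) [NonUnitalCStarAlgebra A] : Type u :=
  {f : A →L[ℂ] ℂ // ∀ x, 0 ≤ f (star x * x)}

variable {A : Type u} {Y : Type v} [NonUnitalCStarAlgebra A] [NormedAddCommGroup Y]
  [NormedSpace ℂ Y] [CompleteSpace Y] [HilbertModule A Y]

theorem PosFunctional.nonneg (f : PosFunctional A) {a : A} (ha : IsPos a) : 0 ≤ f.1 a := by
  obtain ⟨b, rfl⟩ := ha
  exact f.2 b

theorem PosFunctional.apply_star (f : PosFunctional A) (a : A) : f.1 (star a) = conj (f.1 a) := by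
  let _ := CStarAlgebra.spectralOrder A
  let _ := CStarAlgebra.spectralOrderedRing A
  let g : A →ₚ[ℂ] ℂ := PositiveLinearMap.mk₀ (f.1 : A →ₗ[ℂ] ℂ) fun x hx =>
    f.nonneg ((isPos_iff_nonneg x).2 hx)
  exact map_star g a

set_option linter.unusedVariables false in
/-- The space `Y` with the semi-inner product `f(⟨x, y⟩)`. -/
def PreLoc (f : PosFunctional A) (Y : Type v) : Type v := Y

variable (f : PosFunctional A)

instance : AddCommGroup (PreLoc f Y) := inferInstanceAs (AddCommGroup Y)
instance : Module ℂ (PreLoc f Y) := inferInstanceAs (Module ℂ Y)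

/-- The identity map `Y → PreLoc f Y`. -/
def toPreLoc : Y ≃ₗ[ℂ] PreLoc f Y := LinearEquiv.refl ℂ Y

/-- The semi-inner product `f(⟨x, y⟩)`. -/
abbrev preLocCore : PreInnerProductSpace.Core ℂ (PreLoc f Y) where
  inner x y := f.1 (ip (A := A) (X := Y) ((toPreLoc f).symm x) ((toPreLoc f).symm y))
  conj_inner_symm x y := by rw [← PosFunctional.apply_star, star_ip]
  re_inner_nonneg x := (Complex.nonneg_iff.1 (f.nonneg (ip_self_pos _))).1
  add_left x y z := by rw [_root_.map_add, ip_add_left, _root_.map_add]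
  smul_left x y c := by rw [_root_.map_smul, ip_smul_left, _root_.map_smul]; rfl

instance : SeminormedAddCommGroup (PreLoc f Y) :=
  InnerProductSpace.Core.toSeminormedAddCommGroup (c := preLocCore f)
instance : InnerProductSpace ℂ (PreLoc f Y) := InnerProductSpace.ofCore (preLocCore f)

theorem preLoc_inner (x y : Y) : ⟪toPreLoc f x, toPreLoc f y⟫_ℂ = f.1 (ip (A := A) x y) := rfl

theorem preLoc_norm_sq (x : Y) : ((‖toPreLoc f x‖ ^ 2 : ℝ) : ℂ) = f.1 (ip (A := A) x x) := by
  rw [← preLoc_inner, inner_self_eq_norm_sq_to_K]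
  norm_num

/-- Write ‖T‖² - T⋆T = d⋆d in L(Y). Then ‖T‖² ⟨x, x⟩ = ⟨Tx, Tx⟩ + ⟨dx, dx⟩, and the functional is
applied to both sides. -/
theorem norm_preLoc_op_le (T : Adjointable A Y) (x : Y) :
    ‖toPreLoc f (T x)‖ ≤ ‖T‖ * ‖toPreLoc f x‖ := by
  have h0 : IsPos (star T * T) := ⟨T, rfl⟩
  have h1 := h0.conj_le 1
  rw [star_one, one_mul, one_mul, mul_one, CStarRing.norm_star_mul_self] at h1
  obtain ⟨d, hd⟩ := h1
  have h2 : ((‖T‖ * ‖T‖ : ℝ) : ℂ) • ip (A := A) x x = ip (T x) (T x) + ip (d x) (d x) := by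
    rw [← Adjointable.ip_star_right, ← Adjointable.ip_star_right, ← Adjointable.mul_apply,
      ← Adjointable.mul_apply, ← hd, ← ip_add_right, ← Adjointable.add_apply, add_sub_cancel,
      Adjointable.smul_apply, ip_smul_right]
    rfl
  have h3 := congrArg f.1 h2
  rw [_root_.map_add, _root_.map_smul, ← preLoc_norm_sq, ← preLoc_norm_sq, ← preLoc_norm_sq,
    smul_eq_mul] at h3
  have h4 : ‖T‖ * ‖T‖ * ‖toPreLoc f x‖ ^ 2 = ‖toPreLoc f (T x)‖ ^ 2 + ‖toPreLoc f (d x)‖ ^ 2 := by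
    exact_mod_cast h3
  refine abs_le_of_sq_le_sq' ?_ (by positivity) |>.2
  rw [mul_pow, sq ‖T‖, h4]
  nlinarith [sq_nonneg ‖toPreLoc f (d x)‖]

/-- The Hilbert space obtained from a Hilbert module and a positive functional. -/
abbrev Loc (f : PosFunctional A) (Y : Type v) [NormedAddCommGroup Y]
    [NormedSpace ℂ Y] [CompleteSpace Y] [HilbertModule A Y] : Type v :=
  Completion (PreLoc f Y)

/-- The canonical map to the localization. -/
def toLoc (x : Y) : Loc f Y := (toPreLoc f x : PreLoc f Y)

/-- Operators on the pre-localization. -/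
def preLocOp (T : Adjointable A Y) : PreLoc f Y →L[ℂ] PreLoc f Y :=
  LinearMap.mkContinuous
    { toFun := fun x => toPreLoc f (T ((toPreLoc f).symm x))
      map_add' := fun x y => by simp only [_root_.map_add]
      map_smul' := fun c x => by simp only [_root_.map_smul, RingHom.id_apply] } ‖T‖
    fun x => norm_preLoc_op_le f T ((toPreLoc f).symm x)

theorem completion_preLocOp_toLoc (T : Adjointable A Y) (x : Y) :
    (preLocOp f T).completion (toLoc f x) = toLoc f (T x) :=
  ContinuousLinearMap.completion_apply_coe _ _

theorem toLoc_add (x y : Y) : toLoc f (x + y) = toLoc f x + toLoc f y := by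
  rw [toLoc, _root_.map_add, Completion.coe_add]; rfl

theorem toLoc_smul (c : ℂ) (x : Y) : toLoc f (c • x) = c • toLoc f x := by
  rw [toLoc, _root_.map_smul, Completion.coe_smul]; rfl

theorem loc_ext {S T : Loc f Y →L[ℂ] Loc f Y} (h : ∀ x, S (toLoc f x) = T (toLoc f x)) : S = T := by
  refine ContinuousLinearMap.ext fun z => ?_
  induction z using Completion.induction_on with
  | hp => exact isClosed_eq S.continuous T.continuous
  | ih z => exact h ((toPreLoc f).symm z)

theorem inner_toLoc (x y : Y) : ⟪toLoc f x, toLoc f y⟫_ℂ = f.1 (ip (A := A) x y) :=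
  (Completion.inner_coe _ _).trans (preLoc_inner f x y)

/-- The representation of `L(Y)` on the localization. -/
def locHom : Adjointable A Y →⋆ₙₐ[ℂ] (Loc f Y →L[ℂ] Loc f Y) where
  toFun T := (preLocOp f T).completion
  map_smul' c T := loc_ext f fun x => by
    change _ = c • (preLocOp f T).completion (toLoc f x)
    rw [completion_preLocOp_toLoc, completion_preLocOp_toLoc, ← toLoc_smul]; rfl
  map_zero' := loc_ext f fun x => by
    rw [completion_preLocOp_toLoc]
    exact Completion.coe_zero
  map_add' S T := loc_ext f fun x => by
    change _ = (preLocOp f S).completion (toLoc f x) + (preLocOp f T).completion (toLoc f x)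
    rw [completion_preLocOp_toLoc, completion_preLocOp_toLoc, completion_preLocOp_toLoc,
      ← toLoc_add]; rfl
  map_mul' S T := loc_ext f fun x => by
    change _ = (preLocOp f S).completion ((preLocOp f T).completion (toLoc f x))
    rw [completion_preLocOp_toLoc, completion_preLocOp_toLoc, completion_preLocOp_toLoc]; rfl
  map_star' T := by
    refine (ContinuousLinearMap.eq_adjoint_iff _ _).2 fun x y => ?_
    induction x, y using Completion.induction_on₂ with
    | hp => exact isClosed_eq (by fun_prop) (by fun_prop)
    | ih x y =>
      change ⟪(preLocOp f (star T)).completion (toLoc f ((toPreLoc f).symm x)),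
        toLoc f ((toPreLoc f).symm y)⟫_ℂ = ⟪toLoc f ((toPreLoc f).symm x),
        (preLocOp f T).completion (toLoc f ((toPreLoc f).symm y))⟫_ℂ
      rw [completion_preLocOp_toLoc, completion_preLocOp_toLoc, inner_toLoc, inner_toLoc,
        Adjointable.ip_star_left]

theorem locHom_toLoc (T : Adjointable A Y) (x : Y) :
    locHom f T (toLoc f x) = toLoc f (T x) := completion_preLocOp_toLoc f T x

theorem locHom_one : locHom f (1 : Adjointable A Y) = 1 :=
  loc_ext f fun x => locHom_toLoc f 1 x

/-- Linear combinations of images of a total set are dense in the localization. -/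
theorem loc_mem_cspan {S : Set Y} (hS : ∀ y, y ∈ cspan S) (z : Loc f Y) :
    z ∈ cspan (toLoc f '' S) := by
  induction z using Completion.induction_on with
  | hp => exact isClosed_cspan _
  | ih z =>
    let L : Y →L[ℂ] Loc f Y :=
      LinearMap.mkContinuous
        { toFun := toLoc f, map_add' := toLoc_add f, map_smul' := toLoc_smul f } √‖f.1‖ fun y => by
        refine abs_le_of_sq_le_sq' ?_ (by positivity) |>.2
        have h1 : ‖toLoc f y‖ = ‖toPreLoc f y‖ := Completion.norm_coe _
        rw [mul_pow, Real.sq_sqrt (norm_nonneg _)]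
        change ‖toLoc f y‖ ^ 2 ≤ _
        rw [h1, HilbertModule.norm_sq (A := A)]
        have h2 := congrArg norm (preLoc_norm_sq f y)
        rw [Complex.norm_real, Real.norm_eq_abs, abs_of_nonneg (by positivity)] at h2
        rw [h2]
        exact f.1.le_opNorm _
    exact map_mem_cspan L (fun s hs => mem_cspan (Set.mem_image_of_mem (toLoc f) hs)) (hS ((toPreLoc f).symm z))

end Localization

/-! ### Covariant representations on localizations of the Fock module -/

section FockRep

variable {A : Type u} {X : Type v} [NonUnitalCStarAlgebra A] [NormedAddCommGroup X]
  [NormedSpace ℂ X] [CompleteSpace X] [HilbertModule A X] (φ : A →⋆ₙₐ[ℂ] Adjointable A X)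

theorem fock_mem_cspan (y : Fock φ) :
    y ∈ cspan (Set.range fun x : Word A X => emb φ (tensor φ x)) := by
  induction y using Fock.induction with
  | hc => exact isClosed_cspan _
  | h y =>
    induction y using PreFock.induction with
    | h0 => rw [map_zero]; exact zero_mem _
    | hadd y z hy hz => rw [map_add]; exact add_mem hy hz
    | ht x => exact mem_cspan ⟨x, rfl⟩

theorem gradeOp_tensor (t : Circle) (x : Word A X) : gradeOp φ t (emb φ (tensor φ x))
    = circleChar x.1.length t • emb φ (tensor φ x) := by
  rw [gradeOp_emb, gradeL_tensor, map_smul]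
  congr 1

variable (f : PosFunctional A)

/-- The grading unitaries on the localization of the Fock module. -/
def locU : Circle →* unitary (Loc f (Fock φ) →L[ℂ] Loc f (Fock φ)) where
  toFun t := ⟨locHom f (gradeOp φ t), by
    rw [Unitary.mem_iff, ← map_star, ← map_mul, ← map_mul, star_gradeOp, ← gradeOp_mul,
      ← gradeOp_mul, inv_mul_cancel, mul_inv_cancel, gradeOp_one, locHom_one]
    exact ⟨rfl, rfl⟩⟩
  map_one' := Subtype.ext (by
    change locHom f (gradeOp φ 1) = 1
    rw [gradeOp_one, locHom_one])
  map_mul' s t := Subtype.ext (by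
    change locHom f (gradeOp φ (s * t)) = locHom f (gradeOp φ s) * locHom f (gradeOp φ t)
    rw [gradeOp_mul, map_mul])

theorem locU_tensor (t : Circle) (x : Word A X) :
    (locU φ f t : Loc f (Fock φ) →L[ℂ] Loc f (Fock φ)) (toLoc f (emb φ (tensor φ x)))
      = circleChar x.1.length t • toLoc f (emb φ (tensor φ x)) := by
  refine (locHom_toLoc f _ _).trans ?_
  rw [gradeOp_tensor, toLoc_smul]

/-- Unitaries are isometric, so orbit maps depend on the vector uniformly in t, and strong
continuity need only be checked on a total set. -/
theorem continuous_of_dense_span {H : Type w} [NormedAddCommGroup H] [InnerProductSpace ℂ H]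
    [CompleteSpace H] (U : Circle →* unitary (H →L[ℂ] H)) {S : Set H}
    (hS : ∀ h ∈ S, Continuous fun t => (U t : H →L[ℂ] H) h) {h : H} (hh : h ∈ cspan S) :
    Continuous fun t => (U t : H →L[ℂ] H) h := by
  let V : Submodule ℂ H :=
    { carrier := {h | Continuous fun t => (U t : H →L[ℂ] H) h}
      add_mem' := fun {a b} ha hb => by
        rw [Set.mem_ofPred_eq] at *
        simp only [map_add]
        exact ha.add hb
      zero_mem' := by
        rw [Set.mem_ofPred_eq]
        simp only [map_zero]
        exact continuous_const
      smul_mem' := fun c a ha => by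
        rw [Set.mem_ofPred_eq] at *
        simp only [map_smul]
        exact ha.const_smul c }
  refine cspan_le (P := V) ?_ hS hh
  rw [← closure_subset_iff_isClosed]
  intro h hh
  refine continuous_of_uniform_approx_of_continuous fun u hu => ?_
  obtain ⟨ε, hε, hεu⟩ := Metric.mem_uniformity_dist.1 hu
  obtain ⟨k, hk, hhk⟩ := Metric.mem_closure_iff.1 hh ε hε
  refine ⟨_, hk, fun t => hεu ?_⟩
  rw [dist_eq_norm, ← map_sub, norm_unitary_apply, ← dist_eq_norm]
  exact hhk

/-- The covariant representation of the Toeplitz algebra on the localization of the Fock module. -/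
def locRep : CovariantRep (gauge φ) where
  H := Loc f (Fock φ)
  π := (locHom f).comp (NonUnitalStarSubalgebraClass.subtype (toeplitzSubalgebra φ))
  U := locU φ f
  continuous_U h := by
    refine continuous_of_dense_span _ ?_ (loc_mem_cspan f (fock_mem_cspan φ) h)
    rintro _ ⟨_, ⟨x, rfl⟩, rfl⟩
    simp only [locU_tensor]
    exact (circleChar _).continuous.smul continuous_const
  covariant t d := by
    change locHom f (gradeOp φ t) * locHom f d.1
      = locHom f (gradeOp φ t * d.1 * star (gradeOp φ t)) * locHom f (gradeOp φ t)
    rw [← map_mul, ← map_mul, mul_assoc _ (star _), star_gradeOp, ← gradeOp_mul, inv_mul_cancel,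
      gradeOp_one, mul_one]

theorem spectralProj_locRep_tensor (n : ℤ) (x : Word A X) :
    spectralProj (locRep φ f).U (locRep φ f).continuous_U n (toLoc f (emb φ (tensor φ x)))
      = if (x.1.length : ℤ) = n then toLoc f (emb φ (tensor φ x)) else 0 :=
  spectralProj_apply_of_eigen _ _ fun t => locU_tensor φ f t x

/-- The Fock module has no vectors of negative degree. This later separates the consecutive ideals
I_n and I_{n+1}. -/
theorem spectralProj_locRep_of_neg {n : ℤ} (hn : n < 0) :
    spectralProj (locRep φ f).U (locRep φ f).continuous_U n = 0 := by
  refine ContinuousLinearMap.ext fun h => ?_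
  refine map_eq_of_cspan (M := Loc f (Fock φ)) (N := Loc f (Fock φ)) _ 0 ?_
    (loc_mem_cspan f (fock_mem_cspan φ) h)
  rintro _ ⟨_, ⟨x, rfl⟩, rfl⟩
  refine (spectralProj_locRep_tensor φ f n x).trans ?_
  rw [if_neg (by omega)]
  rfl

/-- If `d P_{|x|}` vanishes in all these representations, then `d x = 0`. -/
theorem apply_tensor_eq_zero_of_locRep (d : Toeplitz φ) (x : Word A X)
    (h : ∀ f, (locRep φ f).π d * spectralProj (locRep φ f).U (locRep φ f).continuous_U x.1.length
      = 0) : d.1 (emb φ (tensor φ x)) = 0 := by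
  by_contra hne
  set y := d.1 (emb φ (tensor φ x))
  have hb : ip (A := A) y y ≠ 0 := fun h0 => hne (by
    rw [← norm_eq_zero, ← sq_eq_zero_iff, HilbertModule.norm_sq (A := A), h0, norm_zero])
  obtain ⟨b, hb'⟩ := ip_self_pos (A := A) y
  -- The functional is chosen so that y = d x keeps a nonzero norm in the localization, while
  -- P_{|x|} fixes the image of x.
  obtain ⟨f, hf, hfb⟩ := exists_functional b (fun h0 => hb (by rw [hb', h0, mul_zero]))
  let F : PosFunctional A := ⟨f, hf⟩
  have h1 : toLoc F y = 0 := by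
    have h2 := congrArg (fun T : Loc F (Fock φ) →L[ℂ] Loc F (Fock φ) =>
      T (toLoc F (emb φ (tensor φ x)))) (h F)
    have h3 := spectralProj_locRep_tensor φ F x.1.length x
    rw [if_pos rfl] at h3
    change (locRep φ F).π d (spectralProj (locRep φ F).U (locRep φ F).continuous_U x.1.length
      (toLoc F (emb φ (tensor φ x)))) = 0 at h2
    rw [h3] at h2
    exact (locHom_toLoc F d.1 (emb φ (tensor φ x))).symm.trans h2
  have h4 := inner_toLoc F y y
  rw [h1, _root_.inner_zero_left, hb'] at h4
  exact hfb h4.symm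

end FockRep


open PreHilbert HilbertModule PreFock Fock

/-! ### Generators of the crossed product by the gauge action -/

section GaugeCrossed

variable {A : Type u} {X : Type v} [NonUnitalCStarAlgebra A] [NormedAddCommGroup X]
  [NormedSpace ℂ X] [CompleteSpace X] [HilbertModule A X] (φ : A →⋆ₙₐ[ℂ] Adjointable A X)
  (hfull : IsFull A X)

/-- `T_x` as an element of the Toeplitz algebra. -/
def toeplitzTensor (x : Word A X) : Toeplitz φ := ⟨_, creationTensor_mem_toeplitz φ hfull x⟩

theorem isHomog_toeplitzTensor (x : Word A X) :
    IsHomog (gauge φ) x.1.length (toeplitzTensor φ hfull x) := fun t => Subtype.ext (by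
  refine (gaugeAd_creationTensor φ t x).trans ?_
  change (t : ℂ) ^ x.1.length • _ = ((t ^ (x.1.length : ℤ) : Circle) : ℂ) • creationTensor φ x
  rw [zpow_natCast, Circle.coe_pow])

theorem exists_toeplitzTensor_product (x y z w : Word A X) : ∃ x' w' : Word A X,
    toeplitzTensor φ hfull x * star (toeplitzTensor φ hfull y) *
      (toeplitzTensor φ hfull z * star (toeplitzTensor φ hfull w))
        = toeplitzTensor φ hfull x' * star (toeplitzTensor φ hfull w') ∧
    ((y.1.length ≤ z.1.length ∧ x'.1.length = x.1.length + (z.1.length - y.1.length) ∧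
        w'.1.length = w.1.length) ∨
      (z.1.length ≤ y.1.length ∧ x'.1.length = x.1.length ∧
        w'.1.length = w.1.length + (y.1.length - z.1.length))) := by
  obtain ⟨x', w', h1, h2⟩ := exists_tensor_product φ x y z w
  exact ⟨x', w', Subtype.ext h1, h2⟩

/-- The elements `T_x P_l T_y⋆`. -/
def gen (x y : Word A X) (l : ℤ) : CovariantProd (gauge φ) :=
  coef (gauge φ) (toeplitzTensor φ hfull x) * specProj (gauge φ) l *
    star (coef (gauge φ) (toeplitzTensor φ hfull y))

/-- Moving the projection to the end shows that T_x P_l T_y⋆ starts from degree l + |y|;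
`gen_eq_mul'` shows that it ends in degree l + |x|. -/
theorem gen_eq_mul (x y : Word A X) (l : ℤ) : gen φ hfull x y l =
    coef (gauge φ) (toeplitzTensor φ hfull x * star (toeplitzTensor φ hfull y)) *
      specProj (gauge φ) (l + y.1.length) := by
  have := (isHomog_toeplitzTensor φ hfull y).star.specProj_mul (l + y.1.length)
  rw [add_neg_cancel_right] at this
  rw [gen, mul_assoc, ← map_star, this, ← mul_assoc, ← map_mul]

theorem gen_eq_mul' (x y : Word A X) (l : ℤ) : gen φ hfull x y l =
    specProj (gauge φ) (l + x.1.length) *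
      coef (gauge φ) (toeplitzTensor φ hfull x * star (toeplitzTensor φ hfull y)) := by
  have := (isHomog_toeplitzTensor φ hfull x).specProj_mul l
  rw [gen, ← this, ← map_star, mul_assoc, ← map_mul]

theorem star_gen (x y : Word A X) (l : ℤ) : star (gen φ hfull x y l) = gen φ hfull y x l := by
  rw [gen, star_mul, star_mul, star_star, star_specProj, gen, mul_assoc]

theorem specProj_mul_gen (n : ℤ) (x y : Word A X) (l : ℤ) :
    specProj (gauge φ) n * gen φ hfull x y l
      = if n = l + x.1.length then gen φ hfull x y l else 0 := by
  rw [gen_eq_mul', ← mul_assoc]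
  split_ifs with h
  · rw [h, specProj_mul_self]
  · rw [specProj_mul_of_ne _ h, zero_mul]

theorem gen_mul_specProj (n : ℤ) (x y : Word A X) (l : ℤ) :
    gen φ hfull x y l * specProj (gauge φ) n
      = if n = l + y.1.length then gen φ hfull x y l else 0 := by
  rw [gen_eq_mul, mul_assoc]
  split_ifs with h
  · rw [h, specProj_mul_self]
  · rw [specProj_mul_of_ne _ (Ne.symm h), mul_zero]

theorem gen_mul_gen_of_ne (x y z w : Word A X) {l m : ℤ} (h : l + y.1.length ≠ m + z.1.length) :
    gen φ hfull x y l * gen φ hfull z w m = 0 := by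
  rw [gen_eq_mul, mul_assoc, specProj_mul_gen, if_neg h, mul_zero]

/-- The level of the product is the minimum of the two levels. The inequalities make the I_n ideals;
the alternative l' = l or l' = m makes a single level closed under products. -/
theorem exists_gen_mul_gen (x y z w : Word A X) {l m : ℤ}
    (h : l + y.1.length = m + z.1.length) : ∃ x' w' l', l' ≤ l ∧ l' ≤ m ∧
      l' + x'.1.length = l + x.1.length ∧ l' + w'.1.length = m + w.1.length ∧ (l' = l ∨ l' = m) ∧
      gen φ hfull x y l * gen φ hfull z w m = gen φ hfull x' w' l' := by
  obtain ⟨x', w', h1, h2⟩ := exists_toeplitzTensor_product φ hfull x y z w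
  -- The product starts from the degree m + |w| of its right factor, so its level is this degree
  -- minus |w'|.
  refine ⟨x', w', m + w.1.length - w'.1.length, ?_, ?_, ?_, ?_, ?_, ?_⟩
  iterate 5 omega
  rw [gen_eq_mul, mul_assoc, specProj_mul_gen, if_pos h, gen_eq_mul, ← mul_assoc, ← map_mul, h1,
    gen_eq_mul, sub_add_cancel]

theorem relabel_gen (k : ℤ) (x y : Word A X) (l : ℤ) :
    relabel (gauge φ) k (gen φ hfull x y l) = gen φ hfull x y (l - k) := by
  rw [← relabelHom_apply, gen, map_mul, map_mul, map_star, relabelHom_apply, relabelHom_apply,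
    relabelHom_apply, relabel_coef, relabel_coef, relabel_specProj]
  rfl

/-! ### The ideals I_n, their monotonicity, union and behaviour under the dual action -/

/-- All elements `T_x P_l T_y⋆` with `l ≤ -n`. -/
def genSet (n : ℤ) : Set (CovariantProd (gauge φ)) :=
  {m | ∃ x y l, l ≤ -n ∧ m = gen φ hfull x y l}

/-- All elements `T_x P_l T_y⋆`. -/
def genAll : Set (CovariantProd (gauge φ)) := {m | ∃ x y l, m = gen φ hfull x y l}

theorem genSet_subset_genAll (n : ℤ) : genSet φ hfull n ⊆ genAll φ hfull := by
  rintro _ ⟨x, y, l, -, rfl⟩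
  exact ⟨x, y, l, rfl⟩

theorem genSet_anti {m n : ℤ} (h : m ≤ n) : genSet φ hfull n ⊆ genSet φ hfull m := by
  rintro _ ⟨x, y, l, hl, rfl⟩
  exact ⟨x, y, l, by omega, rfl⟩

theorem toeplitz_mem_cspan (d : Toeplitz φ) : d ∈ cspan {d : Toeplitz φ | ∃ x y,
    d = toeplitzTensor φ hfull x * star (toeplitzTensor φ hfull y)} := by
  refine mem_cspan_of_isometry (homCLM (NonUnitalStarSubalgebraClass.subtype (toeplitzSubalgebra φ)))
    isometry_subtype_coe ?_ (toeplitz_le_cspan φ d.2)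
  rintro _ ⟨x, y, rfl⟩
  exact ⟨_, ⟨x, y, rfl⟩, rfl⟩

theorem mem_crossedSubalgebra_gauge {b : CovariantProd (gauge φ)} :
    b ∈ crossedSubalgebra (gauge φ) ↔ b ∈ cspan (genAll φ hfull) := by
  rw [mem_crossedSubalgebra_iff (gauge φ) (S := {d : Toeplitz φ | ∃ x y,
    d = toeplitzTensor φ hfull x * star (toeplitzTensor φ hfull y)}) ?_ ?_ ?_
    (toeplitz_mem_cspan φ hfull)]
  · suffices h : {m | ∃ d ∈ {d : Toeplitz φ | ∃ x y,
        d = toeplitzTensor φ hfull x * star (toeplitzTensor φ hfull y)}, ∃ n,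
        m = coef (gauge φ) d * specProj (gauge φ) n} = genAll φ hfull by rw [h]
    refine Set.Subset.antisymm ?_ ?_
    · rintro _ ⟨_, ⟨x, y, rfl⟩, n, rfl⟩
      exact ⟨x, y, n - y.1.length, by rw [gen_eq_mul, sub_add_cancel]⟩
    · rintro _ ⟨x, y, l, rfl⟩
      exact ⟨_, ⟨x, y, rfl⟩, _, gen_eq_mul φ hfull x y l⟩
  · rintro _ ⟨x, y, rfl⟩
    exact ⟨_, (isHomog_toeplitzTensor φ hfull x).mul (isHomog_toeplitzTensor φ hfull y).star⟩
  · rintro _ ⟨x, y, rfl⟩ _ ⟨z, w, rfl⟩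
    obtain ⟨x', w', h, -⟩ := exists_toeplitzTensor_product φ hfull x y z w
    exact ⟨x', w', h⟩
  · rintro _ ⟨x, y, rfl⟩
    exact ⟨y, x, by rw [star_mul, star_star]⟩

theorem cspan_genSet_le (n : ℤ) {b : CovariantProd (gauge φ)} (hb : b ∈ cspan (genSet φ hfull n)) :
    b ∈ crossedSubalgebra (gauge φ) :=
  (mem_crossedSubalgebra_gauge φ hfull).2 (cspan_mono (genSet_subset_genAll φ hfull n) hb)

/-- Multiplication by any generator can only lower the level l, so the condition l ≤ -n survives. -/
theorem mul_mem_cspan_genSet (n : ℤ) {a b : CovariantProd (gauge φ)}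
    (ha : a ∈ cspan (genAll φ hfull)) (hb : b ∈ cspan (genSet φ hfull n)) :
    a * b ∈ cspan (genSet φ hfull n) := by
  refine mul_mem_of_cspan (isClosed_cspan _) ?_ ha hb
  rintro _ ⟨x, y, l, rfl⟩ _ ⟨z, w, m, hm, rfl⟩
  by_cases h : l + y.1.length = m + z.1.length
  · obtain ⟨x', w', l', -, h1, -, -, -, h2⟩ := exists_gen_mul_gen φ hfull x y z w h
    exact mem_cspan ⟨x', w', l', h1.trans hm, h2⟩
  · rw [gen_mul_gen_of_ne φ hfull x y z w h]
    exact zero_mem _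

theorem star_mem_cspan_genSet (n : ℤ) {b : CovariantProd (gauge φ)}
    (hb : b ∈ cspan (genSet φ hfull n)) : star b ∈ cspan (genSet φ hfull n) := by
  refine star_mem_of_cspan (isClosed_cspan _) ?_ hb
  rintro _ ⟨x, y, l, hl, rfl⟩
  exact mem_cspan ⟨y, x, l, hl, star_gen φ hfull x y l⟩

theorem star_mem_cspan_genAll {b : CovariantProd (gauge φ)}
    (hb : b ∈ cspan (genAll φ hfull)) : star b ∈ cspan (genAll φ hfull) := by
  rw [← mem_crossedSubalgebra_gauge] at *
  exact star_mem hb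

theorem mul_mem_cspan_genSet' (n : ℤ) {a b : CovariantProd (gauge φ)}
    (ha : a ∈ cspan (genAll φ hfull)) (hb : b ∈ cspan (genSet φ hfull n)) :
    b * a ∈ cspan (genSet φ hfull n) := by
  have := star_mem_cspan_genSet φ hfull n (mul_mem_cspan_genSet φ hfull n
    (star_mem_cspan_genAll φ hfull ha) (star_mem_cspan_genSet φ hfull n hb))
  rwa [star_mul, star_star, star_star] at this

theorem CrossedProduct.mem_cspan (b : CrossedProduct (gauge φ)) : b.1 ∈ cspan (genAll φ hfull) :=
  (mem_crossedSubalgebra_gauge φ hfull).1 b.2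

/-- The ideals `I_n` of the crossed product. -/
def gaugeIdeal (n : ℤ) : ClosedIdeal (CrossedProduct (gauge φ)) where
  carrier := {b | b.1 ∈ cspan (genSet φ hfull n)}
  add_mem' ha hb := add_mem (s := cspan (genSet φ hfull n)) ha hb
  zero_mem' := zero_mem (cspan (genSet φ hfull n))
  mul_mem' {a _} _ hb :=
    mul_mem_cspan_genSet φ hfull n (CrossedProduct.mem_cspan φ hfull a) hb
  smul_mem' c _ ha := (cspan (genSet φ hfull n)).smul_mem c ha
  star_mem' ha := star_mem_cspan_genSet φ hfull n ha
  isClosed_carrier := (isClosed_cspan _).preimage continuous_subtype_val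
  mul_left_mem b _ hx := mul_mem_cspan_genSet φ hfull n (CrossedProduct.mem_cspan φ hfull b) hx
  mul_right_mem b _ hx := mul_mem_cspan_genSet' φ hfull n (CrossedProduct.mem_cspan φ hfull b) hx

theorem gaugeIdeal_anti {m n : ℤ} (h : m ≤ n) :
    (gaugeIdeal φ hfull n).carrier ⊆ (gaugeIdeal φ hfull m).carrier :=
  fun _ hb => cspan_mono (genSet_anti φ hfull h) hb

theorem dualAction_mem_gaugeIdeal (k n : ℤ) {b : CrossedProduct (gauge φ)}
    (hb : b ∈ (gaugeIdeal φ hfull n).carrier) :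
    dualAction (gauge φ) k b ∈ (gaugeIdeal φ hfull (n + k)).carrier := by
  change relabel (gauge φ) k b.1 ∈ cspan _
  refine map_mem_cspan (homCLM (relabelHom (gauge φ) k)) ?_ hb
  rintro _ ⟨x, y, l, hl, rfl⟩
  exact mem_cspan ⟨x, y, l - k, by omega, relabel_gen φ hfull k x y l⟩

theorem dualAction_image_gaugeIdeal (k n : ℤ) :
    dualAction (gauge φ) k '' (gaugeIdeal φ hfull n).carrier
      = (gaugeIdeal φ hfull (n + k)).carrier := by
  refine Set.Subset.antisymm ?_ fun b hb => ⟨dualAction (gauge φ) (-k) b, ?_, ?_⟩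
  · rintro _ ⟨b, hb, rfl⟩
    exact dualAction_mem_gaugeIdeal φ hfull k n hb
  · have := dualAction_mem_gaugeIdeal φ hfull (-k) _ hb
    rwa [add_neg_cancel_right] at this
  · exact (dualAction (gauge φ) k).apply_symm_apply b

theorem closure_iUnion_gaugeIdeal :
    closure (⋃ n, (gaugeIdeal φ hfull n).carrier) = Set.univ := by
  let V : Submodule ℂ (CrossedProduct (gauge φ)) :=
    ⨆ n, (gaugeIdeal φ hfull n).toNonUnitalSubalgebra.toSubmodule
  have hV : (V : Set (CrossedProduct (gauge φ))) = ⋃ n, (gaugeIdeal φ hfull n).carrier := by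
    refine Submodule.coe_iSup_of_directed _ fun m n => ⟨min m n, ?_, ?_⟩
    · exact gaugeIdeal_anti φ hfull (min_le_left m n)
    · exact gaugeIdeal_anti φ hfull (min_le_right m n)
  rw [← hV]
  refine Set.eq_univ_of_forall fun b => ?_
  have h1 : b ∈ cspan (V : Set (CrossedProduct (gauge φ))) := by
    refine mem_cspan_of_isometry
      (homCLM (NonUnitalStarSubalgebraClass.subtype (crossedSubalgebra (gauge φ))))
      isometry_subtype_coe ?_ (CrossedProduct.mem_cspan φ hfull b)
    rintro _ ⟨x, y, l, rfl⟩
    -- A generator of level l already lies in I_{-l}.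
    have h2 : gen φ hfull x y l ∈ cspan (genSet φ hfull (-l)) :=
      CuntzPimsner.mem_cspan ⟨x, y, l, by omega, rfl⟩
    refine ⟨⟨_, cspan_genSet_le φ hfull _ h2⟩, ?_, rfl⟩
    rw [hV]
    exact Set.mem_iUnion.2 ⟨-l, h2⟩
  rwa [cspan, Submodule.span_eq] at h1

end GaugeCrossed


open PreHilbert HilbertModule PreFock Fock

/-! ### Corners of the crossed product -/

section Corner

variable {A : Type u} {X : Type v} [NonUnitalCStarAlgebra A] [NormedAddCommGroup X]
  [NormedSpace ℂ X] [CompleteSpace X] [HilbertModule A X] (φ : A →⋆ₙₐ[ℂ] Adjointable A X)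
  (hfull : IsFull A X)

/-- The inclusion of the core in the Toeplitz algebra. -/
def coreIncl : Core φ →⋆ₙₐ[ℂ] Toeplitz φ :=
  NonUnitalStarSubalgebra.inclusion (S := gradedSubalgebra φ Set.univ) (T := toeplitzSubalgebra φ)
    fun _ hd => core_le_toeplitz φ hfull hd

theorem inclusion_val {M : Type w} [NonUnitalCStarAlgebra M] {S T : NonUnitalStarSubalgebra ℂ M}
    (h : S ≤ T) (d : S) : (NonUnitalStarSubalgebra.inclusion h d).1 = d.1 := rfl

theorem coreIncl_val (d : Core φ) : (coreIncl φ hfull d).1 = d.1 :=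
  inclusion_val (S := gradedSubalgebra φ Set.univ) (T := toeplitzSubalgebra φ)
    (fun _ hd => core_le_toeplitz φ hfull hd) d

/-- In T_x T_y⋆ with |x| = |y| the scalars t^{|x|} and their conjugates cancel, so the core has
degree zero and commutes with every P_j. -/
theorem gaugeAd_core (t : Circle) {d : Adjointable A (Fock φ)} (hd : d ∈ cspan (coreGen φ 0)) :
    gaugeAd φ t d = d := by
  refine map_eq_of_cspan (homCLM (gaugeAd φ t : Adjointable A (Fock φ) →⋆ₙₐ[ℂ]
    Adjointable A (Fock φ))) (ContinuousLinearMap.id ℂ _) ?_ hd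
  rintro _ ⟨x, y, -, hxy, rfl⟩
  change gaugeAd φ t _ = _
  rw [map_mul, map_star, gaugeAd_creationTensor, gaugeAd_creationTensor, hxy, star_smul,
    smul_mul_smul_comm, ← Circle.coe_pow, Complex.star_def, ← Circle.coe_inv_eq_conj,
    ← Circle.coe_mul, mul_inv_cancel, Circle.coe_one, one_smul]
  rfl

theorem isHomog_coreIncl (d : Core φ) : IsHomog (gauge φ) 0 (coreIncl φ hfull d) := fun t => by
  rw [circleChar_zero, one_smul]
  have h : (coreIncl φ hfull d).1 ∈ cspan (coreGen φ 0) := by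
    rw [coreIncl_val]
    exact (mem_core_iff φ).1 d.2
  exact Subtype.ext (gaugeAd_core φ t h)

theorem specProj_mul_coreIncl (j : ℤ) (d : Core φ) :
    specProj (gauge φ) j * coef (gauge φ) (coreIncl φ hfull d)
      = coef (gauge φ) (coreIncl φ hfull d) * specProj (gauge φ) j := by
  have := (isHomog_coreIncl φ hfull d).specProj_mul j
  rwa [add_zero] at this

/-- The embedding `d ↦ d P_j` of the core in the crossed product. -/
def coreEmb (j : ℤ) : Core φ →⋆ₙₐ[ℂ] CrossedProduct (gauge φ) where
  toFun d := ⟨coef (gauge φ) (coreIncl φ hfull d) * specProj (gauge φ) j,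
    coef_mul_specProj_mem (gauge φ) _ j⟩
  map_smul' c d := Subtype.ext (by
    change coef (gauge φ) (coreIncl φ hfull (c • d)) * specProj (gauge φ) j = c • (coef (gauge φ) (coreIncl φ hfull d) * specProj (gauge φ) j)
    rw [map_smul, map_smul, smul_mul_assoc])
  map_zero' := Subtype.ext (by
    change coef (gauge φ) (coreIncl φ hfull (0)) * specProj (gauge φ) j = (0 : CovariantProd (gauge φ))
    rw [map_zero, map_zero, zero_mul])
  map_add' d e := Subtype.ext (by
    change coef (gauge φ) (coreIncl φ hfull (d + e)) * specProj (gauge φ) j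
      = coef (gauge φ) (coreIncl φ hfull d) * specProj (gauge φ) j + coef (gauge φ) (coreIncl φ hfull e) * specProj (gauge φ) j
    rw [map_add, map_add, add_mul])
  map_mul' d e := Subtype.ext (by
    change coef (gauge φ) (coreIncl φ hfull (d * e)) * specProj (gauge φ) j
      = coef (gauge φ) (coreIncl φ hfull d) * specProj (gauge φ) j * (coef (gauge φ) (coreIncl φ hfull e) * specProj (gauge φ) j)
    rw [mul_assoc, ← mul_assoc (specProj (gauge φ) j), specProj_mul_coreIncl, mul_assoc,
      specProj_mul_self, ← mul_assoc, map_mul, map_mul])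
  map_star' d := Subtype.ext (by
    change coef (gauge φ) (coreIncl φ hfull (star d)) * specProj (gauge φ) j
      = star (coef (gauge φ) (coreIncl φ hfull d) * specProj (gauge φ) j)
    rw [star_mul, star_specProj, ← map_star, ← map_star, specProj_mul_coreIncl])

theorem coreEmb_val (j : ℤ) (d : Core φ) : (coreEmb φ hfull j d).1 =
    coef (gauge φ) (coreIncl φ hfull d) * specProj (gauge φ) j := rfl

theorem specProj_mul_coreEmb (j : ℤ) (d : Core φ) :
    specProj (gauge φ) j * (coreEmb φ hfull j d).1 = (coreEmb φ hfull j d).1 := by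
  rw [coreEmb_val, ← mul_assoc, specProj_mul_coreIncl, mul_assoc, specProj_mul_self]

theorem coreEmb_mul_specProj (j : ℤ) (d : Core φ) :
    (coreEmb φ hfull j d).1 * specProj (gauge φ) j = (coreEmb φ hfull j d).1 := by
  rw [coreEmb_val, mul_assoc, specProj_mul_self]

theorem relabel_coreEmb (k j : ℤ) (d : Core φ) :
    relabel (gauge φ) k (coreEmb φ hfull j d).1 = (coreEmb φ hfull (j - k) d).1 := by
  rw [← relabelHom_apply, coreEmb_val, map_mul, relabelHom_apply, relabelHom_apply, relabel_coef,
    relabel_specProj, coreEmb_val]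

/-- For each word x the dual action carries d P_j to d P_{|x|}. If this vanishes, the localized Fock
representations give d x = 0. -/
theorem coreEmb_injective (j : ℤ) : Function.Injective (coreEmb φ hfull j) := by
  rw [injective_iff_map_eq_zero]
  intro d hd
  refine Subtype.ext (adjointable_ext fun x => ?_)
  rw [← coreIncl_val φ hfull]
  refine apply_tensor_eq_zero_of_locRep φ (coreIncl φ hfull d) x fun f => ?_
  have h1 := relabel_coreEmb φ hfull (j - x.1.length) j d
  rw [hd, sub_sub_cancel] at h1
  exact (congrArg (fun m : CovariantProd (gauge φ) => m.1 (locRep φ f)) h1).symm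

theorem isometry_coreEmb (j : ℤ) : Isometry (coreEmb φ hfull j) :=
  NonUnitalStarAlgHom.isometry _ (coreEmb_injective φ hfull j)

/-- `coreEmb` as a continuous linear map to the product of all representations. -/
def coreEmbL (j : ℤ) : Core φ →L[ℂ] CovariantProd (gauge φ) :=
  homCLM ((NonUnitalStarSubalgebraClass.subtype (crossedSubalgebra (gauge φ))).comp
    (coreEmb φ hfull j))

theorem isometry_coreEmbL (j : ℤ) : Isometry (coreEmbL φ hfull j) :=
  isometry_subtype_coe.comp (isometry_coreEmb φ hfull j)

/-! ### The corners P_j B P_j as copies of the core -/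

/-- The element `T_x T_y⋆` of the core. -/
def coreTensor (x y : Word A X) (h : y.1.length = x.1.length) : Core φ :=
  ⟨creationTensor φ x * star (creationTensor φ y), (mem_core_iff φ).2
    (mem_cspan ⟨x, y, Nat.zero_le _, h, rfl⟩)⟩

theorem coreEmb_coreTensor (x y : Word A X) (h : y.1.length = x.1.length) (j : ℤ) :
    (coreEmb φ hfull j (coreTensor φ x y h)).1 = gen φ hfull x y (j - x.1.length) := by
  rw [gen_eq_mul, h, sub_add_cancel]
  rfl

/-- Compression by `P_j`. -/
def compress (j : ℤ) : CovariantProd (gauge φ) →L[ℂ] CovariantProd (gauge φ) :=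
  ((ContinuousLinearMap.mul ℂ _).flip (specProj (gauge φ) j)).comp
    (ContinuousLinearMap.mul ℂ _ (specProj (gauge φ) j))

theorem compress_apply (j : ℤ) (b : CovariantProd (gauge φ)) :
    compress φ j b = specProj (gauge φ) j * b * specProj (gauge φ) j := rfl

theorem compress_coreEmb (j : ℤ) (d : Core φ) :
    compress φ j (coreEmb φ hfull j d).1 = (coreEmb φ hfull j d).1 := by
  rw [compress_apply, specProj_mul_coreEmb, coreEmb_mul_specProj]

/-- Compression by P_j kills T_x P_l T_y⋆ unless l + |x| = l + |y| = j, in which case it leaves T_x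
T_y⋆ P_j. The number N bounds below the words that survive, so the result comes from J_N; limits are
allowed because d ↦ d P_j is isometric. -/
theorem exists_coreEmb_eq_compress (j : ℤ) (N : ℕ) {S : Set (CovariantProd (gauge φ))}
    (hS : ∀ s ∈ S, ∃ x y l, (l + x.1.length = j → N ≤ x.1.length) ∧ s = gen φ hfull x y l)
    {b : CovariantProd (gauge φ)} (hb : b ∈ cspan S) :
    ∃ d : Core φ, d.1 ∈ cspan (coreGen φ N) ∧ (coreEmb φ hfull j d).1 = compress φ j b := by
  let ι : Core φ →L[ℂ] Adjointable A (Fock φ) :=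
    homCLM (NonUnitalStarSubalgebraClass.subtype (gradedSubalgebra φ Set.univ))
  let V : Submodule ℂ (Core φ) := (cspan (coreGen φ N)).comap (ι : Core φ →ₗ[ℂ] _)
  have hV : IsClosed (V : Set (Core φ)) := (isClosed_cspan _).preimage continuous_subtype_val
  have h1 : IsClosed ((V.map (coreEmbL φ hfull j : Core φ →ₗ[ℂ] CovariantProd (gauge φ)) :
      Submodule ℂ (CovariantProd (gauge φ))) : Set (CovariantProd (gauge φ))) := by
    rw [Submodule.map_coe]
    exact (isometry_coreEmbL φ hfull j).isClosedEmbedding.isClosedMap _ hV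
  suffices h2 : ∀ s ∈ S, compress φ j s ∈ V.map
      (coreEmbL φ hfull j : Core φ →ₗ[ℂ] CovariantProd (gauge φ)) by
    obtain ⟨d, hd, h3⟩ := map_mem_of_cspan (compress φ j) h1 h2 hb
    exact ⟨d, hd, h3⟩
  intro s hs
  obtain ⟨x, y, l, hN, rfl⟩ := hS s hs
  rw [compress_apply, specProj_mul_gen]
  split_ifs with hx
  · rw [gen_mul_specProj]
    split_ifs with hy
    · refine ⟨coreTensor φ x y (by omega), mem_cspan ⟨x, y, hN hx.symm, by omega, rfl⟩, ?_⟩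
      refine (coreEmb_coreTensor φ hfull x y (by omega) j).trans ?_
      rw [hx, add_sub_cancel_right]
    · exact zero_mem _
  · rw [zero_mul]; exact zero_mem _

theorem exists_coreEmb_eq_compress_genAll (j : ℤ) {b : CovariantProd (gauge φ)}
    (hb : b ∈ cspan (genAll φ hfull)) :
    ∃ d : Core φ, (coreEmb φ hfull j d).1 = compress φ j b := by
  obtain ⟨d, -, h⟩ := exists_coreEmb_eq_compress φ hfull j 0 (S := genAll φ hfull) (by
    rintro _ ⟨x, y, l, rfl⟩
    exact ⟨x, y, l, fun _ => Nat.zero_le _, rfl⟩) hb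
  exact ⟨d, h⟩

/-- From l ≤ -n and l + |x| = j follows |x| ≥ n + j. Truncation at zero covers the case where this
bound is negative and says nothing. -/
theorem exists_coreEmb_eq_compress_genSet (j n : ℤ) {b : CovariantProd (gauge φ)}
    (hb : b ∈ cspan (genSet φ hfull n)) : ∃ d : Core φ, d.1 ∈ cspan (coreGen φ (n + j).toNat) ∧
      (coreEmb φ hfull j d).1 = compress φ j b := by
  refine exists_coreEmb_eq_compress φ hfull j _ ?_ hb
  rintro _ ⟨x, y, l, hl, rfl⟩
  exact ⟨x, y, l, fun _ => by omega, rfl⟩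

theorem coreEmb_mem_cspan_genSet (j : ℤ) (N : ℕ) {d : Core φ} (hd : d.1 ∈ cspan (coreGen φ N)) :
    (coreEmb φ hfull j d).1 ∈ cspan (genSet φ hfull (N - j)) := by
  have h1 : d ∈ cspan {e : Core φ | ∃ x y h, N ≤ x.1.length ∧ e = coreTensor φ x y h} := by
    refine mem_cspan_of_isometry
      (homCLM (NonUnitalStarSubalgebraClass.subtype (gradedSubalgebra φ Set.univ)))
      isometry_subtype_coe ?_ hd
    rintro _ ⟨x, y, hx, hxy, rfl⟩
    exact ⟨coreTensor φ x y hxy, ⟨x, y, hxy, hx, rfl⟩, rfl⟩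
  refine map_mem_cspan (coreEmbL φ hfull j) ?_ h1
  rintro _ ⟨x, y, h, hx, rfl⟩
  exact mem_cspan ⟨x, y, j - x.1.length, by omega, coreEmb_coreTensor φ hfull x y h j⟩

/-! ### Detecting zero on corners -/

/-- Every generator absorbs some P_j on its left, so an element killed by all P_j annihilates the
whole crossed product, its own adjoint included. -/
theorem eq_zero_of_mul_specProj {b : CovariantProd (gauge φ)} (hb : b ∈ cspan (genAll φ hfull))
    (h : ∀ j, b * specProj (gauge φ) j = 0) : b = 0 := by
  refine eq_zero_of_mul_cspan ?_ (star_mem_cspan_genAll φ hfull hb)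
  rintro _ ⟨x, y, l, rfl⟩
  rw [gen_eq_mul', ← mul_assoc, h, zero_mul]

theorem eq_zero_of_compress {b : CovariantProd (gauge φ)} (hb : b ∈ cspan (genAll φ hfull))
    (h : ∀ j, compress φ j (star b * b) = 0) : b = 0 := by
  refine eq_zero_of_mul_specProj φ hfull hb fun j => eq_zero_of_star_mul_self ?_
  rw [star_mul, star_specProj, mul_assoc, ← mul_assoc (star b), ← mul_assoc]
  exact h j

theorem star_mul_self_mem_genAll {b : CovariantProd (gauge φ)} (hb : b ∈ cspan (genAll φ hfull)) :
    star b * b ∈ cspan (genAll φ hfull) := by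
  rw [← mem_crossedSubalgebra_gauge] at *
  exact mul_mem (star_mem hb) hb

/-- If b lies in every I_n, then P_j b⋆b P_j = d P_j with d in every J_n, so d = 0 for each j. -/
theorem iInter_gaugeIdeal : ⋂ n, (gaugeIdeal φ hfull n).carrier = {0} := by
  refine Set.Subset.antisymm (fun b hb => ?_) ?_
  · rw [Set.mem_iInter] at hb
    have hb0 := CrossedProduct.mem_cspan φ hfull b
    refine Subtype.ext (eq_zero_of_compress φ hfull hb0 fun j => ?_)
    have h1 : ∀ n, star b.1 * b.1 ∈ cspan (genSet φ hfull n) := fun n =>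
      mul_mem_cspan_genSet φ hfull n (star_mem_cspan_genAll φ hfull hb0) (hb n)
    obtain ⟨d, hd⟩ := exists_coreEmb_eq_compress_genAll φ hfull j
      (star_mul_self_mem_genAll φ hfull hb0)
    have h2 : d.1 = 0 := eq_zero_of_mem_all_coreIdeal φ fun n => by
      -- The index n - j compensates for the shift by j in the corner, so that e lies in J_n;
      -- injectivity then identifies e with d.
      obtain ⟨e, he, h3⟩ := exists_coreEmb_eq_compress_genSet φ hfull j (n - j) (h1 (n - j))
      rw [sub_add_cancel, Int.toNat_natCast] at he
      rwa [coreEmb_injective φ hfull j (Subtype.ext (hd.trans h3.symm))]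
    have h3 : d = 0 := Subtype.ext h2
    rw [← hd, h3, map_zero]
    rfl
  · rintro _ rfl
    exact Set.mem_iInter.2 fun n => zero_mem (gaugeIdeal φ hfull n).toNonUnitalStarSubalgebra

/-- For b in an ideal meeting I_n trivially, write P_j b⋆b P_j = d P_j. Multiplying by elements T_x
T_x⋆ P_j of I_n gives d T_x T_x⋆ = 0, hence d T_x = 0 for all long words x, and essentiality of the
ideals of the core yields d = 0. -/
theorem isEssential_gaugeIdeal (hK : ∀ a : A, φ a ∈ Compacts A X → φ a = 0)
    (hφ : Function.Injective φ) (n : ℤ) : (gaugeIdeal φ hfull n).IsEssential := by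
  intro J hJ b hb
  have hb0 := CrossedProduct.mem_cspan φ hfull b
  refine Subtype.ext (eq_zero_of_compress φ hfull hb0 fun j => ?_)
  obtain ⟨d, hd⟩ := exists_coreEmb_eq_compress_genAll φ hfull j
    (star_mul_self_mem_genAll φ hfull hb0)
  have h1 : d.1 = 0 := by
    refine eq_zero_of_mul_creationTensor φ hK hφ (n + j).toNat ((mem_core_iff φ).1 d.2)
      fun x hx => ?_
    have h2 : d * coreTensor φ x x rfl = 0 := by
      refine (injective_iff_map_eq_zero _).1 (coreEmb_injective φ hfull j) _ (Subtype.ext ?_)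
      -- The element T_x T_x⋆ P_j has level j - |x|, which is at most -n because |x| ≥ n + j.
      have h3 : (coreEmb φ hfull j (coreTensor φ x x rfl)).1 ∈ cspan (genSet φ hfull n) := by
        rw [coreEmb_coreTensor]
        exact mem_cspan ⟨x, x, _, by omega, rfl⟩
      have h4 := hJ (star b * b * coreEmb φ hfull j (coreTensor φ x x rfl))
        ((gaugeIdeal φ hfull n).mul_left_mem _ h3)
        (J.mul_right_mem _ (J.mul_left_mem _ hb))
      rw [map_mul]
      change (coreEmb φ hfull j d).1 * (coreEmb φ hfull j (coreTensor φ x x rfl)).1 = 0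
      have h5 : star b.1 * b.1 * (coreEmb φ hfull j (coreTensor φ x x rfl)).1 = 0 :=
        congrArg Subtype.val h4
      rw [hd, compress_apply, mul_assoc, specProj_mul_coreEmb, mul_assoc, h5, mul_zero]
    have h3 : d.1 * (creationTensor φ x * star (creationTensor φ x)) = 0 := congrArg Subtype.val h2
    refine eq_zero_of_mul_star_self ?_
    rw [star_mul, ← mul_assoc, mul_assoc d.1, h3, zero_mul]
  have h2 : d = 0 := Subtype.ext h1
  rw [← hd, h2, map_zero]
  rfl

/-! ### The projection in the multiplier algebra -/

theorem specProj_mul_mem (j : ℤ) {b : CovariantProd (gauge φ)} (hb : b ∈ cspan (genAll φ hfull)) :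
    specProj (gauge φ) j * b ∈ cspan (genAll φ hfull) := by
  refine map_mem_cspan (ContinuousLinearMap.mul ℂ _ (specProj (gauge φ) j)) ?_ hb
  rintro _ ⟨x, y, l, rfl⟩
  rw [ContinuousLinearMap.mul_apply', specProj_mul_gen]
  split_ifs
  · exact mem_cspan ⟨x, y, l, rfl⟩
  · exact zero_mem _

theorem mul_specProj_mem (j : ℤ) {b : CovariantProd (gauge φ)} (hb : b ∈ cspan (genAll φ hfull)) :
    b * specProj (gauge φ) j ∈ cspan (genAll φ hfull) := by
  have := star_mem_cspan_genAll φ hfull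
    (specProj_mul_mem φ hfull j (star_mem_cspan_genAll φ hfull hb))
  rwa [star_mul, star_star, star_specProj] at this

/-- The multiplier `P_j` of the crossed product. -/
def multiplierProj (j : ℤ) : DoubleCentralizer ℂ (CrossedProduct (gauge φ)) where
  fst := ((ContinuousLinearMap.mul ℂ (CovariantProd (gauge φ)) (specProj (gauge φ) j)).comp
    (homCLM (NonUnitalStarSubalgebraClass.subtype (crossedSubalgebra (gauge φ))))).codRestrict
      (crossedSubalgebra (gauge φ)).toNonUnitalSubalgebra.toSubmodule fun b =>
        (mem_crossedSubalgebra_gauge φ hfull).2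
          (specProj_mul_mem φ hfull j (CrossedProduct.mem_cspan φ hfull b))
  snd := (((ContinuousLinearMap.mul ℂ (CovariantProd (gauge φ))).flip (specProj (gauge φ) j)).comp
    (homCLM (NonUnitalStarSubalgebraClass.subtype (crossedSubalgebra (gauge φ))))).codRestrict
      (crossedSubalgebra (gauge φ)).toNonUnitalSubalgebra.toSubmodule fun b =>
        (mem_crossedSubalgebra_gauge φ hfull).2
          (mul_specProj_mem φ hfull j (CrossedProduct.mem_cspan φ hfull b))
  central x y := Subtype.ext (mul_assoc x.1 (specProj (gauge φ) j) y.1)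

theorem isStarProjection_multiplierProj (j : ℤ) : IsStarProjection (multiplierProj φ hfull j) where
  isIdempotentElem := DoubleCentralizer.ext _ _ _ _ (Prod.ext
    (ContinuousLinearMap.ext fun b => Subtype.ext (by
      change specProj (gauge φ) j * (specProj (gauge φ) j * b.1) = specProj (gauge φ) j * b.1
      rw [← mul_assoc, specProj_mul_self]))
    (ContinuousLinearMap.ext fun b => Subtype.ext (by
      change b.1 * specProj (gauge φ) j * specProj (gauge φ) j = b.1 * specProj (gauge φ) j
      rw [mul_assoc, specProj_mul_self])))
  isSelfAdjoint := DoubleCentralizer.ext _ _ _ _ (Prod.ext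
    (ContinuousLinearMap.ext fun b => Subtype.ext (by
      change star (star b.1 * specProj (gauge φ) j) = specProj (gauge φ) j * b.1
      rw [star_mul, star_star, star_specProj]))
    (ContinuousLinearMap.ext fun b => Subtype.ext (by
      change star (specProj (gauge φ) j * star b.1) = b.1 * specProj (gauge φ) j
      rw [star_mul, star_star, star_specProj])))

/-- A C⋆-algebra embeds in its multiplier algebra: the difference of a and b annihilates every
element, in particular its own adjoint. -/
theorem eq_of_coe_eq {B : Type w} [NonUnitalCStarAlgebra B] {a b : B}
    (h : (a : DoubleCentralizer ℂ B) = b) : a = b := by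
  have h1 : ∀ x, a * x = b * x := fun x => congrArg (fun m : DoubleCentralizer ℂ B => m.fst x) h
  rw [← sub_eq_zero]
  refine eq_zero_of_mul_star_self ?_
  rw [sub_mul, h1, sub_self]

theorem multiplierProj_mul_mul (j : ℤ) (b c : CrossedProduct (gauge φ)) :
    multiplierProj φ hfull j * (b : DoubleCentralizer ℂ (CrossedProduct (gauge φ))) *
      multiplierProj φ hfull j = c ↔ c.1 = compress φ j b.1 := by
  obtain ⟨e, he⟩ : ∃ e : CrossedProduct (gauge φ), e.1 = compress φ j b.1 :=
    ⟨⟨_, (mem_crossedSubalgebra_gauge φ hfull).2 (mul_specProj_mem φ hfull j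
      (specProj_mul_mem φ hfull j (CrossedProduct.mem_cspan φ hfull b)))⟩, rfl⟩
  have h1 : multiplierProj φ hfull j * (b : DoubleCentralizer ℂ (CrossedProduct (gauge φ))) *
      multiplierProj φ hfull j = e := DoubleCentralizer.ext _ _ _ _ (Prod.ext
    (ContinuousLinearMap.ext fun x => Subtype.ext (by
      change specProj (gauge φ) j * (b.1 * (specProj (gauge φ) j * x.1)) = e.1 * x.1
      rw [he, compress_apply, mul_assoc, mul_assoc]))
    (ContinuousLinearMap.ext fun x => Subtype.ext (by
      change x.1 * specProj (gauge φ) j * b.1 * specProj (gauge φ) j = x.1 * e.1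
      rw [he, compress_apply, mul_assoc, mul_assoc, mul_assoc])))
  rw [h1, ← he]
  exact ⟨fun h => congrArg Subtype.val (eq_of_coe_eq h).symm, fun h => by rw [Subtype.ext h]⟩

theorem mem_range_coreEmb_iff (j : ℤ) (b : CrossedProduct (gauge φ)) :
    b ∈ Set.range (coreEmb φ hfull j) ↔
      multiplierProj φ hfull j * (b : DoubleCentralizer ℂ (CrossedProduct (gauge φ))) *
        multiplierProj φ hfull j = b := by
  rw [multiplierProj_mul_mul]
  constructor
  · rintro ⟨d, rfl⟩
    exact (compress_coreEmb φ hfull j d).symm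
  · intro h
    obtain ⟨d, hd⟩ := exists_coreEmb_eq_compress_genAll φ hfull j
      (CrossedProduct.mem_cspan φ hfull b)
    exact ⟨d, Subtype.ext (hd.trans h.symm)⟩

theorem mem_image_coreIdeal_iff (n : ℕ) (b : CrossedProduct (gauge φ)) :
    b ∈ coreEmb φ hfull 0 '' coreIdeal φ n ↔ ∃ c ∈ (gaugeIdeal φ hfull n).carrier,
      (b : DoubleCentralizer ℂ (CrossedProduct (gauge φ))) =
        multiplierProj φ hfull 0 * (c : DoubleCentralizer ℂ (CrossedProduct (gauge φ))) *
          multiplierProj φ hfull 0 := by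
  constructor
  · rintro ⟨d, hd, rfl⟩
    refine ⟨coreEmb φ hfull 0 d, ?_, ((mem_range_coreEmb_iff φ hfull 0 _).1 ⟨d, rfl⟩).symm⟩
    have := coreEmb_mem_cspan_genSet φ hfull 0 n ((mem_gradedSubalgebra_Ici φ).1 hd)
    rwa [sub_zero] at this
  · rintro ⟨c, hc, h⟩
    obtain ⟨d, hd, h1⟩ := exists_coreEmb_eq_compress_genSet φ hfull 0 n hc
    rw [add_zero, Int.toNat_natCast] at hd
    exact ⟨d, (mem_gradedSubalgebra_Ici φ).2 hd, Subtype.ext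
      (h1.trans ((multiplierProj_mul_mul φ hfull 0 c b).1 h.symm).symm)⟩

/-- Let r = e P_j - P_j, so r = r P_j. Then (rb)(rb)⋆ = r (P_j bb⋆ P_j) r⋆, and P_j bb⋆ P_j = d P_j
with d in the core, where e and 1 act alike. Thus rb = 0; right multiplication follows by taking
adjoints. -/
theorem coe_coreEmb_of_unit (j : ℤ) (e : Core φ) (he : ∀ x, e * x = x ∧ x * e = x) :
    (coreEmb φ hfull j e : DoubleCentralizer ℂ (CrossedProduct (gauge φ)))
      = multiplierProj φ hfull j := by
  have h0 : star e = e := by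
    have h := congrArg star (he (star e)).1
    rwa [star_mul, star_star, (he (star e)).1, eq_comm, eq_comm] at h
  have hs : star (coreEmb φ hfull j e).1 = (coreEmb φ hfull j e).1 :=
    congrArg Subtype.val ((map_star (coreEmb φ hfull j) e).symm.trans (by rw [h0]))
  have h1 : ∀ b ∈ cspan (genAll φ hfull), (coreEmb φ hfull j e).1 * b
      = specProj (gauge φ) j * b := fun b hb => by
    rw [← sub_eq_zero, ← sub_mul]
    refine eq_zero_of_mul_star_self ?_
    obtain ⟨d, hd⟩ := exists_coreEmb_eq_compress_genAll φ hfull j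
      (b := b * star b) (by
        rw [← mem_crossedSubalgebra_gauge] at *
        exact mul_mem hb (star_mem hb))
    have h2 : (coreEmb φ hfull j e).1 * (coreEmb φ hfull j d).1 = (coreEmb φ hfull j d).1 :=
      congrArg Subtype.val ((map_mul (coreEmb φ hfull j) e d).symm.trans (by rw [(he d).1]))
    have h3 : (coreEmb φ hfull j e).1 - specProj (gauge φ) j
        = ((coreEmb φ hfull j e).1 - specProj (gauge φ) j) * specProj (gauge φ) j := by
      rw [sub_mul, coreEmb_mul_specProj, specProj_mul_self]
    have h4 : ((coreEmb φ hfull j e).1 - specProj (gauge φ) j) * compress φ j (b * star b) = 0 := by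
      rw [← hd, sub_mul, h2, specProj_mul_coreEmb, sub_self]
    rw [star_mul, ← mul_assoc, mul_assoc _ b, h3, star_mul, star_specProj, ← mul_assoc,
      mul_assoc _ (b * star b), mul_assoc _ _ (b * star b * _), ← mul_assoc (specProj (gauge φ) j),
      ← compress_apply, h4, zero_mul]
  refine DoubleCentralizer.ext _ _ _ _ (Prod.ext (ContinuousLinearMap.ext fun b => Subtype.ext ?_)
    (ContinuousLinearMap.ext fun b => Subtype.ext ?_))
  · exact h1 b.1 (CrossedProduct.mem_cspan φ hfull b)
  · have h2 := congrArg star (h1 _ (star_mem_cspan_genAll φ hfull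
      (CrossedProduct.mem_cspan φ hfull b)))
    rw [star_mul, star_mul, star_star, star_specProj, hs] at h2
    exact h2

end Corner


open PreHilbert HilbertModule PreFock Fock

/-! ### Morita equivalence of the core and the ideals -/

section CoreMorita

variable {A : Type u} {X : Type v} [NonUnitalCStarAlgebra A] [NormedAddCommGroup X]
  [NormedSpace ℂ X] [CompleteSpace X] [HilbertModule A X] (φ : A →⋆ₙₐ[ℂ] Adjointable A X)
  (hfull : IsFull A X)

/-- The projection P_{-n} retains only generators with l + |x| = -n, and these have l ≤ -n. So the
row space P_{-n} B lies in I_n. -/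
theorem mem_cspan_genSet_of_specProj_mul {n : ℤ} {b : CovariantProd (gauge φ)}
    (hb : b ∈ cspan (genAll φ hfull)) (h : specProj (gauge φ) (-n) * b = b) :
    b ∈ cspan (genSet φ hfull n) := by
  rw [← h]
  refine map_mem_cspan (ContinuousLinearMap.mul ℂ _ (specProj (gauge φ) (-n))) ?_ hb
  rintro _ ⟨x, y, l, rfl⟩
  rw [ContinuousLinearMap.mul_apply', specProj_mul_gen]
  split_ifs with hl
  · exact mem_cspan ⟨x, y, l, by omega, rfl⟩
  · exact zero_mem _

/-- `a ↦ T_{u a}` as a continuous linear map to the Toeplitz algebra. -/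
def toeplitzTensorL (u : List X) : A →L[ℂ] Toeplitz φ :=
  (creationTensorL φ u).codRestrict (toeplitzSubalgebra φ).toNonUnitalSubalgebra.toSubmodule
    fun a => by
      rw [creationTensorL_apply]
      exact creationTensor_mem_toeplitz φ hfull (u, a)

theorem toeplitzTensorL_apply (u : List X) (a : A) :
    toeplitzTensorL φ hfull u a = toeplitzTensor φ hfull (u, a) :=
  Subtype.ext (creationTensorL_apply φ u a)

theorem toeplitzTensor_mul_leftAction (u : List X) (a b : A) :
    toeplitzTensor φ hfull (u, a * b) = toeplitzTensor φ hfull (u, a) *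
      toeplitzTensor φ hfull ([], b) :=
  Subtype.ext (by
    change creationTensor φ (u, a * b) = creationTensor φ (u, a) * creationTensor φ ([], b)
    rw [creationTensor_nil, creationTensor_leftAction])

theorem toeplitz_leftAction_mem_cspan
    (hfull₂ : Dense (Submodule.span ℂ {a : A | ∃ (x y : X) (b : A), a = ip x (φ b y)} : Set A))
    (k : ℕ) (b : A) : toeplitzTensor φ hfull ([], b) ∈ cspan {d : Toeplitz φ |
      ∃ z w : Word A X, z.1.length = k ∧ w.1.length = k ∧
        d = star (toeplitzTensor φ hfull z) * toeplitzTensor φ hfull w} := by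
  refine mem_cspan_of_isometry (homCLM (NonUnitalStarSubalgebraClass.subtype (toeplitzSubalgebra φ)))
    isometry_subtype_coe ?_ (leftAction_mem_cspan φ hfull₂ k b)
  rintro _ ⟨z, w, hz, hw, rfl⟩
  exact ⟨_, ⟨z, w, hz, hw, rfl⟩, rfl⟩

/-- For words of equal length T_z⋆ T_w has degree zero and commutes with P_l. -/
theorem gen_mul_gen_eq (x z w y : Word A X) (l : ℤ) (h : z.1.length = w.1.length) :
    gen φ hfull x z l * gen φ hfull w y l = coef (gauge φ) (toeplitzTensor φ hfull x *
      (star (toeplitzTensor φ hfull z) * toeplitzTensor φ hfull w)) * specProj (gauge φ) l *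
        star (coef (gauge φ) (toeplitzTensor φ hfull y)) := by
  have h1 := ((isHomog_toeplitzTensor φ hfull z).star.mul
    (isHomog_toeplitzTensor φ hfull w)).specProj_mul l
  rw [h, neg_add_cancel, add_zero, map_mul, map_star] at h1
  rw [gen, gen, map_mul, map_mul, map_star]
  have h2 : specProj (gauge φ) l * star (coef (gauge φ) (toeplitzTensor φ hfull z)) *
      (coef (gauge φ) (toeplitzTensor φ hfull w) * specProj (gauge φ) l) =
      star (coef (gauge φ) (toeplitzTensor φ hfull z)) * coef (gauge φ) (toeplitzTensor φ hfull w) *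
        specProj (gauge φ) l := by
    rw [← mul_assoc, mul_assoc (specProj (gauge φ) l), h1, mul_assoc, specProj_mul_self]
  rw [mul_assoc (coef (gauge φ) (toeplitzTensor φ hfull x)), ← mul_assoc _ _ (star _),
    mul_assoc (coef (gauge φ) (toeplitzTensor φ hfull x)), h2, ← mul_assoc]

/-- Replace the coefficient a of x by ab and expand φ₊(b) into products T_z⋆ T_w with |z| = |w| = k.
The length k is free; it selects the degree l + k through which T_x P_l T_y⋆ is factored. -/
theorem gen_mem_cspan_mul
    (hfull₂ : Dense (Submodule.span ℂ {a : A | ∃ (x y : X) (b : A), a = ip x (φ b y)} : Set A))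
    (k : ℕ) (x y : Word A X) (l : ℤ) : gen φ hfull x y l ∈ cspan {m | ∃ z w : Word A X,
      z.1.length = k ∧ w.1.length = k ∧ m = gen φ hfull x z l * gen φ hfull w y l} := by
  let F : Toeplitz φ →L[ℂ] CovariantProd (gauge φ) :=
    ((ContinuousLinearMap.mul ℂ (CovariantProd (gauge φ))).flip
      (specProj (gauge φ) l * star (coef (gauge φ) (toeplitzTensor φ hfull y)))).comp
        (homCLM (coef (gauge φ)))
  have hF : ∀ d, F d = coef (gauge φ) d * specProj (gauge φ) l *
      star (coef (gauge φ) (toeplitzTensor φ hfull y)) := fun d => (mul_assoc _ _ _).symm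
  obtain ⟨u, a⟩ := x
  rw [gen, ← hF, ← toeplitzTensorL_apply]
  set Q := cspan {m | ∃ z w : Word A X, z.1.length = k ∧ w.1.length = k ∧
    m = gen φ hfull (u, a) z l * gen φ hfull w y l}
  refine mem_of_mul_mem (g := fun a => F (toeplitzTensorL φ hfull u a))
    (F.continuous.comp (toeplitzTensorL φ hfull u).continuous) (isClosed_cspan _) (P := Q)
    fun b => ?_
  change F (toeplitzTensorL φ hfull u (a * b)) ∈ Q
  rw [toeplitzTensorL_apply, toeplitzTensor_mul_leftAction]
  refine map_mem_cspan (F.comp (ContinuousLinearMap.mul ℂ _ (toeplitzTensor φ hfull (u, a)))) ?_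
    (toeplitz_leftAction_mem_cspan φ hfull hfull₂ k b)
  rintro _ ⟨z, w, hz, hw, rfl⟩
  refine mem_cspan ⟨z, w, hz, hw, ?_⟩
  rw [gen_mul_gen_eq φ hfull _ z w y l (hz.trans hw.symm)]
  exact hF _

/-- The elements `b` of the crossed product with `P_j b = b`. -/
def rowSpace (j : ℤ) : Submodule ℂ (CrossedProduct (gauge φ)) where
  carrier := {b | specProj (gauge φ) j * b.1 = b.1}
  add_mem' {a b} ha hb := by
    change specProj (gauge φ) j * (a.1 + b.1) = a.1 + b.1
    rw [mul_add, ha, hb]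
  zero_mem' := mul_zero _
  smul_mem' c a ha := by
    change specProj (gauge φ) j * (c • a.1) = c • a.1
    rw [mul_smul_comm, ha]

theorem isClosed_rowSpace (j : ℤ) : IsClosed (rowSpace φ j : Set (CrossedProduct (gauge φ))) :=
  isClosed_eq (continuous_const.mul continuous_subtype_val) continuous_subtype_val

theorem gen_mem_rowSpace (x y : Word A X) (l : ℤ) : ∃ b ∈ rowSpace φ (l + x.1.length),
    b.1 = gen φ hfull x y l :=
  ⟨⟨_, (mem_crossedSubalgebra_gauge φ hfull).2 (mem_cspan ⟨x, y, l, rfl⟩)⟩,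
    by
      change specProj (gauge φ) _ * gen φ hfull x y l = gen φ hfull x y l
      rw [specProj_mul_gen, if_pos rfl], rfl⟩

/-- The equivalence bimodule is the row space Y = P_{-n} B: Y Y⋆ lies in the corner P_{-n} B P_{-n},
a copy of the core, and Y⋆ Y spans I_n densely. -/
theorem moritaEquiv_core_gaugeIdeal
    (hfull₂ : Dense (Submodule.span ℂ {a : A | ∃ (x y : X) (b : A), a = ip x (φ b y)} : Set A))
    (n : ℤ) : MoritaEquiv (Core φ) (gaugeIdeal φ hfull n).Alg := by
  refine moritaEquiv_of_subspace.{max u v, max (u + 1) (v + 1)} (gaugeIdeal φ hfull n).toNonUnitalStarSubalgebra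
    (rowSpace φ (-n)) (isClosed_rowSpace φ (-n)) (coreEmb φ hfull (-n))
    (coreEmb_injective φ hfull (-n)) ?_ ?_ ?_ ?_ ?_ ?_
  · intro x hx s _
    change specProj (gauge φ) (-n) * (x.1 * s.1) = x.1 * s.1
    rw [← mul_assoc, hx]
  · intro x _ y hy
    exact (gaugeIdeal φ hfull n).mul_left_mem _ (mem_cspan_genSet_of_specProj_mul φ hfull
      (CrossedProduct.mem_cspan φ hfull y) hy)
  · intro c x _
    change specProj (gauge φ) (-n) * ((coreEmb φ hfull (-n) c).1 * x.1) = _ * x.1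
    rw [← mul_assoc, specProj_mul_coreEmb]
  · intro s hs
    refine mem_cspan_of_isometry
      (homCLM (NonUnitalStarSubalgebraClass.subtype (crossedSubalgebra (gauge φ))))
      isometry_subtype_coe subset_rfl (cspan_le (isClosed_cspan _) ?_ hs)
    rintro _ ⟨x, y, l, hl, rfl⟩
    -- The length k = -n - l is nonnegative since l ≤ -n, and it places the intermediate degree l +
    -- k at -n.
    refine cspan_mono ?_ (gen_mem_cspan_mul φ hfull hfull₂ (-n - l).toNat x y l)
    rintro _ ⟨z, w, hz, hw, rfl⟩
    obtain ⟨b, hb, h1⟩ := gen_mem_rowSpace φ hfull z x l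
    obtain ⟨c, hc, h2⟩ := gen_mem_rowSpace φ hfull w y l
    rw [show l + (z.1.length : ℤ) = -n by omega] at hb
    rw [show l + (w.1.length : ℤ) = -n by omega] at hc
    refine ⟨star b * c, ⟨b, hb, c, hc, rfl⟩, ?_⟩
    rw [← star_gen, ← h1, ← h2]
    rfl
  · intro x hx y hy
    obtain ⟨c, hc⟩ := exists_coreEmb_eq_compress_genAll φ hfull (-n)
      (CrossedProduct.mem_cspan φ hfull (x * star y))
    refine ⟨c, Subtype.ext (hc.trans ?_)⟩
    change specProj (gauge φ) (-n) * (x.1 * star y.1) * specProj (gauge φ) (-n) = x.1 * star y.1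
    have h1 := congrArg star (show specProj (gauge φ) (-n) * y.1 = y.1 from hy)
    rw [star_mul, star_specProj] at h1
    rw [← mul_assoc, show specProj (gauge φ) (-n) * x.1 = x.1 from hx, mul_assoc, h1]
  · intro c
    -- The corner is contained in the row space, so a product ce of core elements is the left inner
    -- product of c P_{-n} and e⋆ P_{-n}.
    refine mem_of_mul_mem continuous_id (isClosed_cspan _) fun e => mem_cspan
      ⟨coreEmb φ hfull (-n) c, specProj_mul_coreEmb φ hfull (-n) c,
        coreEmb φ hfull (-n) (star e), specProj_mul_coreEmb φ hfull (-n) (star e), ?_⟩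
    rw [← map_star, star_star, ← map_mul]
    rfl

end CoreMorita


open PreHilbert HilbertModule PreFock Fock

/-! ### Subquotients of the ideals -/

/-- For k in K and i in I, ‖k‖ = ‖f(k + i)‖ ≤ ‖k + i‖ and hence ‖i‖ ≤ 2‖k + i‖. Addition K × I → M
is bounded below, so its range is closed. -/
theorem isClosed_sup_of_map {M : Type u} {N : Type v} [NormedAddCommGroup M] [NormedSpace ℂ M]
    [CompleteSpace M] [NormedAddCommGroup N] [NormedSpace ℂ N] (f : M →L[ℂ] N)
    (hf : ∀ x, ‖f x‖ ≤ ‖x‖) {K I : Submodule ℂ M} (hKc : IsClosed (K : Set M))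
    (hIc : IsClosed (I : Set M)) (hK : ∀ k ∈ K, ‖f k‖ = ‖k‖) (hI : ∀ i ∈ I, f i = 0) :
    IsClosed ((K ⊔ I : Submodule ℂ M) : Set M) := by
  have : CompleteSpace K := hKc.completeSpace_coe
  have : CompleteSpace I := hIc.completeSpace_coe
  let g : K × I →L[ℂ] M := K.subtypeL.coprod I.subtypeL
  have h1 : ∀ p : K × I, ‖p‖ ≤ (2 : NNReal) * ‖g p‖ := fun p => by
    have h2 : g p = p.1 + p.2 := rfl
    have h3 : ‖(p.1 : M)‖ ≤ ‖g p‖ := by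
      have h4 := hf (g p)
      rwa [h2, map_add, hI _ p.2.2, add_zero, hK _ p.1.2, ← h2] at h4
    have h5 : ‖(p.2 : M)‖ ≤ ‖g p‖ + ‖(p.1 : M)‖ := by
      have h6 : (p.2 : M) = g p - p.1 := by rw [h2, add_sub_cancel_left]
      rw [h6]
      exact norm_sub_le _ _
    change ‖p‖ ≤ 2 * ‖g p‖
    rw [Prod.norm_def]
    exact max_le (h3.trans (by linarith [norm_nonneg (g p)])) (h5.trans (by linarith))
  have h2 := (ContinuousLinearMap.antilipschitz_of_bound g h1).isClosed_range g.uniformContinuous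
  have h3 : Set.range g = ((K ⊔ I : Submodule ℂ M) : Set M) := by
    ext x
    rw [SetLike.mem_coe, Submodule.mem_sup]
    constructor
    · rintro ⟨p, rfl⟩
      exact ⟨p.1, p.1.2, p.2, p.2.2, rfl⟩
    · rintro ⟨k, hk, i, hi, rfl⟩
      exact ⟨(⟨k, hk⟩, ⟨i, hi⟩), rfl⟩
  rwa [h3] at h2

section Subquotient

variable {A : Type u} {X : Type v} [NonUnitalCStarAlgebra A] [NormedAddCommGroup X]
  [NormedSpace ℂ X] [CompleteSpace X] [HilbertModule A X] (φ : A →⋆ₙₐ[ℂ] Adjointable A X)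
  (hfull : IsFull A X)

/-- The product of the localizations of the Fock representation. -/
def LocProd : Type (max u v) :=
  lp (fun f : PosFunctional A => Loc f (Fock φ) →L[ℂ] Loc f (Fock φ)) ∞

instance : NonUnitalCStarAlgebra (LocProd φ) :=
  inferInstanceAs (NonUnitalCStarAlgebra
    (lp (fun f : PosFunctional A => Loc f (Fock φ) →L[ℂ] Loc f (Fock φ)) ∞))

/-- Evaluation at the localized Fock representations. -/
def toLocProd : CovariantProd (gauge φ) →⋆ₙₐ[ℂ] LocProd φ where
  toFun x := ⟨fun f => x.1 (locRep φ f), memℓp_infty ⟨‖x‖, by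
    rintro _ ⟨f, rfl⟩
    exact lp.norm_apply_le_norm ENNReal.top_ne_zero x (locRep φ f)⟩⟩
  map_smul' _ _ := rfl
  map_zero' := rfl
  map_add' _ _ := rfl
  map_mul' _ _ := rfl
  map_star' _ := rfl

/-- The Fock representation with grading shifted by `n`. -/
def shiftRep (n : ℤ) : CovariantProd (gauge φ) →⋆ₙₐ[ℂ] LocProd φ :=
  (toLocProd φ).comp (relabelHom (gauge φ) (-n))

/-- In the shifted representation P_l becomes the projection onto Fock degree l + n, which is
negative. -/
theorem shiftRep_gen_of_lt {n l : ℤ} (h : l < -n) (x y : Word A X) :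
    shiftRep φ n (gen φ hfull x y l) = 0 := by
  have h1 : shiftRep φ n (specProj (gauge φ) l) = 0 := by
    change toLocProd φ (relabel (gauge φ) (-n) (specProj (gauge φ) l)) = 0
    rw [relabel_specProj]
    exact lp.ext (funext fun f => spectralProj_locRep_of_neg φ f (by omega))
  rw [gen, map_mul, map_mul, h1, mul_zero, zero_mul]

theorem shiftRep_eq_zero (n : ℤ) {b : CovariantProd (gauge φ)}
    (hb : b ∈ cspan (genSet φ hfull (n + 1))) : shiftRep φ n b = 0 := by
  refine map_eq_of_cspan (homCLM (shiftRep φ n)) 0 ?_ hb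
  rintro _ ⟨x, y, l, hl, rfl⟩
  exact shiftRep_gen_of_lt φ hfull (by omega) x y

theorem leftAction_mem_core (a : A) : leftAction φ a ∈ gradedSubalgebra φ Set.univ := by
  refine mem_of_mul_mem (g := leftHom φ) (continuous_starHom _)
    (NonUnitalStarSubalgebra.isClosed_topologicalClosure _) fun b => ?_
  refine (mem_core_iff φ).2 (mem_cspan ⟨([], a), ([], star b), le_rfl, rfl, ?_⟩)
  rw [creationTensor_nil, creationTensor_nil, star_leftAction, star_star, map_mul]
  rfl

/-- The left action as a homomorphism to the core. -/
def leftCore : A →⋆ₙₐ[ℂ] Core φ :=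
  NonUnitalStarAlgHom.codRestrict (leftHom φ) (gradedSubalgebra φ Set.univ) (leftAction_mem_core φ)

theorem leftCore_val (a : A) : (leftCore φ a).1 = leftAction φ a := rfl

theorem eq_zero_of_leftAction_vacuum {a : A}
    (h : ∀ b, leftAction φ a (emb φ (tensor φ ([], b))) = 0) : a = 0 := by
  have h1 := h (star a)
  rw [leftAction_tensor, ← norm_eq_zero] at h1
  exact eq_zero_of_mul_star_self (norm_eq_zero.1 ((norm_vacuum φ (a * star a)).symm.trans h1))

/-- The embedding `a ↦ a P_j` of the coefficient algebra. -/
def leftEmb (j : ℤ) : A →⋆ₙₐ[ℂ] CovariantProd (gauge φ) :=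
  ((NonUnitalStarSubalgebraClass.subtype (crossedSubalgebra (gauge φ))).comp
    (coreEmb φ hfull j)).comp (leftCore φ)

theorem leftEmb_apply (j : ℤ) (a : A) :
    leftEmb φ hfull j a = (coreEmb φ hfull j (leftCore φ a)).1 := rfl

/-- The shift turns φ₊(a) P_{-n} into φ₊(a) P_0, which acts on the vacuum vectors as left
multiplication by a. -/
theorem shiftRep_leftEmb_injective (n : ℤ) :
    Function.Injective ((shiftRep φ n).comp (leftEmb φ hfull (-n))) := by
  rw [injective_iff_map_eq_zero]
  intro a ha
  refine eq_zero_of_leftAction_vacuum φ fun b => ?_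
  have h1 : toLocProd φ (coreEmb φ hfull 0 (leftCore φ a)).1 = 0 := by
    have h2 := relabel_coreEmb φ hfull (-n) (-n) (leftCore φ a)
    rw [sub_self] at h2
    rw [← h2]
    exact ha
  have h2 := apply_tensor_eq_zero_of_locRep φ (coreIncl φ hfull (leftCore φ a)) ([], b)
    fun f => congrArg (fun m : LocProd φ => m.1 f) h1
  rwa [coreIncl_val, leftCore_val] at h2

theorem leftEmb_injective (j : ℤ) : Function.Injective (leftEmb φ hfull j) := by
  have h := shiftRep_leftEmb_injective φ hfull (-j)
  rw [neg_neg] at h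
  exact fun a b hab => h (congrArg (shiftRep φ (-j)) hab)

/-! ### The C⋆-algebra spanned by one level, a complement of I_{n+1} in I_n -/

/-- The elements `T_x P_{-n} T_y⋆`. -/
def levelGen (n : ℤ) : Set (CovariantProd (gauge φ)) := {m | ∃ x y, m = gen φ hfull x y (-n)}

theorem levelGen_subset (n : ℤ) : levelGen φ hfull n ⊆ genSet φ hfull n := by
  rintro _ ⟨x, y, rfl⟩
  exact ⟨x, y, -n, le_rfl, rfl⟩

/-- The closed span of the elements `T_x P_{-n} T_y⋆`. -/
def level (n : ℤ) : NonUnitalStarSubalgebra ℂ (CovariantProd (gauge φ)) :=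
  cspanAlg (levelGen φ hfull n)
    (by
      rintro _ ⟨x, y, rfl⟩ _ ⟨z, w, rfl⟩
      by_cases h : -n + (y.1.length : ℤ) = -n + z.1.length
      · obtain ⟨x', w', l', -, -, -, -, h1, h2⟩ := exists_gen_mul_gen φ hfull x y z w h
        rw [or_self] at h1
        exact mem_cspan ⟨x', w', by rw [h2, h1]⟩
      · rw [gen_mul_gen_of_ne φ hfull x y z w h]
        exact zero_mem _)
    (by
      rintro _ ⟨x, y, rfl⟩
      exact mem_cspan ⟨y, x, star_gen φ hfull x y (-n)⟩)

instance (n : ℤ) : IsClosed (level φ hfull n : Set (CovariantProd (gauge φ))) := isClosed_cspan _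

theorem leftEmb_mem_level (n : ℤ) (a : A) : leftEmb φ hfull (-n) a ∈ level φ hfull n := by
  refine mem_of_mul_mem (g := leftEmb φ hfull (-n)) (continuous_starHom _) (isClosed_cspan _)
    fun b => mem_cspan ⟨([], a), ([], star b), ?_⟩
  have h1 : leftCore φ (a * b) = coreTensor φ ([], a) ([], star b) rfl := Subtype.ext (by
    change leftHom φ (a * b) = creationTensor φ ([], a) * star (creationTensor φ ([], star b))
    rw [creationTensor_nil, creationTensor_nil, star_leftAction, star_star, map_mul]
    rfl)
  rw [leftEmb_apply, h1, coreEmb_coreTensor]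
  change gen φ hfull _ _ (-n - ((0 : ℕ) : ℤ)) = _
  rw [Nat.cast_zero, sub_zero]

/-- At level -n only the empty words end and start in degree -n, so the corner of this algebra at
P_{-n} is φ₊(A) P_{-n}. -/
theorem exists_leftEmb_eq_compress (n : ℤ) {b : CovariantProd (gauge φ)}
    (hb : b ∈ level φ hfull n) : ∃ a, leftEmb φ hfull (-n) a = compress φ (-n) b := by
  let L : A →L[ℂ] CovariantProd (gauge φ) := homCLM (leftEmb φ hfull (-n))
  have h1 : IsClosed ((LinearMap.range (L : A →ₗ[ℂ] CovariantProd (gauge φ)) :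
      Submodule ℂ (CovariantProd (gauge φ))) : Set (CovariantProd (gauge φ))) := by
    rw [LinearMap.coe_range]
    exact (NonUnitalStarAlgHom.isometry _
      (leftEmb_injective φ hfull (-n))).isClosedEmbedding.isClosed_range
  refine map_mem_of_cspan (compress φ (-n)) h1 ?_ hb
  rintro _ ⟨⟨u, a⟩, ⟨v, b⟩, rfl⟩
  rw [compress_apply, specProj_mul_gen]
  split_ifs with hx
  · rw [gen_mul_specProj]
    split_ifs with hy
    · obtain rfl : u = [] := List.length_eq_zero_iff.1 (by
        change -n = -n + (u.length : ℤ) at hx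
        omega)
      obtain rfl : v = [] := List.length_eq_zero_iff.1 (by
        change -n = -n + (v.length : ℤ) at hy
        omega)
      refine ⟨a * star b, ?_⟩
      have h2 : leftCore φ (a * star b) = coreTensor φ ([], a) ([], b) rfl := Subtype.ext (by
        change leftHom φ (a * star b) = creationTensor φ ([], a) * star (creationTensor φ ([], b))
        rw [creationTensor_nil, creationTensor_nil, star_leftAction, map_mul]
        rfl)
      change leftEmb φ hfull (-n) _ = _
      rw [leftEmb_apply, h2, coreEmb_coreTensor]
      change gen φ hfull _ _ (-n - ((0 : ℕ) : ℤ)) = _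
      rw [Nat.cast_zero, sub_zero]
    · exact zero_mem _
  · rw [zero_mul]; exact zero_mem _

/-- The elements `b` of `level n` with `P_{-n} b = b`. -/
def levelRow (n : ℤ) : Submodule ℂ (CovariantProd (gauge φ)) where
  carrier := {b | b ∈ level φ hfull n ∧ specProj (gauge φ) (-n) * b = b}
  add_mem' {a b} ha hb := ⟨add_mem ha.1 hb.1, by rw [mul_add, ha.2, hb.2]⟩
  zero_mem' := ⟨zero_mem _, mul_zero _⟩
  smul_mem' c a ha := ⟨SMulMemClass.smul_mem c ha.1, by rw [mul_smul_comm, ha.2]⟩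

theorem isClosed_levelRow (n : ℤ) :
    IsClosed (levelRow φ hfull n : Set (CovariantProd (gauge φ))) :=
  (isClosed_cspan _).inter (isClosed_eq (continuous_const.mul continuous_id) continuous_id)

theorem compress_levelRow {n : ℤ} {x y : CovariantProd (gauge φ)} (hx : x ∈ levelRow φ hfull n)
    (hy : y ∈ levelRow φ hfull n) (b : CovariantProd (gauge φ)) :
    compress φ (-n) (x * b * star y) = x * b * star y := by
  have h1 := congrArg star hy.2
  rw [star_mul, star_specProj] at h1
  rw [compress_apply, ← mul_assoc, ← mul_assoc, hx.2, mul_assoc, h1]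

theorem level_mem_cspan_mul
    (hfull₂ : Dense (Submodule.span ℂ {a : A | ∃ (x y : X) (b : A), a = ip x (φ b y)} : Set A))
    (n : ℤ) {b : CovariantProd (gauge φ)} (hb : b ∈ level φ hfull n) :
    b ∈ cspan {m | ∃ x ∈ levelRow φ hfull n, ∃ y ∈ levelRow φ hfull n, m = star x * y} := by
  refine cspan_le (isClosed_cspan _) ?_ hb
  rintro _ ⟨x, y, rfl⟩
  refine cspan_mono ?_ (gen_mem_cspan_mul φ hfull hfull₂ 0 x y (-n))
  have h1 : ∀ z w : Word A X, z.1.length = 0 → gen φ hfull z w (-n) ∈ levelRow φ hfull n :=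
    fun z w hz => ⟨mem_cspan ⟨z, w, rfl⟩, by
      rw [specProj_mul_gen, hz, Nat.cast_zero, add_zero, if_pos rfl]⟩
  rintro _ ⟨z, w, hz, hw, rfl⟩
  exact ⟨gen φ hfull z x (-n), h1 z x hz, gen φ hfull w y (-n), h1 w y hw, by rw [star_gen]⟩

/-- The bimodule is the row at P_{-n} of the level algebra; its corner there is a copy of A, and
factoring through words of length 0 gives fullness. -/
theorem moritaEquiv_level
    (hfull₂ : Dense (Submodule.span ℂ {a : A | ∃ (x y : X) (b : A), a = ip x (φ b y)} : Set A))
    (n : ℤ) : MoritaEquiv A (level φ hfull n) := by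
  have h0 : ∀ a, leftEmb φ hfull (-n) a ∈ levelRow φ hfull n := fun a =>
    ⟨leftEmb_mem_level φ hfull n a, specProj_mul_coreEmb φ hfull (-n) _⟩
  refine moritaEquiv_of_subspace.{u, max (u + 1) (v + 1)} (level φ hfull n)
    (levelRow φ hfull n) (isClosed_levelRow φ hfull n) (leftEmb φ hfull (-n))
    (leftEmb_injective φ hfull (-n)) ?_ ?_ ?_ ?_ ?_ ?_
  · exact fun x hx s hs => ⟨mul_mem hx.1 hs, by rw [← mul_assoc, hx.2]⟩
  · exact fun x hx y hy => mul_mem (star_mem hx.1) hy.1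
  · exact fun c x hx => ⟨mul_mem (h0 c).1 hx.1, by rw [← mul_assoc, (h0 c).2]⟩
  · exact fun s hs => level_mem_cspan_mul φ hfull hfull₂ n hs
  · intro x hx y hy
    obtain ⟨c, hc⟩ := exists_leftEmb_eq_compress φ hfull n (mul_mem hx.1 (star_mem hy.1))
    refine ⟨c, hc.trans ?_⟩
    have h1 := congrArg star hy.2
    rw [star_mul, star_specProj] at h1
    rw [compress_apply, ← mul_assoc, hx.2, mul_assoc, h1]
  · intro c
    refine mem_of_mul_mem continuous_id (isClosed_cspan _) fun e => mem_cspan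
      ⟨_, h0 c, _, h0 (star e), ?_⟩
    rw [← map_star, star_star, ← map_mul]
    rfl

/-- If b is in the kernel and x is in the row, then x bb⋆ x⋆ lies in the corner φ₊(A) P_{-n}, where
the representation is faithful, so xb = 0. Since b⋆ is a limit of combinations of products x⋆y of
row elements, b⋆b = 0. -/
theorem shiftRep_injOn_level
    (hfull₂ : Dense (Submodule.span ℂ {a : A | ∃ (x y : X) (b : A), a = ip x (φ b y)} : Set A))
    (n : ℤ) {b : CovariantProd (gauge φ)} (hb : b ∈ level φ hfull n) (h : shiftRep φ n b = 0) :
    b = 0 := by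
  have h1 : ∀ x ∈ levelRow φ hfull n, x * b = 0 := fun x hx => by
    refine eq_zero_of_mul_star_self ?_
    obtain ⟨c, hc⟩ := exists_leftEmb_eq_compress φ hfull n
      (mul_mem (mul_mem hx.1 (mul_mem hb (star_mem hb))) (star_mem hx.1))
    rw [compress_levelRow φ hfull hx hx] at hc
    have h2 : ((shiftRep φ n).comp (leftEmb φ hfull (-n))) c = 0 := by
      change shiftRep φ n (leftEmb φ hfull (-n) c) = 0
      rw [hc, map_mul, map_mul, map_mul, h, zero_mul, mul_zero, zero_mul]
    rw [star_mul, mul_assoc, ← mul_assoc b, ← mul_assoc, ← hc,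
      (injective_iff_map_eq_zero _).1 (shiftRep_leftEmb_injective φ hfull n) c h2, map_zero]
  refine eq_zero_of_star_mul_self ?_
  refine map_eq_of_cspan ((ContinuousLinearMap.mul ℂ (CovariantProd (gauge φ))).flip b) 0 ?_
    (level_mem_cspan_mul φ hfull hfull₂ n (star_mem hb))
  rintro _ ⟨x, -, y, hy, rfl⟩
  change star x * y * b = 0
  rw [mul_assoc, h1 y hy, mul_zero]

/-- Every generator of I_n has level -n or level at most -(n + 1). The sum of the two closed spans
is closed, since the shifted Fock representation is isometric on the first and zero on the second.
-/
theorem exists_level_add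
    (hfull₂ : Dense (Submodule.span ℂ {a : A | ∃ (x y : X) (b : A), a = ip x (φ b y)} : Set A))
    (n : ℤ) {b : CovariantProd (gauge φ)} (hb : b ∈ cspan (genSet φ hfull n)) :
    ∃ k ∈ level φ hfull n, ∃ i ∈ cspan (genSet φ hfull (n + 1)), k + i = b := by
  let σ := (shiftRep φ n).comp (NonUnitalStarSubalgebraClass.subtype (level φ hfull n))
  have hσ : Isometry σ := NonUnitalStarAlgHom.isometry σ (by
    rw [injective_iff_map_eq_zero]
    exact fun k hk => Subtype.ext (shiftRep_injOn_level φ hfull hfull₂ n k.2 hk))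
  have h1 : IsClosed ((cspan (levelGen φ hfull n) ⊔ cspan (genSet φ hfull (n + 1)) :
      Submodule ℂ (CovariantProd (gauge φ))) : Set (CovariantProd (gauge φ))) :=
    isClosed_sup_of_map (homCLM (shiftRep φ n))
      (fun x => NonUnitalStarAlgHom.norm_apply_le (shiftRep φ n) x) (isClosed_cspan _)
      (isClosed_cspan _) (fun k hk => hσ.norm_map_of_map_zero (map_zero σ) ⟨k, hk⟩)
      fun i hi => shiftRep_eq_zero φ hfull n hi
  refine Submodule.mem_sup.1 (cspan_le h1 ?_ hb)
  rintro _ ⟨x, y, l, hl, rfl⟩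
  rcases hl.eq_or_lt with rfl | hl
  · exact Submodule.mem_sup_left (mem_cspan ⟨x, y, rfl⟩)
  · exact Submodule.mem_sup_right (mem_cspan ⟨x, y, l, by omega, rfl⟩)

/-- The level algebra itself serves as the quotient. The quotient map sends b to the element of the
level algebra with the same image in the shifted Fock representation; faithfulness there makes it a
`⋆`-homomorphism, and its kernel is I_{n+1}. -/
theorem moritaEquivQuotient_gaugeIdeal
    (hfull₂ : Dense (Submodule.span ℂ {a : A | ∃ (x y : X) (b : A), a = ip x (φ b y)} : Set A))
    (n : ℤ) :
    ClosedIdeal.MoritaEquivQuotient A (gaugeIdeal φ hfull n) (gaugeIdeal φ hfull (n + 1)) := by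
  refine ⟨gaugeIdeal_anti φ hfull (by omega), level φ hfull n, inferInstance, ?_⟩
  let σ := (shiftRep φ n).comp (NonUnitalStarSubalgebraClass.subtype (level φ hfull n))
  let τ : (gaugeIdeal φ hfull n).Alg →⋆ₙₐ[ℂ] LocProd φ :=
    ((shiftRep φ n).comp (NonUnitalStarSubalgebraClass.subtype (crossedSubalgebra (gauge φ)))).comp
      (NonUnitalStarSubalgebraClass.subtype (gaugeIdeal φ hfull n).toNonUnitalStarSubalgebra)
  have hσ : Function.Injective σ := by
    rw [injective_iff_map_eq_zero]
    exact fun k hk => Subtype.ext (shiftRep_injOn_level φ hfull hfull₂ n k.2 hk)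
  have h1 : ∀ b : (gaugeIdeal φ hfull n).Alg, ∃ k : level φ hfull n, σ k = τ b ∧
      b.1.1 - k.1 ∈ cspan (genSet φ hfull (n + 1)) := fun b => by
    obtain ⟨k, hk, i, hi, h⟩ := exists_level_add φ hfull hfull₂ n b.2
    refine ⟨⟨k, hk⟩, ?_, ?_⟩
    · change shiftRep φ n k = shiftRep φ n b.1.1
      rw [← h, map_add, shiftRep_eq_zero φ hfull n hi, add_zero]
    · rwa [← h, add_sub_cancel_left]
  choose q hq hq' using h1
  refine ⟨{ toFun := q
            map_smul' := fun c b => hσ (by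
              rw [hq, map_smul, map_smul, hq]; rfl)
            map_zero' := hσ (by rw [hq, map_zero, map_zero])
            map_add' := fun a b => hσ (by rw [hq, map_add, map_add, hq, hq])
            map_mul' := fun a b => hσ (by rw [hq, map_mul, map_mul, hq, hq])
            map_star' := fun a => hσ (by rw [hq, map_star, map_star, hq]) }, ?_, ?_, ?_⟩
  · intro k
    have h2 : k.1 ∈ cspan (genSet φ hfull n) := cspan_mono (levelGen_subset φ hfull n) k.2
    -- The level algebra is contained in I_n, and each of its elements is its own image.
    refine ⟨⟨⟨k.1, cspan_genSet_le φ hfull n h2⟩, h2⟩, hσ ?_⟩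
    exact hq _
  · intro b
    change q b = 0 ↔ b.1.1 ∈ cspan (genSet φ hfull (n + 1))
    constructor
    · intro h
      have h2 := hq' b
      rw [h] at h2
      rwa [← sub_zero b.1.1]
    · intro h
      refine hσ ?_
      rw [hq, map_zero]
      exact shiftRep_eq_zero φ hfull n h
  · exact moritaEquiv_level φ hfull hfull₂ n

end Subquotient

end CuntzPimsner

end

open CuntzPimsner PreHilbert in
theorem mainTheorem7 {A : Type*} [NonUnitalCStarAlgebra A]
    {E : Type*} [NormedAddCommGroup E] [NormedSpace ℂ E] [CompleteSpace E] [HilbertModule A E]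
    (φ : A →⋆ₙₐ[ℂ] Adjointable A E) (hφ : Function.Injective φ)
    (hfull : IsFull A E)
    (hfull₂ : Dense (Submodule.span ℂ {a : A | ∃ (x y : E) (b : A), a = ip x (φ b y)} : Set A))
    (hK : ∀ a : A, φ a ∈ Compacts A E → φ a = 0) :
    ∃ (ε : Core φ →⋆ₙₐ[ℂ] CrossedProduct (gauge φ))
      (p : DoubleCentralizer ℂ (CrossedProduct (gauge φ)))
      (I : ℤ → ClosedIdeal (CrossedProduct (gauge φ))),
      Function.Injective ε ∧
      IsStarProjection p ∧
      (∀ b : CrossedProduct (gauge φ), b ∈ Set.range ε ↔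
        p * (b : DoubleCentralizer ℂ (CrossedProduct (gauge φ))) * p = b) ∧
      (∀ e : Core φ, (∀ x, e * x = x ∧ x * e = x) →
        (ε e : DoubleCentralizer ℂ (CrossedProduct (gauge φ))) = p) ∧
      (∀ n, (I n).IsEssential) ∧
      (∀ n, MoritaEquiv (Core φ) (I n).Alg ∧
        ClosedIdeal.MoritaEquivQuotient A (I n) (I (n + 1))) ∧
      (∀ (n : ℕ) (b : CrossedProduct (gauge φ)), b ∈ ε '' coreIdeal φ n ↔
        ∃ c ∈ (I n).carrier, (b : DoubleCentralizer ℂ (CrossedProduct (gauge φ))) =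
          p * (c : DoubleCentralizer ℂ (CrossedProduct (gauge φ))) * p) ∧
      (∀ m n, m ≤ n → (I n).carrier ⊆ (I m).carrier) ∧
      (⋂ n, (I n).carrier) = {0} ∧
      closure (⋃ n, (I n).carrier) = Set.univ ∧
      (∀ k n, dualAction (gauge φ) k '' (I n).carrier = (I (n + k)).carrier) := by
  -- The corner is taken in degree 0: there the bound |x| ≥ n + j is |x| ≥ n, which matches J_n with
  -- I_n without a shift.
  refine ⟨coreEmb φ hfull 0, multiplierProj φ hfull 0, gaugeIdeal φ hfull,
    coreEmb_injective φ hfull 0, isStarProjection_multiplierProj φ hfull 0,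
    mem_range_coreEmb_iff φ hfull 0, coe_coreEmb_of_unit φ hfull 0,
    isEssential_gaugeIdeal φ hfull hK hφ,
    fun n => ⟨moritaEquiv_core_gaugeIdeal φ hfull hfull₂ n,
      moritaEquivQuotient_gaugeIdeal φ hfull hfull₂ n⟩,
    mem_image_coreIdeal_iff φ hfull, fun _ _ h => gaugeIdeal_anti φ hfull h,
    iInter_gaugeIdeal φ hfull, closure_iUnion_gaugeIdeal φ hfull,
    dualAction_image_gaugeIdeal φ hfull⟩
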